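/- **Definitions.** All graphs are finite, simple, undirected and unweighted. A *$3$-separated clustering of $G=(V,E)$ with weak diameter $D$ and average overlap at most $\xi$* is a collection $\mathcal C$ of disjoint vertex sets (clusters), each $C\in\mathcal C$ coming with a tree $T_C\subseteq G$ with $C\subseteq V(T_C)$, such that (i) $\mathrm{diam}(T_C)\le D$ for all $C\in\mathcal C$, (ii) $d_G(C_1,C_2)\ge 3$ for all distinct $C_1,C_2\in\mathcal C$, (iii) $|\bigcup_{C\in\mathcal C}C|\ge |V|/2$, (iv) $\sum_{C\in\mathcal C}|V(T_C)|\le \xi\,|V|$. A *$\beta$-spanner* of $G$ is a subgraph $H$ on the same vertex set with $d_H(u,v)\le\beta\, d_G(u,v)$ for all $u,v$. An *$r$-cluster-graph* of a network $G$ is obtained by contracting the clusters of a partition of $V(G)$, each of which contains a rooted spanning tree of radius at most $r$ in its induced subgraph; an algorithm on it communicates over $G$, every node of $G$ knowing the name of its cluster and its tree parent. *Algorithms.* An algorithm is either a $\mathsf{CONGEST}$ algorithm (synchronous rounds, one $O(\log n)$-bit message per edge, direction and round, unique $O(\log n)$-bit identifiers, private random bits) or a (priority CRCW) $\mathsf{PRAM}$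 algorithm on $O(\log n)$-bit words; it is deterministic if it uses no random bits. The number $n$ is known to the algorithm and is an upper bound on the number of nodes of the network (in $\mathsf{PRAM}$: the graph is stored in $n$ vertex slots and $m\le n^2$ edge slots, some of which may be unused). Algorithms may fail with probability at most $\delta(n)<1$ ($\delta=0$: they never fail). **Theorem.** Let $D(n)\ge1$, $\xi_{\mathrm{AVG}}(n)$ and $\delta(n)<1$ be functions, and let $A$ be an algorithm which, on every graph with parameter $n$, finds, except with probability $\delta(n)$, a $3$-separated clustering with weak diameter $D(n)$ and average overlap at most $\xi_{\mathrm{AVG}}(n)$. Then there is an algorithm $A'$ which, on every such graph $G$, builds, except with probability $(\lfloor\log_2 n\rfloor+1)\,\delta(n)$, a $\beta$-spanner $H$ with $|E(H)|=O(\xi_{\mathrm{AVG}}(n)\cdot|V(G)|)$ and $\beta=O(D(n))$. If $A$ is deterministic, then so is $A'$. Moreover, for $n\ge2$: 1. If $A$ is a $\mathsf{CONGEST}$ algorithm on graphs that requires at most $T(n)$ rounds, where $T\ge1$, then $A'$ is a $\mathsf{CONGEST}$ algorithm that requires $O(\log(n)\,T(n))$ rounds. 2. If $A$ is a $\mathsf{CONGEST}$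 algorithm that works on $r$-cluster-graphs for all $r\geq 0$, in at most $T(n,r)$ rounds, where $T\ge 1$, then so does $A'$, in $O(\log(n)\,(T(n,r)+r))$ rounds. 3. If $A$ is a $\mathsf{PRAM}$ algorithm with depth $T(n)$ and work $W(m,n)$, then $A'$ is a $\mathsf{PRAM}$ algorithm with depth $O(\log(n)\,T(n))$ and work $O\big(\mathrm{poly}(\log n)\,(W(m,n)+m+n\,\xi_{\mathrm{AVG}}(n))\big)$. (Here the time bounds of $A$ and $A'$ are understood to hold whenever the algorithm does not fail.) All constants in $O(\cdot)$ and the degree of the polynomial are absolute. -/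

import Mathlib

namespace SpannersViaClusterings

noncomputable section

/-! ### Clusterings and spanners -/

/-- A `t`-separated clustering of `G` with weak diameter `D` and average overlap at most `ξ`.
The cluster with label `ℓ` is `{v | cl v = some ℓ}` and `T ℓ` is the tree it comes with;
labels that are not used carry the empty subgraph. -/
structure IsWeakClustering {V : Type} (G : SimpleGraph V) (cl : V → Option ℕ)
    (T : ℕ → G.Subgraph) (t D : ℕ) (ξ : ℝ) : Prop where
  isTree : ∀ v ℓ, cl v = some ℓ → (T ℓ).coe.IsTree
  unused : ∀ ℓ, (∀ v, cl v ≠ some ℓ) → T ℓ = ⊥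
  subset : ∀ v ℓ, cl v = some ℓ → v ∈ (T ℓ).verts
  diam : ∀ v ℓ, cl v = some ℓ → (T ℓ).coe.ediam ≤ (D : ℕ∞)
  separated : ∀ u v ℓ ℓ', cl u = some ℓ → cl v = some ℓ' → ℓ ≠ ℓ' → (t : ℕ∞) ≤ G.edist u v
  covers : Nat.card V ≤ 2 * {v | cl v ≠ none}.ncard
  overlap : ({p : ℕ × V | p.2 ∈ (T p.1).verts}.ncard : ℝ) ≤ ξ * Nat.card V

/-- `H` is a subgraph of `G` on the same vertices with `d_H ≤ β · d_G`. -/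
def IsSpanner {V : Type} (G H : SimpleGraph V) (β : ℕ) : Prop :=
  H ≤ G ∧ ∀ u v, H.edist u v ≤ (β : ℕ∞) * G.edist u v

/-- The probability that `E` fails, for a uniformly random element of the finite type `Ω`. -/
def failureProb (Ω : Type) (E : Ω → Prop) : ℝ :=
  (Nat.card {ω : Ω // ¬ E ω} : ℝ) / (Nat.card Ω : ℝ)

/-! ### CONGEST, on graphs and on cluster graphs -/

/-- A communication network `G` with at most `n` nodes and unique identifiers below `n ^ a`
(that is, of `O(log n)` bits), together with a partition of its nodes into clusters, each with a
rooted spanning tree of radius at most `r` inside the cluster. The trees are given by the `parent`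
map, roots being their own parents. For `r = 0` all clusters are singletons. -/
structure Network (V : Type) (a n r : ℕ) where
  G : SimpleGraph V
  ident : V → ℕ
  ident_injective : Function.Injective ident
  ident_lt : ∀ v, ident v < n ^ a
  finite : Finite V
  card_le : Nat.card V ≤ n
  parent : V → V
  parent_adj : ∀ v, parent v = v ∨ G.Adj v (parent v)
  parent_iterate : ∀ v, parent (parent^[r] v) = parent^[r] v

namespace Network

variable {V : Type} {a n r : ℕ} (net : Network V a n r)

/-- The nodes of the cluster graph: one for each cluster, represented by the root. -/
abbrev Node : Type := {v : V // net.parent v = v}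

/-- The cluster of `v`. -/
def cluster (v : V) : net.Node := ⟨net.parent^[r] v, net.parent_iterate v⟩

/-- The `r`-cluster-graph: every cluster is contracted to a single node. -/
def clusterGraph : SimpleGraph net.Node where
  Adj x y := x ≠ y ∧ ∃ u v, net.G.Adj u v ∧ net.cluster u = x ∧ net.cluster v = y
  symm := ⟨fun _ _ ⟨hne, u, v, h, hu, hv⟩ => ⟨hne.symm, v, u, h.symm, hv, hu⟩⟩
  loopless := ⟨fun _ h => h.1 rfl⟩

/-- For `r = 0` the cluster graph is the network itself. -/
theorem clusterGraph_radius_zero (net : Network V a n 0) :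
    Nonempty (net.clusterGraph ≃g net.G) := by
  have hp : ∀ v, net.parent v = v := fun v => by simpa using net.parent_iterate v
  refine ⟨⟨⟨fun x => x.1, fun v => ⟨v, hp v⟩, fun _ => rfl, fun _ => rfl⟩, ?_⟩⟩
  rintro ⟨x, hx⟩ ⟨y, hy⟩
  simp only [clusterGraph, cluster, Equiv.coe_fn_mk, Function.iterate_zero, id_eq, ne_eq,
    Subtype.mk.injEq]
  constructor
  · intro h
    exact ⟨h.ne, x, y, h, rfl, rfl⟩
  · rintro ⟨-, u, v, h, rfl, rfl⟩
    exact h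

end Network

/-- What a node knows at the start (besides `n` and `r`): its own identifier, those of its
neighbours, the identifier of its parent (its own one if it is a root), and the name of its
cluster, which is the identifier of the root. -/
structure NodeInput where
  ident : ℕ
  nbrs : Set ℕ
  parent : ℕ
  cluster : ℕ

def Network.input {V : Type} {a n r : ℕ} (net : Network V a n r) (v : V) : NodeInput where
  ident := net.ident v
  nbrs := net.ident '' net.G.neighborSet v
  parent := net.ident (net.parent v)
  cluster := net.ident (net.cluster v).1

/-- A CONGEST algorithm in which each node ends with an output in `Out`. It runs for
`rounds n r` rounds; in each round a node sends at most one message to each neighbour (addressed by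
its identifier), then receives those of its neighbours. A message has `O(log n)` bits: there are at
most `2 ^ (bandwidth * (⌊log₂ n⌋ + 1))` different ones. Each node has `bits n r` private random
bits; local computation is free. -/
structure CongestAlg (Out : Type) where
  rounds : ℕ → ℕ → ℕ
  bits : ℕ → ℕ → ℕ
  bandwidth : ℕ
  Msg : ℕ → ℕ → Type
  msg_finite : ∀ n r, Finite (Msg n r)
  msg_card : ∀ n r, Nat.card (Msg n r) ≤ 2 ^ (bandwidth * (Nat.log 2 n + 1))
  State : ℕ → ℕ → Type
  init : ∀ n r, NodeInput → (Fin (bits n r) → Bool) → State n r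
  send : ∀ n r, State n r → ℕ → Option (Msg n r)
  recv : ∀ n r, State n r → (ℕ → Option (Msg n r)) → State n r
  out : ∀ n r, State n r → Out

namespace CongestAlg

variable {Out : Type} (A : CongestAlg Out) {V : Type} {a n r : ℕ}

/-- A deterministic algorithm uses no random bits. -/
def Deterministic : Prop := ∀ n r, A.bits n r = 0

/-- The assignments of random bits to the nodes. -/
abbrev Tapes (V : Type) (n r : ℕ) : Type := V → Fin (A.bits n r) → Bool

open Classical in
/-- What `v` receives from the node with identifier `k` when the states are `s`. -/
def inbox (net : Network V a n r) (s : V → A.State n r) (v : V) (k : ℕ) :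
    Option (A.Msg n r) :=
  if h : ∃ w, net.G.Adj v w ∧ net.ident w = k then A.send n r (s h.choose) (net.ident v) else none

/-- The states of all nodes after a number of rounds. -/
def stateAfter (net : Network V a n r) (ω : A.Tapes V n r) : ℕ → V → A.State n r
  | 0 => fun v => A.init n r (net.input v) (ω v)
  | t + 1 => fun v =>
      A.recv n r (stateAfter net ω t v) (A.inbox net (stateAfter net ω t) v)

def output (net : Network V a n r) (ω : A.Tapes V n r) (v : V) : Out :=
  A.out n r (A.stateAfter net ω (A.rounds n r) v)

end CongestAlg

/-- Local output of a clustering algorithm: the label of the cluster that contains (the node of the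
cluster graph represented by) this node, the labels of trees of which it is reported to be a vertex,
and for each tree the incident edges that belong to it, as pairs of label and identifier of the
other end. -/
structure ClusteringOut where
  label : Option ℕ
  treeLabels : Set ℕ
  treeEdges : Set (ℕ × ℕ)

/-- The local outputs describe the clustering `cl`, `T` of the cluster graph. All nodes of the
network that are contracted to `x` know the label of `x`; both ends of an edge of the network that
represents a tree edge know this. -/
structure EncodesClustering {V : Type} {a n r : ℕ} (net : Network V a n r)
    (o : V → ClusteringOut) (cl : net.Node → Option ℕ) (T : ℕ → net.clusterGraph.Subgraph) :
    Prop where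
  label : ∀ v, (o v).label = cl (net.cluster v)
  verts : ∀ ℓ x, x ∈ (T ℓ).verts ↔ ∃ v, net.cluster v = x ∧ ℓ ∈ (o v).treeLabels
  consistent : ∀ v ℓ k, (ℓ, k) ∈ (o v).treeEdges →
    ∃ w, net.G.Adj v w ∧ net.ident w = k ∧ (ℓ, net.ident v) ∈ (o w).treeEdges
  edges : ∀ ℓ x y, (T ℓ).Adj x y ↔ x ≠ y ∧ ∃ u v, net.G.Adj u v ∧
    net.cluster u = x ∧ net.cluster v = y ∧ (ℓ, net.ident v) ∈ (o u).treeEdges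

/-- The local outputs (identifiers of the other ends of incident chosen edges) describe the subgraph
`H` of the cluster graph. -/
structure EncodesSubgraph {V : Type} {a n r : ℕ} (net : Network V a n r)
    (o : V → Set ℕ) (H : SimpleGraph net.Node) : Prop where
  consistent : ∀ v k, k ∈ o v → ∃ w, net.G.Adj v w ∧ net.ident w = k ∧ net.ident v ∈ o w
  edges : ∀ x y, H.Adj x y ↔ x ≠ y ∧ ∃ u v, net.G.Adj u v ∧
    net.cluster u = x ∧ net.cluster v = y ∧ net.ident v ∈ o u

/-- On every `r`-cluster-graph, except with probability `δ n`, the algorithm finds a `3`-separated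
clustering with weak diameter `D n` and average overlap at most `ξ n`. -/
def CongestAlg.FindsClusterings (A : CongestAlg ClusteringOut) (a r : ℕ)
    (D : ℕ → ℕ) (ξ δ : ℕ → ℝ) : Prop :=
  ∀ (n : ℕ) (V : Type) (net : Network V a n r),
    failureProb (A.Tapes V n r) (fun ω => ∃ cl T, EncodesClustering net (A.output net ω) cl T ∧
      IsWeakClustering net.clusterGraph cl T 3 (D n) (ξ n)) ≤ δ n

/-- On every `r`-cluster-graph, except with probability `δ n`, the algorithm finds a spanner with
stretch `β n` and at most `s n` times as many edges as the cluster graph has nodes. -/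
def CongestAlg.BuildsSpanners (A : CongestAlg (Set ℕ)) (a r : ℕ)
    (β : ℕ → ℕ) (s δ : ℕ → ℝ) : Prop :=
  ∀ (n : ℕ) (V : Type) (net : Network V a n r),
    failureProb (A.Tapes V n r) (fun ω => ∃ H, EncodesSubgraph net (A.output net ω) H ∧
      IsSpanner net.clusterGraph H (β n) ∧
      (H.edgeSet.ncard : ℝ) ≤ s n * Nat.card net.Node) ≤ δ n

/-! ### PRAM

A synchronous priority-CRCW PRAM. The shared memory consists of arrays (named by numbers, as are
their cells) of words below a bound `B`. A program is executed in lockstep by a list of active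
threads. A thread is identified by the list of its indices in the enclosing parallel loops,
innermost first. -/

abbrev Mem : Type := ℕ → ℕ → ℕ

abbrev Thread : Type := List ℕ

inductive Op
  | add | sub | mul | div | mod | lt | eq

def Op.eval : Op → ℕ → ℕ → ℕ
  | .add, x, y => x + y
  | .sub, x, y => x - y
  | .mul, x, y => x * y
  | .div, x, y => x / y
  | .mod, x, y => x % y
  | .lt, x, y => if x < y then 1 else 0
  | .eq, x, y => if x = y then 1 else 0

/-- Expressions: constants, the index of the thread in the `d`-th enclosing parallel loop, the cell
`a[e]`, the `e`-th random bit, arithmetic. -/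
inductive Expr
  | const (k : ℕ)
  | index (d : ℕ)
  | read (a : ℕ) (e : Expr)
  | coin (e : Expr)
  | bin (o : Op) (e₁ e₂ : Expr)

namespace Expr

def eval (ω : ℕ → Bool) (M : Mem) (θ : Thread) : Expr → ℕ
  | const k => k
  | index d => θ.getD d 0
  | read a e => M a (eval ω M θ e)
  | coin e => if ω (eval ω M θ e) then 1 else 0
  | bin o e₁ e₂ => o.eval (eval ω M θ e₁) (eval ω M θ e₂)

/-- The number of unit-time operations in the evaluation. -/
def size : Expr → ℕ
  | const _ => 1
  | index _ => 1
  | read _ e => e.size + 1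
  | coin e => e.size + 1
  | bin _ e₁ e₂ => e₁.size + e₂.size + 1

/-- All values that appear in the evaluation, addresses included, are below `B`. -/
def Fits (B : ℕ) (ω : ℕ → Bool) (M : Mem) (θ : Thread) : Expr → Prop
  | const k => k < B
  | index d => θ.getD d 0 < B
  | read a e => Fits B ω M θ e ∧ (read a e).eval ω M θ < B
  | coin e => Fits B ω M θ e ∧ (coin e).eval ω M θ < B
  | bin o e₁ e₂ => Fits B ω M θ e₁ ∧ Fits B ω M θ e₂ ∧ (bin o e₁ e₂).eval ω M θ < B

def NoCoin : Expr → Prop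
  | const _ => True
  | index _ => True
  | read _ e => e.NoCoin
  | coin _ => False
  | bin _ e₁ e₂ => e₁.NoCoin ∧ e₂.NoCoin

end Expr

/-- Programs: `skip`, `a[i] := e`, sequence, conditional, loop, and
`for j < e in parallel do p`. -/
inductive Prog
  | skip
  | write (a : ℕ) (i e : Expr)
  | seq (p q : Prog)
  | ite (e : Expr) (p q : Prog)
  | loop (e : Expr) (p : Prog)
  | par (e : Expr) (p : Prog)

def Prog.NoCoin : Prog → Prop
  | .skip => True
  | .write _ i e => i.NoCoin ∧ e.NoCoin
  | .seq p q => p.NoCoin ∧ q.NoCoin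
  | .ite e p q => e.NoCoin ∧ p.NoCoin ∧ q.NoCoin
  | .loop e p => e.NoCoin ∧ p.NoCoin
  | .par e p => e.NoCoin ∧ p.NoCoin

/-- `M` with cell `a[x]` changed to `y`. -/
def Mem.set (M : Mem) (a x y : ℕ) : Mem :=
  fun b z => if b = a ∧ z = x then y else M b z

/-- All threads of `S` read in memory `M`, then all write; the first thread in `S` wins. -/
def writeAll (ω : ℕ → Bool) (M : Mem) (a : ℕ) (i e : Expr) (S : List Thread) : Mem :=
  S.foldr (fun θ M' => M'.set a (i.eval ω M θ) (e.eval ω M θ)) M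

/-- The threads of `S` in which `e` is true (nonzero). -/
def selectTrue (ω : ℕ → Bool) (M : Mem) (e : Expr) (S : List Thread) : List Thread :=
  S.filter (fun θ => e.eval ω M θ ≠ 0)

def selectFalse (ω : ℕ → Bool) (M : Mem) (e : Expr) (S : List Thread) : List Thread :=
  S.filter (fun θ => e.eval ω M θ = 0)

/-- Each thread of `S` is replaced by as many threads as the value of `e` says. -/
def spawn (ω : ℕ → Bool) (M : Mem) (e : Expr) (S : List Thread) : List Thread :=
  S.flatMap (fun θ => (List.range (e.eval ω M θ)).map (fun j => j :: θ))

/-- `Exec B ω p S M M' d w`: with words below `B` and random bits `ω`, the execution of `p` by the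
threads `S` in lockstep terminates and takes memory `M` to `M'`, with depth (parallel time) `d` and
work (number of operations of all threads) `w`. -/
inductive Exec (B : ℕ) (ω : ℕ → Bool) : Prog → List Thread → Mem → Mem → ℕ → ℕ → Prop
  | skip (S M) : Exec B ω .skip S M M 1 S.length
  | write (a i e S M) (hi : ∀ θ ∈ S, i.Fits B ω M θ) (he : ∀ θ ∈ S, e.Fits B ω M θ) :
      Exec B ω (.write a i e) S M (writeAll ω M a i e S)
        (i.size + e.size) (S.length * (i.size + e.size))
  | seq {p q S M M₁ M₂ d₁ d₂ w₁ w₂} (hp : Exec B ω p S M M₁ d₁ w₁)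
      (hq : Exec B ω q S M₁ M₂ d₂ w₂) :
      Exec B ω (.seq p q) S M M₂ (d₁ + d₂) (w₁ + w₂)
  | ite {e p q S M M₁ M₂ d₁ d₂ w₁ w₂} (he : ∀ θ ∈ S, e.Fits B ω M θ)
      (hp : Exec B ω p (selectTrue ω M e S) M M₁ d₁ w₁)
      (hq : Exec B ω q (selectFalse ω M e S) M₁ M₂ d₂ w₂) :
      Exec B ω (.ite e p q) S M M₂ (e.size + d₁ + d₂) (S.length * e.size + w₁ + w₂)
  | loopDone {e p S M} (he : ∀ θ ∈ S, e.Fits B ω M θ) (h : selectTrue ω M e S = []) :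
      Exec B ω (.loop e p) S M M e.size (S.length * e.size)
  | loopStep {e p S M M₁ M₂ d₁ d₂ w₁ w₂} (he : ∀ θ ∈ S, e.Fits B ω M θ)
      (h : selectTrue ω M e S ≠ [])
      (hp : Exec B ω p (selectTrue ω M e S) M M₁ d₁ w₁)
      (hq : Exec B ω (.loop e p) (selectTrue ω M e S) M₁ M₂ d₂ w₂) :
      Exec B ω (.loop e p) S M M₂ (e.size + d₁ + d₂) (S.length * e.size + w₁ + w₂)
  | par {e p S M M₁ d w} (he : ∀ θ ∈ S, e.Fits B ω M θ)
      (hp : Exec B ω p (spawn ω M e S) M M₁ d w) :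
      Exec B ω (.par e p) S M M₁ (e.size + d) (S.length * e.size + w)

/-- A graph stored in `n` vertex slots and `m` edge slots, some of which may be unused. -/
structure StoredGraph (n m : ℕ) where
  verts : Finset (Fin n)
  slot : Fin m → Option (Fin n × Fin n)
  slot_mem : ∀ j u v, slot j = some (u, v) → u ∈ verts ∧ v ∈ verts ∧ u ≠ v
  slot_unique : ∀ i j u v, slot i = some (u, v) →
    slot j = some (u, v) ∨ slot j = some (v, u) → i = j

namespace StoredGraph

variable {n m : ℕ} (I : StoredGraph n m)

/-- Slot number `j` holds the edge `{u, v}`. -/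
def Joins (j : ℕ) (u v : I.verts) : Prop :=
  ∃ h : j < m, I.slot ⟨j, h⟩ = some (u.1, v.1) ∨ I.slot ⟨j, h⟩ = some (v.1, u.1)

def graph : SimpleGraph I.verts where
  Adj u v := ∃ j, I.Joins j u v
  symm := ⟨fun _ _ ⟨j, h, hj⟩ => ⟨j, h, hj.symm⟩⟩
  loopless := ⟨fun _ ⟨_, _, hj⟩ =>
    hj.elim (fun h => (I.slot_mem _ _ _ h).2.2 rfl) (fun h => (I.slot_mem _ _ _ h).2.2 rfl)⟩

open Classical in
/-- The initial memory. Array 0 holds `n` and `m`; array 1 tells which vertex slots are in use;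
array 2 tells which edge slots are in use, and arrays 3 and 4 hold the ends of the edges. -/
def load : Mem
  | 0, 0 => n
  | 0, 1 => m
  | 1, x => if ∃ h : x < n, (⟨x, h⟩ : Fin n) ∈ I.verts then 1 else 0
  | 2, j => if h : j < m then (if (I.slot ⟨j, h⟩).isSome then 1 else 0) else 0
  | 3, j => if h : j < m then ((I.slot ⟨j, h⟩).elim 0 fun p => (p.1 : ℕ)) else 0
  | 4, j => if h : j < m then ((I.slot ⟨j, h⟩).elim 0 fun p => (p.2 : ℕ)) else 0
  | _, _ => 0

end StoredGraph

/-- The memory describes the clustering `cl`, `T`. Array 5 holds for each vertex its label plus one,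
or zero if it is not clustered. Arrays 7 and 8 hold a list without repetitions of `M 6 0` pairs
(label of a tree, vertex of this tree), and arrays 9 and 10 one of `M 6 1` pairs (label of a tree,
slot of an edge of this tree). -/
structure MemClustering {n m : ℕ} (I : StoredGraph n m) (M : Mem)
    (cl : I.verts → Option ℕ) (T : ℕ → I.graph.Subgraph) : Prop where
  label : ∀ v : I.verts, M 5 v.1 = (cl v).elim 0 (fun ℓ => ℓ + 1)
  vert_valid : ∀ k < M 6 0, ∃ v : I.verts, M 8 k = v.1
  vert_unique : ∀ k < M 6 0, ∀ k' < M 6 0, M 7 k = M 7 k' → M 8 k = M 8 k' → k = k'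
  verts : ∀ ℓ (v : I.verts), v ∈ (T ℓ).verts ↔ ∃ k < M 6 0, M 7 k = ℓ ∧ M 8 k = v.1
  edge_valid : ∀ k < M 6 1, ∃ u v, I.Joins (M 10 k) u v
  edge_unique : ∀ k < M 6 1, ∀ k' < M 6 1, M 9 k = M 9 k' → M 10 k = M 10 k' → k = k'
  edges : ∀ ℓ u v, (T ℓ).Adj u v ↔ ∃ k < M 6 1, M 9 k = ℓ ∧ I.Joins (M 10 k) u v

/-- The memory describes the subgraph `H`: array 5 marks the slots of its edges. -/
def MemSubgraph {n m : ℕ} (I : StoredGraph n m) (M : Mem) (H : SimpleGraph I.verts) : Prop :=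
  ∀ u v, H.Adj u v ↔ ∃ j, I.Joins j u v ∧ M 5 j ≠ 0

/-- A PRAM algorithm: one program for all inputs, on words of `O(log n)` bits. -/
structure PramAlg where
  prog : Prog
  wordExp : ℕ

namespace PramAlg

variable (A : PramAlg)

/-- Words are below this bound. -/
def bound (n : ℕ) : ℕ := n ^ A.wordExp

/-- A deterministic algorithm tosses no coins. -/
def Deterministic : Prop := A.prog.NoCoin

/-- The random bits: one for each possible address. -/
abbrev Tape (n : ℕ) : Type := Fin (A.bound n) → Bool

/-- Run by a single initial thread on `I` with random bits `ω`, the algorithm halts with memory `M'`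
after at most `d` time steps and `w` operations. -/
def HaltsWith {n m : ℕ} (I : StoredGraph n m) (ω : A.Tape n) (M' : Mem) (d w : ℝ) : Prop :=
  ∃ d₀ w₀ : ℕ, (d₀ : ℝ) ≤ d ∧ (w₀ : ℝ) ≤ w ∧
    Exec (A.bound n) (fun k => if h : k < A.bound n then ω ⟨k, h⟩ else false)
      A.prog [[]] I.load M' d₀ w₀

/-- Except with probability `δ n`, the algorithm finds a `3`-separated clustering with weak diameter
`D n` and average overlap at most `ξ n`, with depth `T n` and work `W m n`. -/
def FindsClusterings (D : ℕ → ℕ) (ξ δ : ℕ → ℝ) (T : ℕ → ℝ) (W : ℕ → ℕ → ℝ) : Prop :=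
  ∀ n m : ℕ, 2 ≤ n → m ≤ n ^ 2 → ∀ I : StoredGraph n m,
    failureProb (A.Tape n) (fun ω => ∃ M', A.HaltsWith I ω M' (T n) (W m n) ∧
      ∃ cl T, MemClustering I M' cl T ∧ IsWeakClustering I.graph cl T 3 (D n) (ξ n)) ≤ δ n

/-- Except with probability `δ n`, the algorithm finds a spanner with stretch `β n` and at most
`s n` times as many edges as there are vertices, with depth `T n` and work `W m n`. -/
def BuildsSpanners (β : ℕ → ℕ) (s δ : ℕ → ℝ) (T : ℕ → ℝ) (W : ℕ → ℕ → ℝ) : Prop :=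
  ∀ n m : ℕ, 2 ≤ n → m ≤ n ^ 2 → ∀ I : StoredGraph n m,
    failureProb (A.Tape n) (fun ω => ∃ M', A.HaltsWith I ω M' (T n) (W m n) ∧
      ∃ H, MemSubgraph I M' H ∧ IsSpanner I.graph H (β n) ∧
        (H.edgeSet.ncard : ℝ) ≤ s n * I.verts.card) ≤ δ n

end PramAlg

end

end SpannersViaClusterings

open SpannersViaClusterings

namespace SpannersViaClusterings

noncomputable section

/-! ### Graph theory: one phase, and the union of all phases -/

section Graph

/-! The spanner is built in `⌊log₂ n⌋ + 1` phases. A phase clusters the graph induced by the live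
nodes, which are all nodes at the beginning. It selects all tree edges and, for each unclustered
node with a clustered neighbour, one edge to such a neighbour. The clustered nodes then cease to be
live. Since `n` is only an upper bound on the number of nodes, every induced subgraph is again an
admissible input with the same parameters.

Size: at least half of the live nodes are clustered in each phase, so no node is live at the end. A
phase with live set `R` selects at most `ξ |R|` tree edges and `|R|` further ones. Covering half of
the nodes forces `ξ ≥ 1/2`, so this is at most `3 ξ |R|`, and the geometric series gives `6 ξ |V|`
(`IsWeakClustering.isPhase`, `spanner_of_phases`).

Stretch: it suffices to treat an edge `{x, y}`. Consider the phase in which it first loses a live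
end, say `x`. If `y` is clustered too, then `3`-separation puts both into one cluster, and the tree
joins them within `D`. Otherwise `y` has selected an edge to a clustered `z`. As `x` and `z` are at
distance at most `2`, they share a cluster, so `x` and `y` are within `D + 1 ≤ 2 D`.

Probability: the input of a phase depends on the random bits of earlier phases. Each phase uses a
fresh block of bits, which is uniform given the past, and the guarantee for the clustering algorithm
holds for every input; so a union bound over the phases is valid (`failureProb_blockRun_le`).

CONGEST: nodes that are not live are silent, so the live nodes behave as in the network that they
induce (`round_iterate_restrict`). In a cluster graph, the node that selects the edge of its cluster
is elected by flooding the least identifier for `2 r` rounds. `exists_spanner` combines the phases.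

PRAM: clearing the memory between phases could cost too much work. Instead, the values of a run are
stored with an offset that exceeds everything written before, so that truncated subtraction turns
old contents into zeros (`Exec.shift`). `phase_triple` verifies one phase and `main_triple` the
whole program. -/

theorem edist_map_le {V W : Type} {G : SimpleGraph V} {H : SimpleGraph W} (φ : G →g H) (u v : V) :
    H.edist (φ u) (φ v) ≤ G.edist u v := by
  by_cases h : G.edist u v = ⊤
  · rw [h]; exact le_top
  · obtain ⟨w, hw⟩ := SimpleGraph.exists_walk_of_edist_ne_top h
    rw [← hw, ← SimpleGraph.Walk.length_map φ w]
    exact SimpleGraph.edist_le _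

/-- The edges `P` are chosen and the live nodes change from `R` to `R'`: at least half of them
become inactive, and edges with an end that becomes inactive are spanned. -/
structure IsPhase {W : Type} (G P : SimpleGraph W) (R R' : Set W) (D : ℕ) (ξ : ℝ) : Prop where
  le : P ≤ G
  subset : R' ⊆ R
  halve : 2 * R'.ncard ≤ R.ncard
  edges : (P.edgeSet.ncard : ℝ) ≤ 3 * ξ * R.ncard
  stretch : ∀ x ∈ R \ R', ∀ y ∈ R, G.Adj x y → P.edist x y ≤ (D : ℕ∞) + 1

/-- The edges of a shortest walk are replaced one by one. Positivity of `b` matters for unconnected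
pairs, because `0 * ⊤ = 0`. -/
theorem edist_le_mul_of_adj {W : Type} {G H : SimpleGraph W} {b : ℕ}
    (hb : 0 < b)
    (h : ∀ x y, G.Adj x y → H.edist x y ≤ (b : ℕ∞)) (x y : W) :
    H.edist x y ≤ (b : ℕ∞) * G.edist x y := by
  by_cases ht : G.edist x y = ⊤
  · rw [ht, ENat.mul_top (by exact_mod_cast hb.ne')]; exact le_top
  · obtain ⟨w, hw⟩ := SimpleGraph.exists_walk_of_edist_ne_top ht
    rw [← hw]
    clear hw ht
    induction w with
    | nil => simp
    | cons hadj p ih =>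
      refine SimpleGraph.edist_triangle.trans ((add_le_add (h _ _ hadj) ih).trans ?_)
      simp only [SimpleGraph.Walk.length_cons]
      push_cast
      rw [mul_add, mul_one, add_comm]

theorem spanner_of_phases {W : Type} [Finite W] {G H : SimpleGraph W} {L D : ℕ} {ξ : ℝ}
    (hD : 1 ≤ D) (hL : Nat.card W < 2 ^ L) (R : ℕ → Set W) (P : ℕ → SimpleGraph W)
    (h0 : R 0 = Set.univ) (hP : ∀ p < L, IsPhase G (P p) (R p) (R (p + 1)) D ξ)
    (hH : ∀ x y, H.Adj x y ↔ ∃ p < L, (P p).Adj x y) :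
    IsSpanner G H (2 * D) ∧ (H.edgeSet.ncard : ℝ) ≤ 6 * ξ * Nat.card W := by
  have hPH : ∀ p < L, P p ≤ H := fun p hp x y hxy => (hH x y).2 ⟨p, hp, hxy⟩
  have hr0 : (R 0).ncard = Nat.card W := by rw [h0, Set.ncard_univ]
  -- Halving `L` times leaves fewer than one live node, by `hL`.
  have hpow : ∀ p ≤ L, 2 ^ p * (R p).ncard ≤ Nat.card W := by
    intro p
    induction p with
    | zero => intro _; simp [hr0]
    | succ p ih =>
      intro hp
      have h1 := ih (by omega)
      have h2 := (hP p (by omega)).halve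
      calc 2 ^ (p + 1) * (R (p + 1)).ncard = 2 ^ p * (2 * (R (p + 1)).ncard) := by ring
        _ ≤ _ := (Nat.mul_le_mul_left _ h2).trans h1
  have hRL : R L = ∅ := by
    rw [← Set.ncard_eq_zero (Set.toFinite _)]
    by_contra hne
    have := hpow L le_rfl
    have h1 : 2 ^ L * 1 ≤ 2 ^ L * (R L).ncard := Nat.mul_le_mul_left _ (Nat.pos_of_ne_zero hne)
    omega
  refine ⟨⟨fun x y hxy => ?_, edist_le_mul_of_adj (by omega) fun x y hxy => ?_⟩, ?_⟩
  · obtain ⟨p, hp, h⟩ := (hH x y).1 hxy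
    exact (hP p hp).le h
  -- The phase in which the edge loses a live end: both ends are live before it, and at least one is
  -- not live after it.
  · have key : ∃ p < L, (x ∈ R p ∧ y ∈ R p) ∧ ¬ (x ∈ R (p + 1) ∧ y ∈ R (p + 1)) := by
      by_contra hcon
      push Not at hcon
      have : ∀ p ≤ L, x ∈ R p ∧ y ∈ R p := by
        intro p
        induction p with
        | zero => intro _; simp [h0]
        | succ p ih =>
          intro hp
          have := ih (by omega)
          exact hcon p (by omega) this
      have := (this L le_rfl).1
      rw [hRL] at this
      exact this
    obtain ⟨p, hp, ⟨hx, hy⟩, hn⟩ := key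
    have hle : H.edist x y ≤ (D : ℕ∞) + 1 := by
      refine (SimpleGraph.edist_anti (hPH p hp)).trans ?_
      by_cases hx' : x ∈ R (p + 1)
      · rw [SimpleGraph.edist_comm]
        exact (hP p hp).stretch y ⟨hy, fun hy' => hn ⟨hx', hy'⟩⟩ x hx hxy.symm
      · exact (hP p hp).stretch x ⟨hx, hx'⟩ y hy hxy
    refine hle.trans ?_
    have : D + 1 ≤ 2 * D := by omega
    exact_mod_cast this
  -- The geometric series with its tail: the term `2 * |R p|` pays for all later phases.
  · have hsum : ∀ p ≤ L, ∑ q ∈ Finset.range p, (R q).ncard + 2 * (R p).ncard ≤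
        2 * Nat.card W := by
      intro p
      induction p with
      | zero => intro _; simp [hr0]
      | succ p ih =>
        intro hp
        have h1 := ih (by omega)
        have h2 := (hP p (by omega)).halve
        rw [Finset.sum_range_succ]
        omega
    have hle : H.edgeSet.ncard ≤ ∑ p ∈ Finset.range L, (P p).edgeSet.ncard := by
      have hsub : H.edgeSet ⊆ ⋃ p ∈ Finset.range L, (P p).edgeSet := by
        intro e
        induction e using Sym2.ind with
        | _ x y =>
          intro h
          obtain ⟨p, hp, h⟩ := (hH x y).1 h
          simp only [Set.mem_iUnion]
          exact ⟨p, Finset.mem_range.2 hp, h⟩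
      exact (Set.ncard_le_ncard hsub (Set.toFinite _)).trans (Finset.set_ncard_biUnion_le _ _)
    have hle' : (H.edgeSet.ncard : ℝ) ≤ 3 * ξ * (∑ q ∈ Finset.range L, (R q).ncard : ℕ) := by
      calc (H.edgeSet.ncard : ℝ) ≤ (∑ p ∈ Finset.range L, (P p).edgeSet.ncard : ℕ) := by
            exact_mod_cast hle
        _ ≤ _ := by
          push_cast
          rw [Finset.mul_sum]
          exact Finset.sum_le_sum fun p hp => (hP p (Finset.mem_range.1 hp)).edges
    have hs := hsum L le_rfl
    -- Multiplying the sum bound by `ξ` needs `0 ≤ ξ`. This follows from the first phase if there is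
    -- a node; otherwise both sides vanish.
    rcases Nat.eq_zero_or_pos (Nat.card W) with hW | hW
    · have : ∑ q ∈ Finset.range L, (R q).ncard = 0 := by omega
      rw [this] at hle'
      rw [hW]
      simpa using hle'
    · have hL0 : 0 < L := by
        by_contra h
        have : L = 0 := by omega
        subst this
        simp at hL
        omega
      have hξ : 0 ≤ ξ := by
        have h1 := (hP 0 hL0).edges
        rw [hr0] at h1
        by_contra hneg
        have h2 : (0 : ℝ) ≤ ((P 0).edgeSet.ncard : ℝ) := Nat.cast_nonneg _
        have h3 : (0 : ℝ) < Nat.card W := by exact_mod_cast hW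
        nlinarith
      have h4 : ((∑ q ∈ Finset.range L, (R q).ncard : ℕ) : ℝ) ≤ 2 * Nat.card W := by
        exact_mod_cast (by omega : ∑ q ∈ Finset.range L, (R q).ncard ≤ 2 * Nat.card W)
      nlinarith

/-- The trees `T ℓ` together with the edges from the nodes to the ones chosen by `c`. -/
def attachGraph {V : Type} {G : SimpleGraph V} (T : ℕ → G.Subgraph) (c : V → Option V)
    (hc : ∀ a b, c a = some b → G.Adj a b) : SimpleGraph V where
  Adj a b := (∃ ℓ, (T ℓ).Adj a b) ∨ c a = some b ∨ c b = some a
  symm := ⟨fun _ _ h => h.imp (fun ⟨ℓ, h⟩ => ⟨ℓ, h.symm⟩) Or.symm⟩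
  loopless := ⟨fun a h => h.elim (fun ⟨_, h⟩ => h.ne rfl)
    (fun h => h.elim (fun h => (hc a a h).ne rfl) (fun h => (hc a a h).ne rfl))⟩

namespace IsWeakClustering

variable {V : Type} [Finite V] {G : SimpleGraph V} {cl : V → Option ℕ} {T : ℕ → G.Subgraph}
  {t D : ℕ} {ξ : ℝ} (h : IsWeakClustering G cl T t D ξ)
include h

omit [Finite V] in
theorem label_of_mem {ℓ : ℕ} {v : V} (hv : v ∈ (T ℓ).verts) : ∃ w, cl w = some ℓ := by
  by_contra hn
  push Not at hn
  rw [h.unused ℓ hn] at hv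
  exact hv

/-- As `ncard` is `0` on infinite sets, the counting below needs finiteness. Only the finitely many
labels in use carry nonempty trees. -/
theorem finite_overlap : {p : ℕ × V | p.2 ∈ (T p.1).verts}.Finite := by
  have : {p : ℕ × V | p.2 ∈ (T p.1).verts} ⊆
      {ℓ | ∃ w, cl w = some ℓ} ×ˢ (Set.univ : Set V) := fun p hp => ⟨h.label_of_mem hp, trivial⟩
  refine Set.Finite.subset (Set.Finite.prod ?_ Set.finite_univ) this
  have hfin : (Set.range cl).Finite := Set.finite_range cl
  exact (hfin.preimage (Option.some_injective ℕ).injOn).subset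
    (fun ℓ ⟨w, hw⟩ => ⟨w, hw⟩)

theorem ncard_clustered_le : {v | cl v ≠ none}.ncard ≤
    {p : ℕ × V | p.2 ∈ (T p.1).verts}.ncard := by
  refine Set.ncard_le_ncard_of_injOn (fun v => ((cl v).getD 0, v)) ?_ ?_ h.finite_overlap
  · intro v hv
    obtain ⟨ℓ, hℓ⟩ := Option.ne_none_iff_exists'.1 hv
    have := h.subset v ℓ hℓ
    simpa [hℓ] using this
  · intro u _ v _ huv
    exact (Prod.ext_iff.1 huv).2

/-- Each clustered vertex lies in its own tree, so the overlap is at least the number of clustered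
vertices, hence at least half of all. This allows one extra edge per vertex to be charged to `ξ`. -/
theorem card_le : (Nat.card V : ℝ) ≤ 2 * ξ * Nat.card V := by
  have h1 := h.covers
  have h2 := h.ncard_clustered_le
  have h3 := h.overlap
  have h4 : (Nat.card V : ℝ) ≤ 2 * ({p : ℕ × V | p.2 ∈ (T p.1).verts}.ncard : ℝ) := by
    exact_mod_cast h1.trans (by omega)
  linarith

theorem half_le [Nonempty V] : 1 / 2 ≤ ξ := by
  have h1 := h.card_le
  have h2 : (0 : ℝ) < Nat.card V := by exact_mod_cast Nat.card_pos
  nlinarith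

theorem finite_treeEdges : {p : ℕ × Sym2 V | p.2 ∈ (T p.1).edgeSet}.Finite := by
  have : {p : ℕ × Sym2 V | p.2 ∈ (T p.1).edgeSet} ⊆
      (Prod.fst '' {p : ℕ × V | p.2 ∈ (T p.1).verts}) ×ˢ (Set.univ : Set (Sym2 V)) := by
    rintro ⟨ℓ, e⟩ he
    induction e using Sym2.ind with
    | _ x y => exact ⟨⟨(ℓ, x), (T ℓ).edge_vert he, rfl⟩, trivial⟩
  exact ((h.finite_overlap.image _).prod Set.finite_univ).subset this

theorem ncard_edgeSet_le (ℓ : ℕ) : (T ℓ).edgeSet.ncard ≤ (T ℓ).verts.ncard := by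
  classical
  by_cases hℓ : ∃ w, cl w = some ℓ
  · obtain ⟨w, hw⟩ := hℓ
    have ht := h.isTree w ℓ hw
    have := Fintype.ofFinite (T ℓ).verts
    have hcard := ht.card_edgeFinset
    have : (T ℓ).edgeSet = Sym2.map Subtype.val '' (T ℓ).coe.edgeSet := by
      ext e
      induction e using Sym2.ind with
      | _ x y =>
        constructor
        · intro hxy
          refine ⟨s(⟨x, (T ℓ).edge_vert hxy⟩, ⟨y, (T ℓ).edge_vert hxy.symm⟩), hxy, rfl⟩
        · rintro ⟨e', he', heq⟩
          induction e' using Sym2.ind with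
          | _ a b =>
            rw [← heq]
            exact he'
    rw [this]
    refine (Set.ncard_image_le (Set.toFinite _)).trans ?_
    rw [← Nat.card_coe_set_eq (T ℓ).verts, Nat.card_eq_fintype_card, ← hcard,
      ← SimpleGraph.coe_edgeFinset, Set.ncard_coe_finset]
    omega
  · push Not at hℓ
    rw [h.unused ℓ hℓ]
    simp

/-- Trees of different labels may share edges, so edges are counted together with their labels. For
each label the edges inject into the vertices, since a tree has fewer edges than vertices; keeping
the label makes the injections compatible. -/
theorem ncard_treeEdges_le : {p : ℕ × Sym2 V | p.2 ∈ (T p.1).edgeSet}.ncard ≤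
    {p : ℕ × V | p.2 ∈ (T p.1).verts}.ncard := by
  have hinj : ∀ ℓ, ∃ g : Sym2 V → V, (∀ e ∈ (T ℓ).edgeSet, g e ∈ (T ℓ).verts) ∧
      Set.InjOn g (T ℓ).edgeSet := by
    intro ℓ
    rcases isEmpty_or_nonempty V with hV | hV
    · exact ⟨fun e => e.out.1, fun e _ => (hV.false e.out.1).elim,
        fun e _ => (hV.false e.out.1).elim⟩
    · obtain ⟨g, hg⟩ := (Set.toFinite (T ℓ).edgeSet).exists_injOn_of_encard_le
        (t := (T ℓ).verts) (by
          rw [← (Set.toFinite (T ℓ).edgeSet).cast_ncard_eq,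
            ← (Set.toFinite (T ℓ).verts).cast_ncard_eq]
          exact_mod_cast h.ncard_edgeSet_le ℓ)
      exact ⟨g, fun e he => hg.1 he, hg.2⟩
  choose g hg1 hg2 using hinj
  refine Set.ncard_le_ncard_of_injOn (fun p => (p.1, g p.1 p.2)) ?_ ?_ h.finite_overlap
  · exact fun p hp => hg1 p.1 p.2 hp
  · rintro ⟨ℓ, e⟩ he ⟨ℓ', e'⟩ he' heq
    obtain ⟨h1, h2⟩ := Prod.ext_iff.1 heq
    simp only at h1 h2
    subst h1
    rw [show e = e' from hg2 ℓ he he' h2]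

/-- At most `ξ |V|` tree edges and at most one edge per vertex; by `card_le`, the latter are at most
`2 ξ |V|`. -/
theorem ncard_attachGraph_le (c : V → Option V) (hc : ∀ a b, c a = some b → G.Adj a b) :
    ((attachGraph T c hc).edgeSet.ncard : ℝ) ≤ 3 * ξ * Nat.card V := by
  -- For a vertex without a choice, the default `a` gives a loop, which only enlarges the covering
  -- set.
  have hsub : (attachGraph T c hc).edgeSet ⊆
      Prod.snd '' {p : ℕ × Sym2 V | p.2 ∈ (T p.1).edgeSet} ∪
      (fun a => s(a, (c a).getD a)) '' Set.univ := by
    intro e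
    induction e using Sym2.ind with
    | _ x y =>
      rintro (⟨ℓ, h⟩ | h | h)
      · exact Or.inl ⟨(ℓ, s(x, y)), h, rfl⟩
      · exact Or.inr ⟨x, trivial, by simp [h]⟩
      · exact Or.inr ⟨y, trivial, by simp [h, Sym2.eq_swap]⟩
  have h1 : (attachGraph T c hc).edgeSet.ncard ≤
      {p : ℕ × V | p.2 ∈ (T p.1).verts}.ncard + Nat.card V := by
    refine (Set.ncard_le_ncard hsub (Set.toFinite _)).trans ((Set.ncard_union_le _ _).trans ?_)
    refine add_le_add ((Set.ncard_image_le h.finite_treeEdges).trans h.ncard_treeEdges_le) ?_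
    exact (Set.ncard_image_le (Set.toFinite _)).trans (by rw [Set.ncard_univ])
  have h2 : ((attachGraph T c hc).edgeSet.ncard : ℝ) ≤
      ({p : ℕ × V | p.2 ∈ (T p.1).verts}.ncard : ℝ) + Nat.card V := by exact_mod_cast h1
  linarith [h.overlap, h.card_le]

omit [Finite V] in
theorem edist_attachGraph_le_of_label (c : V → Option V) (hc : ∀ a b, c a = some b → G.Adj a b)
    {x y : V} {ℓ : ℕ} (hx : cl x = some ℓ) (hy : cl y = some ℓ) :
    (attachGraph T c hc).edist x y ≤ D := by
  let φ : (T ℓ).coe →g attachGraph T c hc := ⟨Subtype.val, fun hab => Or.inl ⟨ℓ, hab⟩⟩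
  exact (edist_map_le φ ⟨x, h.subset x ℓ hx⟩ ⟨y, h.subset y ℓ hy⟩).trans
    (SimpleGraph.edist_le_ediam.trans (h.diam x ℓ hx))

omit [Finite V] in
theorem label_eq_of_edist_lt {x y : V} {ℓ ℓ' : ℕ} (hx : cl x = some ℓ) (hy : cl y = some ℓ')
    (hxy : G.edist x y < t) : ℓ = ℓ' := by
  by_contra hne
  exact absurd (h.separated x y ℓ ℓ' hx hy hne) (not_le.2 hxy)

omit [Finite V] in
-- The core of the stretch bound, and the reason for separation `3`: a clustered end and the
-- clustered vertex chosen by the other end are at distance at most `2`, hence in one cluster.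
theorem edist_attachGraph_le (ht : t = 3) (c : V → Option V)
    (hc : ∀ a b, c a = some b → G.Adj a b) (hc' : ∀ a b, c a = some b → cl b ≠ none)
    (hc'' : ∀ a b, G.Adj a b → cl a = none → cl b ≠ none → c a ≠ none)
    {x y : V} (hx : cl x ≠ none) (hxy : G.Adj x y) :
    (attachGraph T c hc).edist x y ≤ (D : ℕ∞) + 1 := by
  obtain ⟨ℓ, hℓ⟩ := Option.ne_none_iff_exists'.1 hx
  by_cases hy : cl y = none
  · obtain ⟨z, hz⟩ := Option.ne_none_iff_exists'.1 (hc'' y x hxy.symm hy hx)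
    obtain ⟨ℓ', hℓ'⟩ := Option.ne_none_iff_exists'.1 (hc' y z hz)
    -- The path from `x` over `y` to `z` stays below the separation.
    have hxz : G.edist x z ≤ 1 + 1 := SimpleGraph.edist_triangle.trans (add_le_add
      (SimpleGraph.edist_eq_one_iff_adj.2 hxy).le
      (SimpleGraph.edist_eq_one_iff_adj.2 (hc y z hz)).le)
    have hlt : G.edist x z < t := lt_of_le_of_lt hxz (by
      rw [ht]; exact_mod_cast (by norm_num : 1 + 1 < 3))
    have hE : ℓ = ℓ' := h.label_eq_of_edist_lt hℓ hℓ' hlt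
    subst hE
    refine SimpleGraph.edist_triangle.trans
      (add_le_add (h.edist_attachGraph_le_of_label c hc hℓ hℓ') ?_)
    exact (SimpleGraph.edist_eq_one_iff_adj.2 (Or.inr (Or.inr hz))).le
  · obtain ⟨ℓ', hℓ'⟩ := Option.ne_none_iff_exists'.1 hy
    have hlt : G.edist x y < t := by
      rw [SimpleGraph.edist_eq_one_iff_adj.2 hxy, ht]
      exact_mod_cast (by norm_num : 1 < 3)
    have hE : ℓ = ℓ' := h.label_eq_of_edist_lt hℓ hℓ' hlt
    subst hE
    exact (h.edist_attachGraph_le_of_label c hc hℓ hℓ').trans (le_add_right le_rfl)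

theorem ncard_unclustered_le : 2 * {v | cl v = none}.ncard ≤ Nat.card V := by
  have h1 := h.covers
  have h2 : {v | cl v = none}.ncard + {v | cl v = none}ᶜ.ncard = Nat.card V :=
    Set.ncard_add_ncard_compl _
  have h3 : {v | cl v = none}ᶜ = {v | cl v ≠ none} := rfl
  rw [h3] at h2
  omega

/-- A clustering of the graph of the live nodes, with the edges chosen by `c`, gives a phase. -/
theorem isPhase {W : Type} {G₀ : SimpleGraph W} (ht : t = 3) (f : G ↪g G₀) (c : V → Option V)
    (hc : ∀ a b, c a = some b → G.Adj a b) (hc' : ∀ a b, c a = some b → cl b ≠ none)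
    (hc'' : ∀ a b, G.Adj a b → cl a = none → cl b ≠ none → c a ≠ none) :
    IsPhase G₀ ((attachGraph T c hc).map f.toEmbedding) (Set.range f) (f '' {a | cl a = none})
      D ξ where
  le := by
    intro x y hxy
    obtain ⟨a, b, hab, rfl, rfl⟩ := (SimpleGraph.map_adj _ _ _ _).1 hxy
    refine f.map_rel_iff.2 ?_
    rcases hab with ⟨ℓ, h⟩ | h | h
    · exact h.adj_sub
    · exact hc _ _ h
    · exact (hc _ _ h).symm
  subset := Set.image_subset_range _ _
  halve := by
    rw [Set.ncard_image_of_injective _ f.injective, ← Set.image_univ,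
      Set.ncard_image_of_injective _ f.injective, Set.ncard_univ]
    exact h.ncard_unclustered_le
  edges := by
    have h1 := h.ncard_attachGraph_le c hc
    rw [SimpleGraph.edgeSet_map, ← Set.image_univ,
      Set.ncard_image_of_injective _ f.injective, Set.ncard_univ]
    refine le_trans ?_ h1
    exact_mod_cast Set.ncard_image_le (Set.toFinite _)
  stretch := by
    rintro _ ⟨⟨a, rfl⟩, ha⟩ _ ⟨b, rfl⟩ hab
    let φ : attachGraph T c hc →g (attachGraph T c hc).map f.toEmbedding :=
      ⟨f, fun {a b} hab => (SimpleGraph.map_adj _ _ _ _).2 ⟨a, b, hab, rfl, rfl⟩⟩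
    refine (edist_map_le φ a b).trans ?_
    exact h.edist_attachGraph_le ht c hc hc' hc'' (fun hn => ha ⟨a, hn, rfl⟩)
      (f.map_rel_iff.1 hab)

end IsWeakClustering

end Graph

/-! ### Adaptive union bound -/

section Probability

theorem failureProb_mono {Ω : Type} [Finite Ω] {E E' : Ω → Prop} (h : ∀ ω, E ω → E' ω) :
    failureProb Ω E' ≤ failureProb Ω E := by
  unfold failureProb
  refine div_le_div_of_nonneg_right ?_ (Nat.cast_nonneg _)
  exact_mod_cast Nat.card_le_card_of_injective
    (fun ω : {ω : Ω // ¬ E' ω} => (⟨ω.1, fun h' => ω.2 (h _ h')⟩ : {ω : Ω // ¬ E ω}))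
    (fun ω ω' h => Subtype.ext (congrArg (fun x => x.1) h))

theorem failureProb_congr_equiv {Ω Ω' : Type} (e : Ω ≃ Ω') (E : Ω' → Prop) :
    failureProb Ω (fun ω => E (e ω)) = failureProb Ω' E := by
  unfold failureProb
  rw [Nat.card_congr e, Nat.card_congr (e.subtypeEquiv (fun ω => Iff.rfl) :
    {ω : Ω // ¬ E (e ω)} ≃ {ω : Ω' // ¬ E ω})]

theorem exists_of_failureProb_lt_one {Ω : Type} [Finite Ω] [Nonempty Ω] {E : Ω → Prop} {δ : ℝ}
    (h : failureProb Ω E ≤ δ) (hδ : δ < 1) : ∃ ω, E ω := by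
  by_contra hn
  push Not at hn
  have : failureProb Ω E = 1 := by
    unfold failureProb
    rw [Nat.card_congr (Equiv.subtypeUnivEquiv hn)]
    exact div_self (by exact_mod_cast Nat.card_pos.ne')
  linarith

theorem failureProb_forall_lt_le {Ω : Type} [Finite Ω] {δ : ℝ} (E : ℕ → Ω → Prop) :
    ∀ L : ℕ, (∀ p < L, failureProb Ω (E p) ≤ δ) →
      failureProb Ω (fun ω => ∀ p < L, E p ω) ≤ L * δ := by
  intro L
  induction L with
  | zero => intro _; simp [failureProb]
  | succ L ih =>
    intro h
    have h1 := ih (fun p hp => h p (by omega))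
    have h2 := h L (by omega)
    have h3 : failureProb Ω (fun ω => ∀ p < L + 1, E p ω) ≤
        failureProb Ω (fun ω => ∀ p < L, E p ω) + failureProb Ω (E L) := by
      unfold failureProb
      rw [← add_div]
      refine div_le_div_of_nonneg_right ?_ (Nat.cast_nonneg _)
      have hsub : {ω | ¬ ∀ p < L + 1, E p ω} ⊆ {ω | ¬ ∀ p < L, E p ω} ∪ {ω | ¬ E L ω} := by
        intro ω hω
        by_contra hcon
        simp only [Set.mem_union, Set.mem_ofPred_eq, not_or, not_not] at hcon
        refine hω fun p hp => ?_
        rcases Nat.lt_succ_iff_lt_or_eq.1 hp with hp | rfl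
        · exact hcon.1 p hp
        · exact hcon.2
      exact_mod_cast (Set.ncard_le_ncard hsub (Set.toFinite _)).trans (Set.ncard_union_le _ _)
    push_cast
    linarith

/-- An event whose parameter does not depend on the coordinates in the range of `ι`. -/
theorem failureProb_block_le {X Y S : Type} [Finite X] {ι : Y → X} (hι : Function.Injective ι)
    {δ : ℝ} (g : (X → Bool) → S)
    (hg : ∀ ω ω', (∀ x, x ∉ Set.range ι → ω x = ω' x) → g ω = g ω')
    (E : S → (Y → Bool) → Prop) (h : ∀ s, failureProb (Y → Bool) (E s) ≤ δ) :
    failureProb (X → Bool) (fun ω => E (g ω) (ω ∘ ι)) ≤ δ := by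
  classical
  have : Finite Y := Finite.of_injective ι hι
  -- Fubini: the bits split into the block and the rest `Z`. For a fixed rest the parameter is
  -- constant and `h` bounds the failures in the fibre; summing over all assignments to `Z` gives
  -- the claim.
  let Z : Type := {x // x ∉ Set.range ι}
  let e₀ : Y ⊕ Z ≃ X :=
    ((Equiv.ofInjective ι hι).sumCongr (Equiv.refl Z)).trans (Equiv.Set.sumCompl (Set.range ι))
  have he₀l : ∀ y, e₀ (Sum.inl y) = ι y := fun y => rfl
  have he₀r : ∀ z, e₀ (Sum.inr z) = z.1 := fun z => by
    simp only [e₀, Equiv.trans_apply, Equiv.sumCongr_apply, Sum.map_inr, Equiv.refl_apply]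
    exact Equiv.Set.sumCompl_apply_inr _ z
  let e : (Y → Bool) × (Z → Bool) ≃ (X → Bool) :=
    (Equiv.sumArrowEquivProdArrow Y Z Bool).symm.trans (e₀.arrowCongr (Equiv.refl Bool))
  have hel : ∀ q, (e q) ∘ ι = q.1 := by
    intro q
    funext y
    have : e q (e₀ (Sum.inl y)) = q.1 y := by simp [e]; rfl
    rwa [he₀l] at this
  have her : ∀ q (z : Z), e q z.1 = q.2 z := by
    intro q z
    have : e q (e₀ (Sum.inr z)) = q.2 z := by simp [e]; rfl
    rwa [he₀r] at this
  -- Overwriting the block by a fixed assignment does not change the parameter, which is thus a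
  -- function of the rest alone.
  let y₀ : Y → Bool := fun _ => false
  have hg' : ∀ q, g (e q) = g (e (y₀, q.2)) := by
    intro q
    refine hg _ _ fun x hx => ?_
    rw [her q ⟨x, hx⟩, her (y₀, q.2) ⟨x, hx⟩]
  rw [← failureProb_congr_equiv e]
  have heq : (fun q => E (g (e q)) (e q ∘ ι)) = fun q => E (g (e (y₀, q.2))) q.1 := by
    funext q
    rw [hel, hg' q]
  rw [heq]
  have := Fintype.ofFinite (Z → Bool)
  have hfib : ∀ z : Z → Bool, (Nat.card {y : Y → Bool // ¬ E (g (e (y₀, z))) y} : ℝ) ≤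
      δ * Nat.card (Y → Bool) := by
    intro z
    have := h (g (e (y₀, z)))
    unfold failureProb at this
    rwa [div_le_iff₀ (by exact_mod_cast Nat.card_pos)] at this
  have hcard : Nat.card {q : (Y → Bool) × (Z → Bool) // ¬ E (g (e (y₀, q.2))) q.1} =
      ∑ z : Z → Bool, Nat.card {y : Y → Bool // ¬ E (g (e (y₀, z))) y} := by
    rw [← Nat.card_sigma]
    exact Nat.card_congr
      ⟨fun q => ⟨q.1.2, q.1.1, q.2⟩, fun s => ⟨(s.2.1, s.1), s.2.2⟩, fun _ => rfl, fun _ => rfl⟩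
  unfold failureProb
  rw [hcard, div_le_iff₀ (by exact_mod_cast Nat.card_pos), Nat.card_prod]
  push_cast
  refine (Finset.sum_le_sum fun z _ => hfib z).trans ?_
  rw [Finset.sum_const, Finset.card_univ, ← Nat.card_eq_fintype_card, nsmul_eq_mul]
  exact le_of_eq (by ring)

/-- Bits that an event ignores do not change its probability. This disposes of the tapes of nodes
that are no longer live. -/
theorem failureProb_comp_le {X Y : Type} [Finite X] {ι : Y → X} (hι : Function.Injective ι)
    {δ : ℝ} (E : (Y → Bool) → Prop) (h : failureProb (Y → Bool) E ≤ δ) :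
    failureProb (X → Bool) (fun ω => E (ω ∘ ι)) ≤ δ :=
  failureProb_block_le hι (fun _ => ()) (fun _ _ _ => rfl) (fun _ => E) (fun _ => h)

/-- The states of a process whose step number `p` uses the block `ι p` of random bits. -/
def blockRun {X Y S : Type} (ι : ℕ → Y → X) (step : S → (Y → Bool) → S) (s₀ : S)
    (ω : X → Bool) : ℕ → S
  | 0 => s₀
  | p + 1 => step (blockRun ι step s₀ ω p) (ω ∘ ι p)

/-- The state before step `p` is a function of the earlier blocks, which are disjoint from block
`p`. Given that state, block `p` is therefore still uniform, and a bound that is valid for every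
fixed state applies to the random one. -/
theorem failureProb_blockRun_le {X Y S : Type} [Finite X] {ι : ℕ → Y → X} {L : ℕ}
    (hι : ∀ p < L, Function.Injective (ι p))
    (hdisj : ∀ p < L, ∀ q < p, ∀ y y', ι p y ≠ ι q y')
    {δ : ℝ} (step : S → (Y → Bool) → S) (s₀ : S) (E : S → (Y → Bool) → Prop)
    (h : ∀ s, failureProb (Y → Bool) (E s) ≤ δ) :
    failureProb (X → Bool) (fun ω => ∀ p < L, E (blockRun ι step s₀ ω p) (ω ∘ ι p)) ≤ L * δ := by
  refine failureProb_forall_lt_le _ L fun p hp => ?_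
  refine failureProb_block_le (hι p hp) (fun ω => blockRun ι step s₀ ω p) ?_ E h
  intro ω ω' hω
  have key : ∀ q ≤ p, blockRun ι step s₀ ω q = blockRun ι step s₀ ω' q := by
    intro q
    induction q with
    | zero => intro _; rfl
    | succ q ih =>
      intro hq
      have hcomp : ω ∘ ι q = ω' ∘ ι q := by
        funext y
        refine hω _ ?_
        rintro ⟨y', hy'⟩
        exact hdisj p hp q (by omega) y' y hy'
      simp only [blockRun]
      rw [ih (by omega), hcomp]
  exact key p le_rfl

end Probability

/-! ### Networks: live clusters, selection of one edge per cluster -/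

namespace Network

variable {V : Type} {a n r : ℕ} (net : Network V a n r)

theorem cluster_parent (v : V) : net.cluster (net.parent v) = net.cluster v := by
  apply Subtype.ext
  change net.parent^[r] (net.parent v) = net.parent^[r] v
  rw [← Function.iterate_succ_apply, Function.iterate_succ_apply', net.parent_iterate]

theorem cluster_node (x : net.Node) : net.cluster x.1 = x :=
  Subtype.ext (Function.iterate_fixed x.2 r)

/-- The network consisting of the clusters in `R`. -/
def restrict (R : Set net.Node) : Network {v : V // net.cluster v ∈ R} a n r where
  G := net.G.comap Subtype.val
  ident v := net.ident v.1
  ident_injective _ _ h := Subtype.ext (net.ident_injective h)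
  ident_lt v := net.ident_lt v.1
  finite := have := net.finite; inferInstance
  card_le := by
    have := net.finite
    exact (Nat.card_le_card_of_injective _ Subtype.val_injective).trans net.card_le
  parent v := ⟨net.parent v.1, by rw [cluster_parent]; exact v.2⟩
  parent_adj v := (net.parent_adj v.1).imp Subtype.ext id
  parent_iterate v := by
    have h : ∀ k, ((fun v : {v : V // net.cluster v ∈ R} =>
        (⟨net.parent v.1, by rw [cluster_parent]; exact v.2⟩ : {v : V // net.cluster v ∈ R}))^[k]
          v).1 = net.parent^[k] v.1 := by
      intro k
      induction k with
      | zero => rfl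
      | succ k ih => rw [Function.iterate_succ_apply', Function.iterate_succ_apply', ← ih]
    apply Subtype.ext
    simp only [h]
    exact net.parent_iterate v.1

variable (R : Set net.Node)

theorem restrict_iterate (k : ℕ) (v : {v : V // net.cluster v ∈ R}) :
    ((net.restrict R).parent^[k] v).1 = net.parent^[k] v.1 := by
  induction k with
  | zero => rfl
  | succ k ih => rw [Function.iterate_succ_apply', Function.iterate_succ_apply', ← ih]; rfl

theorem cluster_restrict_val (v : {v : V // net.cluster v ∈ R}) :
    ((net.restrict R).cluster v).1.1 = (net.cluster v.1).1 :=
  net.restrict_iterate R r v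

/-- The nodes of the cluster graph of the restricted network. -/
def nodeVal (x : (net.restrict R).Node) : net.Node := ⟨x.1.1, congrArg Subtype.val x.2⟩

theorem nodeVal_cluster (v : {v : V // net.cluster v ∈ R}) :
    net.nodeVal R ((net.restrict R).cluster v) = net.cluster v.1 :=
  Subtype.ext (net.restrict_iterate R r v)

theorem nodeVal_injective : Function.Injective (net.nodeVal R) := fun _ _ h =>
  Subtype.ext (Subtype.ext (congrArg (fun z : net.Node => z.1) h))

theorem nodeVal_mem (x : (net.restrict R).Node) : net.nodeVal R x ∈ R := by
  have h := x.1.2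
  rwa [show net.cluster x.1.1 = net.nodeVal R x from net.cluster_node (net.nodeVal R x)] at h

theorem range_nodeVal : Set.range (net.nodeVal R) = R := by
  ext x
  constructor
  · rintro ⟨y, rfl⟩
    exact net.nodeVal_mem R y
  · intro hx
    exact ⟨⟨⟨x.1, by rwa [net.cluster_node x]⟩, Subtype.ext x.2⟩, rfl⟩

theorem cluster_restrict_eq_iff (u v : {v : V // net.cluster v ∈ R}) :
    (net.restrict R).cluster u = (net.restrict R).cluster v ↔
      net.cluster u.1 = net.cluster v.1 := by
  rw [← nodeVal_cluster, ← nodeVal_cluster, (net.nodeVal_injective R).eq_iff]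

/-- The cluster graph of the restricted network is an induced subgraph. -/
def clusterGraphEmbedding : (net.restrict R).clusterGraph ↪g net.clusterGraph where
  toFun := net.nodeVal R
  inj' := net.nodeVal_injective R
  map_rel_iff' := by
    intro x y
    constructor
    · rintro ⟨hne, u, v, huv, hu, hv⟩
      have hu' : net.cluster u ∈ R := hu ▸ net.nodeVal_mem R x
      have hv' : net.cluster v ∈ R := hv ▸ net.nodeVal_mem R y
      refine ⟨fun h => hne (congrArg _ h), ⟨u, hu'⟩, ⟨v, hv'⟩, huv, ?_, ?_⟩
      · exact net.nodeVal_injective R ((net.nodeVal_cluster R _).trans hu)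
      · exact net.nodeVal_injective R ((net.nodeVal_cluster R _).trans hv)
    · rintro ⟨hne, u, v, huv, hu, hv⟩
      refine ⟨fun h => hne (net.nodeVal_injective R h), u.1, v.1, huv, ?_, ?_⟩
      · rw [← nodeVal_cluster, hu]; rfl
      · rw [← nodeVal_cluster, hv]; rfl

/-! #### Selection -/

variable (lab : V → Option ℕ)

/-- An unclustered node of the network with a clustered neighbour. -/
def IsCandidate (v : V) : Prop := lab v = none ∧ ∃ w, net.G.Adj v w ∧ lab w ≠ none

/-- The candidate with the smallest identifier in its cluster. -/
def IsWinner (v : V) : Prop := net.IsCandidate lab v ∧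
  ∀ u, net.cluster u = net.cluster v → net.IsCandidate lab u → net.ident v ≤ net.ident u

def clusteredNbrs (v : V) : Set ℕ := {k | ∃ w, net.G.Adj v w ∧ net.ident w = k ∧ lab w ≠ none}

/-- The neighbour that a winner chooses. -/
def target (v : V) : ℕ := sInf (net.clusteredNbrs lab v)

/-- The edges that are added to the spanner: tree edges and the edges chosen by the winners. -/
def newChosen (o : V → ClusteringOut) (v : V) : Set ℕ :=
  {k | (∃ ℓ, (ℓ, k) ∈ (o v).treeEdges) ∨
    (net.IsWinner (fun u => (o u).label) v ∧ k = net.target (fun u => (o u).label) v) ∨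
    ∃ w, net.G.Adj v w ∧ net.ident w = k ∧ net.IsWinner (fun u => (o u).label) w ∧
      net.target (fun u => (o u).label) w = net.ident v}

variable {lab}

theorem IsCandidate.exists_target {v : V} (h : net.IsCandidate lab v) :
    ∃ w, net.G.Adj v w ∧ net.ident w = net.target lab v ∧ lab w ≠ none := by
  obtain ⟨w, hw, hl⟩ := h.2
  exact Nat.sInf_mem (s := net.clusteredNbrs lab v) ⟨_, w, hw, rfl, hl⟩

theorem IsWinner.eq {u v : V} (hu : net.IsWinner lab u) (hv : net.IsWinner lab v)
    (h : net.cluster u = net.cluster v) : u = v :=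
  net.ident_injective (le_antisymm (hu.2 v h.symm hv.1) (hv.2 u h hu.1))

theorem IsCandidate.exists_isWinner {v : V} (h : net.IsCandidate lab v) :
    ∃ u, net.cluster u = net.cluster v ∧ net.IsWinner lab u := by
  classical
  have hex : ∃ k, ∃ u, net.ident u = k ∧ net.cluster u = net.cluster v ∧ net.IsCandidate lab u :=
    ⟨_, v, rfl, rfl, h⟩
  obtain ⟨u, hk, hc, hu⟩ := Nat.find_spec hex
  refine ⟨u, hc, hu, fun w hw hw' => ?_⟩
  rw [hk]
  exact Nat.find_min' hex ⟨w, rfl, hw.trans hc, hw'⟩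

variable (lab)

/-- The cluster of the neighbour that is chosen by the winner of a cluster. -/
def chosenNode (x : net.Node) : Option net.Node := by
  classical
  exact if h : ∃ y, ∃ v w, net.cluster v = x ∧ net.IsWinner lab v ∧ net.G.Adj v w ∧
    net.ident w = net.target lab v ∧ net.cluster w = y then some h.choose else none

variable {lab}

/-- A cluster has at most one winner and identifiers are injective, so the right-hand side
determines `y` and the arbitrary choice in the definition is immaterial. -/
theorem chosenNode_eq_some {x y : net.Node} : net.chosenNode lab x = some y ↔
    ∃ v w, net.cluster v = x ∧ net.IsWinner lab v ∧ net.G.Adj v w ∧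
      net.ident w = net.target lab v ∧ net.cluster w = y := by
  classical
  unfold chosenNode
  constructor
  · intro h
    split_ifs at h with hex
    have := hex.choose_spec
    rwa [Option.some_injective _ h] at this
  · rintro ⟨v, w, hv, hw, hadj, ht, hy⟩
    have hex : ∃ y, ∃ v w, net.cluster v = x ∧ net.IsWinner lab v ∧ net.G.Adj v w ∧
        net.ident w = net.target lab v ∧ net.cluster w = y := ⟨y, v, w, hv, hw, hadj, ht, hy⟩
    rw [dif_pos hex]
    obtain ⟨v', w', hv', hw', hadj', ht', hy'⟩ := hex.choose_spec
    have hvv : v' = v := hw'.eq net hw (hv'.trans hv.symm)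
    subst hvv
    have hww : w' = w := net.ident_injective (ht'.trans ht.symm)
    subst hww
    rw [← hy', hy]

end Network

/-! ### Local outputs of a clustering run and the graph of edges that they select -/

namespace EncodesClustering

variable {V : Type} {a n r : ℕ} {net : Network V a n r} {o : V → ClusteringOut}
  {cl : net.Node → Option ℕ} {T : ℕ → net.clusterGraph.Subgraph}
  (h : EncodesClustering net o cl T)
include h

theorem label_eq (v : V) : cl (net.cluster v) = (o v).label := (h.label v).symm

theorem chosenNode_spec {x y : net.Node}
    (hxy : net.chosenNode (fun v => (o v).label) x = some y) :
    net.clusterGraph.Adj x y ∧ cl x = none ∧ cl y ≠ none := by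
  obtain ⟨v, w, rfl, hw, hadj, ht, rfl⟩ := net.chosenNode_eq_some.1 hxy
  obtain ⟨w', hadj', ht', hl'⟩ := hw.1.exists_target net
  obtain rfl : w = w' := net.ident_injective (ht.trans ht'.symm)
  have h1 : cl (net.cluster v) = none := (h.label_eq v).trans hw.1.1
  have h2 : cl (net.cluster w) ≠ none := fun hn => hl' ((h.label_eq w).symm.trans hn)
  -- One end is clustered and the other is not, so the edge joins different clusters and survives
  -- the contraction.
  exact ⟨⟨fun he => h2 (he ▸ h1), v, w, hadj, rfl, rfl⟩, h1, h2⟩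

/-- The given edge makes its end in `x` a candidate, and a cluster with a candidate has a winner.
The winner may choose a cluster other than `y`; any clustered neighbour serves for the stretch. -/
theorem chosenNode_ne_none {x y : net.Node} (hadj : net.clusterGraph.Adj x y)
    (hx : cl x = none) (hy : cl y ≠ none) :
    net.chosenNode (fun v => (o v).label) x ≠ none := by
  obtain ⟨-, u, v, huv, rfl, rfl⟩ := hadj
  have hcand : net.IsCandidate (fun v => (o v).label) u :=
    ⟨(h.label u).trans hx, v, huv, fun hn => hy ((h.label_eq v).trans hn)⟩
  obtain ⟨w, hw, hwin⟩ := hcand.exists_isWinner net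
  obtain ⟨z, hz, hzt, -⟩ := hwin.1.exists_target net
  rw [net.chosenNode_eq_some.2 ⟨w, z, hw, hwin, hz, hzt, rfl⟩]
  exact Option.some_ne_none _

/-- The third alternative in `newChosen` mirrors the second at the other end of the edge; tree edges
are known at both ends by assumption. -/
theorem newChosen_symm {v : V} {k : ℕ} (hk : k ∈ net.newChosen o v) :
    ∃ w, net.G.Adj v w ∧ net.ident w = k ∧ net.ident v ∈ net.newChosen o w := by
  rcases hk with ⟨ℓ, hℓ⟩ | ⟨hwin, rfl⟩ | ⟨w, hadj, rfl, hwin, ht⟩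
  · obtain ⟨w, hadj, hk, hw⟩ := h.consistent v ℓ k hℓ
    exact ⟨w, hadj, hk, Or.inl ⟨ℓ, hw⟩⟩
  · obtain ⟨z, hz, hzt, -⟩ := hwin.1.exists_target net
    exact ⟨z, hz, hzt, Or.inr (Or.inr ⟨v, hz.symm, rfl, hwin, hzt.symm⟩)⟩
  · exact ⟨w, hadj, rfl, Or.inr (Or.inl ⟨hwin, ht.symm⟩)⟩

theorem attachGraph_adj_iff (hc : ∀ x y, net.chosenNode (fun v => (o v).label) x = some y →
    net.clusterGraph.Adj x y) (x y : net.Node) :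
    (attachGraph T (net.chosenNode (fun v => (o v).label)) hc).Adj x y ↔ x ≠ y ∧
      ∃ u v, net.G.Adj u v ∧ net.cluster u = x ∧ net.cluster v = y ∧
        net.ident v ∈ net.newChosen o u := by
  constructor
  · intro hadj
    refine ⟨hadj.ne, ?_⟩
    rcases hadj with ⟨ℓ, hℓ⟩ | hxy | hxy
    · obtain ⟨-, u, v, huv, hu, hv, ho⟩ := (h.edges ℓ x y).1 hℓ
      exact ⟨u, v, huv, hu, hv, Or.inl ⟨ℓ, ho⟩⟩
    · obtain ⟨v, w, hv, hw, hadj, ht, hy⟩ := net.chosenNode_eq_some.1 hxy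
      exact ⟨v, w, hadj, hv, hy, Or.inr (Or.inl ⟨hw, ht⟩)⟩
    · obtain ⟨v, w, hv, hw, hadj, ht, hy⟩ := net.chosenNode_eq_some.1 hxy
      exact ⟨w, v, hadj.symm, hy, hv, Or.inr (Or.inr ⟨v, hadj.symm, rfl, hw, ht.symm⟩)⟩
  · rintro ⟨hne, u, v, huv, hu, hv, ⟨ℓ, hℓ⟩ | ⟨hwin, ht⟩ | ⟨w, hadj, hw, hwin, ht⟩⟩
    · exact Or.inl ⟨ℓ, (h.edges ℓ x y).2 ⟨hne, u, v, huv, hu, hv, hℓ⟩⟩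
    · exact Or.inr (Or.inl (net.chosenNode_eq_some.2 ⟨u, v, hu, hwin, huv, ht, hv⟩))
    · obtain rfl : w = v := net.ident_injective hw
      exact Or.inr (Or.inr (net.chosenNode_eq_some.2 ⟨w, u, hv, hwin, huv.symm, ht.symm, hu⟩))

end EncodesClustering

/-! ### Flooding in clusters -/

namespace Network

variable {V : Type} {a n r : ℕ} (net : Network V a n r)

/-- In each step, every node takes the minimum of its value and those of its neighbours in the same
cluster. -/
def flood (c : V → ℕ) : ℕ → V → ℕ
  | 0 => c
  | t + 1 => fun v => sInf (insert (flood c t v)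
      {k | ∃ w, net.G.Adj v w ∧ net.cluster w = net.cluster v ∧ flood c t w = k})

variable (c : V → ℕ)

theorem flood_eq_init (t : ℕ) (v : V) :
    ∃ u, net.cluster u = net.cluster v ∧ net.flood c t v = c u := by
  induction t generalizing v with
  | zero => exact ⟨v, rfl, rfl⟩
  | succ t ih =>
    have := Nat.sInf_mem (s := insert (net.flood c t v)
      {k | ∃ w, net.G.Adj v w ∧ net.cluster w = net.cluster v ∧ net.flood c t w = k})
      (Set.insert_nonempty _ _)
    rcases this with h | ⟨w, -, hw, h⟩
    · obtain ⟨u, hu, hc⟩ := ih v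
      exact ⟨u, hu, h.trans hc⟩
    · obtain ⟨u, hu, hc⟩ := ih w
      exact ⟨u, hu.trans hw, h.symm.trans hc⟩

theorem flood_succ_le (t : ℕ) {v w : V} (h : v = w ∨ net.G.Adj v w)
    (hc : net.cluster w = net.cluster v) : net.flood c (t + 1) v ≤ net.flood c t w := by
  refine Nat.sInf_le ?_
  rcases h with rfl | h
  · exact Set.mem_insert _ _
  · exact Set.mem_insert_of_mem _ ⟨w, h, hc, rfl⟩

/-- Upward half: a value reaches the ancestor at height `t` within `t` steps. -/
theorem flood_iterate_le (t : ℕ) (v : V) : net.flood c t (net.parent^[t] v) ≤ c v := by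
  induction t with
  | zero => exact le_rfl
  | succ t ih =>
    rw [Function.iterate_succ_apply']
    refine (net.flood_succ_le c t ?_ (net.cluster_parent _).symm).trans ih
    exact (net.parent_adj (net.parent^[t] v)).imp id (fun h => h.symm)

/-- Downward half: within `t` further steps, `v` learns what its ancestor at height `t` knew. -/
theorem flood_add_le (s t : ℕ) (v : V) :
    net.flood c (s + t) v ≤ net.flood c s (net.parent^[t] v) := by
  induction t generalizing v with
  | zero => exact le_rfl
  | succ t ih =>
    rw [Function.iterate_succ_apply]
    exact (net.flood_succ_le c (s + t) ((net.parent_adj v).imp Eq.symm id)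
      (net.cluster_parent v)).trans (ih _)

/-- Every value travels to the root in `r` steps and from there to any node in `r` more. The values
spread along all edges inside the cluster; the tree serves only to bound the time. -/
theorem flood_le {u v : V} (h : net.cluster u = net.cluster v) :
    net.flood c (r + r) v ≤ c u := by
  refine (net.flood_add_le c r r v).trans ?_
  have : net.parent^[r] v = net.parent^[r] u := (congrArg Subtype.val h).symm
  rw [this]
  exact net.flood_iterate_le c r u

/-- Nodes that are not candidates start with `n ^ a`, which exceeds all identifiers. So the flooded
minimum is the identifier of the winner if the cluster has one, and `n ^ a` otherwise; each node can
test this locally. -/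
theorem isWinner_iff_flood (lab : V → Option ℕ)
    (hc : ∀ v, (net.IsCandidate lab v → c v = net.ident v) ∧
      (¬ net.IsCandidate lab v → c v = n ^ a)) (v : V) :
    net.IsWinner lab v ↔ lab v = none ∧ net.flood c (r + r) v = net.ident v := by
  obtain ⟨u, hu, huv⟩ := net.flood_eq_init c (r + r) v
  constructor
  · intro h
    refine ⟨h.1.1, le_antisymm ?_ ?_⟩
    · rw [← (hc v).1 h.1]
      exact net.flood_le c rfl
    · rw [huv]
      by_cases hcu : net.IsCandidate lab u
      · rw [(hc u).1 hcu]
        exact h.2 u hu hcu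
      · rw [(hc u).2 hcu]
        exact (net.ident_lt v).le
  · rintro ⟨-, hf⟩
    have hcu : net.IsCandidate lab u := by
      by_contra hn
      rw [(hc u).2 hn, hf] at huv
      exact (net.ident_lt v).ne huv
    have huv' : u = v := net.ident_injective (by rw [← (hc u).1 hcu, ← huv, hf])
    subst huv'
    refine ⟨hcu, fun w hw hcw => ?_⟩
    rw [← hf, ← (hc w).1 hcw]
    exact net.flood_le c hw

end Network

/-! ### The CONGEST algorithm -/

namespace CongestAlg

section

variable {Out : Type} (A : CongestAlg Out) {V : Type} {a n r : ℕ}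

theorem inbox_eq_some (net : Network V a n r) (s : V → A.State n r) (v : V) (k : ℕ)
    (m : A.Msg n r) : A.inbox net s v k = some m ↔
      ∃ w, net.G.Adj v w ∧ net.ident w = k ∧ A.send n r (s w) (net.ident v) = some m := by
  unfold inbox
  split_ifs with h
  · constructor
    · intro hs
      exact ⟨h.choose, h.choose_spec.1, h.choose_spec.2, hs⟩
    · rintro ⟨w, hw, hk, hs⟩
      have : h.choose = w := net.ident_injective (h.choose_spec.2.trans hk.symm)
      rwa [this]
  · simp only [false_iff]
    rintro ⟨w, hw, hk, -⟩
    exact h ⟨w, hw, hk⟩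

/-- One round. -/
def step (net : Network V a n r) (s : V → A.State n r) (v : V) : A.State n r :=
  A.recv n r (s v) (A.inbox net s v)

theorem stateAfter_eq_iterate (net : Network V a n r) (ω : A.Tapes V n r) (t : ℕ) :
    A.stateAfter net ω t = (A.step net)^[t] (A.stateAfter net ω 0) := by
  induction t with
  | zero => rfl
  | succ t ih => rw [Function.iterate_succ_apply', ← ih]; rfl

end

variable (A : CongestAlg ClusteringOut)

/-- The number of rounds of one phase. -/
def phaseLength (n r : ℕ) : ℕ := A.rounds n r + 1 + (r + r) + 1

/-- `tape` holds the bits for all phases; `inp` is the input of the node in the network of live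
nodes, and `sub` the state of the simulated clustering algorithm. `clNbrs` are the neighbours
clustered in the current phase, `cand` is the value being flooded, and `chosen` accumulates the
selected edges. -/
structure SpannerState (n r : ℕ) where
  clock : ℕ
  tape : Fin ((Nat.log 2 n + 1) * A.bits n r) → Bool
  inp : NodeInput
  alive : Prop
  sub : A.State n r
  clNbrs : Set ℕ
  cand : ℕ
  chosen : Set ℕ

/-- A message of the simulated algorithm, or a pair. In the flooding rounds the pair consists of the
name of the cluster and the flooded value. The range includes `n ^ a`, the value of a cluster
without candidates. -/
abbrev SpannerMsg (a n r : ℕ) : Type := A.Msg n r ⊕ (Fin (n ^ a + 1) × Fin (n ^ a + 1))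

/-- The position of bit number `j` of block number `p`. -/
def blockIndex {L b : ℕ} (p : ℕ) (j : Fin b) : Fin ((L + 1) * b) :=
  -- The reduction makes the index total. It is inactive for `p ≤ L` and affects only the run that
  -- is prepared after the last phase and never carried out.
  ⟨(p * b + j) % ((L + 1) * b), Nat.mod_lt _ (Nat.mul_pos L.succ_pos (Fin.pos j))⟩

namespace SpannerState

variable {A} {n r : ℕ}

def label (s : A.SpannerState n r) : Option ℕ := (A.out n r s.sub).label

open Classical in
/-- A phase: a run of the clustering algorithm, one round in which the live nodes tell whether they
are clustered, flooding of the smallest identifier of a candidate in each cluster, and one round in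
which the selected candidates notify the neighbours that they choose. -/
def send (a : ℕ) (s : A.SpannerState n r) (k : ℕ) : Option (A.SpannerMsg a n r) :=
  if ¬ s.alive then none
  else if s.clock % A.phaseLength n r < A.rounds n r then (A.send n r s.sub k).map Sum.inl
  else if s.clock % A.phaseLength n r < A.rounds n r + 1 then
    some (Sum.inr (Fin.ofNat _ (if s.label = none then 0 else 1), 0))
  else if s.clock % A.phaseLength n r < A.rounds n r + 1 + (r + r) then
    some (Sum.inr (Fin.ofNat _ s.inp.cluster, Fin.ofNat _ s.cand))
  else if s.label = none ∧ s.cand = s.inp.ident ∧ k = sInf s.clNbrs then some (Sum.inr (0, 0))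
  else none

-- A node that is not live is frozen, which preserves its output. In the announcement round the
-- neighbours in `inp` are cut down to the unclustered ones, which is the input for the next run.
-- The quotient of the clock by the length of a phase selects the block of random bits.
open Classical in
def recv (a : ℕ) (s : A.SpannerState n r) (ib : ℕ → Option (A.SpannerMsg a n r)) :
    A.SpannerState n r :=
  if ¬ s.alive then s
  else if s.clock % A.phaseLength n r < A.rounds n r then
    { s with
      clock := s.clock + 1
      sub := A.recv n r s.sub (fun k => (ib k).bind Sum.getLeft?) }
  else if s.clock % A.phaseLength n r < A.rounds n r + 1 then
    { s with
      clock := s.clock + 1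
      inp := { s.inp with nbrs := {k | ∃ m, ib k = some (Sum.inr m) ∧ m.1.val = 0} }
      clNbrs := {k | ∃ m, ib k = some (Sum.inr m) ∧ m.1.val ≠ 0}
      cand := if s.label = none ∧ {k | ∃ m, ib k = some (Sum.inr m) ∧ m.1.val ≠ 0}.Nonempty
        then s.inp.ident else n ^ a }
  else if s.clock % A.phaseLength n r < A.rounds n r + 1 + (r + r) then
    { s with
      clock := s.clock + 1
      cand := sInf (insert s.cand
        {c | ∃ k m, ib k = some (Sum.inr m) ∧ m.1.val = s.inp.cluster ∧ m.2.val = c}) }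
  else
    { s with
      clock := s.clock + 1
      alive := s.label = none
      sub := A.init n r s.inp
        (fun j => s.tape (blockIndex ((s.clock + 1) / A.phaseLength n r) j))
      chosen := s.chosen ∪ {k | (∃ ℓ, (ℓ, k) ∈ (A.out n r s.sub).treeEdges) ∨
        (s.label = none ∧ s.cand = s.inp.ident ∧ k = sInf s.clNbrs) ∨ ib k ≠ none} }

end SpannerState

/-- The spanner algorithm that repeatedly runs the clustering algorithm on the live nodes. -/
def spannerAlg (a : ℕ) : CongestAlg (Set ℕ) where
  rounds n r := (Nat.log 2 n + 1) * A.phaseLength n r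
  bits n r := (Nat.log 2 n + 1) * A.bits n r
  bandwidth := A.bandwidth + 2 * a + 3
  Msg := A.SpannerMsg a
  msg_finite n r := have := A.msg_finite n r; inferInstance
  msg_card n r := by
    have := A.msg_finite n r
    have h1 := A.msg_card n r
    rw [Nat.card_sum, Nat.card_prod, Nat.card_fin]
    set l := Nat.log 2 n + 1 with hl
    -- With `x = 2 ^ (a * l)` and `y = 2 ^ (bandwidth * l)`, the number of messages is at most `y +
    -- (2 * x) ^ 2 ≤ 8 * x ^ 2 * y`. The factor `8 ≤ 2 ^ (3 * l)` accounts for the summand `3` in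
    -- the bandwidth.
    have hn : n ^ a ≤ 2 ^ (a * l) := by
      rw [mul_comm, pow_mul]
      exact Nat.pow_le_pow_left (Nat.lt_pow_succ_log_self (by norm_num) n).le a
    have hpos : 1 ≤ 2 ^ (a * l) := Nat.one_le_two_pow
    have hposb : 1 ≤ 2 ^ (A.bandwidth * l) := Nat.one_le_two_pow
    have h2 : (n ^ a + 1) * (n ^ a + 1) ≤ (2 * 2 ^ (a * l)) * (2 * 2 ^ (a * l)) :=
      Nat.mul_le_mul (by omega) (by omega)
    have h3 : (A.bandwidth + 2 * a + 3) * l = A.bandwidth * l + a * l + a * l + 3 * l := by ring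
    have h4 : 8 ≤ 2 ^ (3 * l) :=
      (Nat.pow_le_pow_right (by norm_num) (by omega : 3 ≤ 3 * l) : 2 ^ 3 ≤ 2 ^ (3 * l))
    rw [h3, pow_add, pow_add, pow_add]
    generalize 2 ^ (a * l) = x at *
    generalize 2 ^ (A.bandwidth * l) = y at *
    have hxx : 1 ≤ x * x := Nat.mul_pos hpos hpos
    have h5 : y + 4 * (x * x) ≤ y * (x * x) * 8 := by nlinarith
    calc _ ≤ y + (2 * x) * (2 * x) := add_le_add h1 h2
      _ = y + 4 * (x * x) := by ring
      _ ≤ y * (x * x) * 8 := h5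
      _ ≤ _ := by rw [mul_assoc y x x]; exact Nat.mul_le_mul_left _ h4
  State := A.SpannerState
  init n r i τ :=
    { clock := 0
      tape := τ
      inp := i
      alive := True
      sub := A.init n r i (fun j => τ (blockIndex 0 j))
      clNbrs := ∅
      cand := 0
      chosen := ∅ }
  send _ _ s k := s.send a k
  recv _ _ s ib := s.recv a ib
  out _ _ s := s.chosen

namespace spannerAlg

open SpannerState

variable {A} {V : Type} {a n r : ℕ}

section

variable (net : Network V a n r) (p : ℕ)

/-- What a node receives. -/
def inbox (s : V → A.SpannerState n r) (v : V) (k : ℕ) : Option (A.SpannerMsg a n r) :=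
  CongestAlg.inbox (A.spannerAlg a) net s v k

/-- One round. -/
def round (s : V → A.SpannerState n r) (v : V) : A.SpannerState n r :=
  (s v).recv a (inbox net s v)

theorem inbox_eq_some (s : V → A.SpannerState n r) (v : V) (k : ℕ) (m : A.SpannerMsg a n r) :
    inbox net s v k = some m ↔
      ∃ w, net.G.Adj v w ∧ net.ident w = k ∧ (s w).send a (net.ident v) = some m :=
  CongestAlg.inbox_eq_some (A.spannerAlg a) net s v k m

theorem phaseLength_pos : 0 < A.phaseLength n r := Nat.succ_pos _

theorem clock_mod {q : ℕ} (hq : q < A.phaseLength n r) :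
    (p * A.phaseLength n r + q) % A.phaseLength n r = q := by
  rw [Nat.mul_add_mod', Nat.mod_eq_of_lt hq]

/-- A run of the clustering algorithm within the spanner algorithm. -/
theorem step_iterate_run (τ : A.Tapes V n r) (s : V → A.SpannerState n r)
    (halive : ∀ v, (s v).alive) (hclock : ∀ v, (s v).clock = p * A.phaseLength n r)
    (hsub : ∀ v, (s v).sub = A.init n r (net.input v) (τ v)) (q : ℕ) (hq : q ≤ A.rounds n r) :
    (round net)^[q] s = fun v =>
      { s v with
        clock := p * A.phaseLength n r + q
        sub := A.stateAfter net τ q v } := by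
  induction q with
  | zero =>
    funext v
    rw [Function.iterate_zero, id_eq, add_zero, ← hclock v, stateAfter]
    simp only [← hsub v]
  | succ q ih =>
    rw [Function.iterate_succ_apply', ih (by omega)]
    funext v
    have hmod : (p * A.phaseLength n r + q) % A.phaseLength n r = q :=
      clock_mod p (by unfold phaseLength; omega)
    have hlt : (p * A.phaseLength n r + q) % A.phaseLength n r < A.rounds n r := by omega
    simp only [round, SpannerState.recv, halive, not_true_eq_false, if_false, hlt,
      if_true, stateAfter, add_assoc]
    congr 2
    funext k
    refine Option.ext fun m => ?_
    rw [CongestAlg.inbox_eq_some]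
    constructor
    · intro h
      obtain ⟨x, hx, hxm⟩ := Option.bind_eq_some_iff.1 h
      obtain ⟨w, hw, hk, hs⟩ := (inbox_eq_some net _ v k x).1 hx
      refine ⟨w, hw, hk, ?_⟩
      simp only [SpannerState.send, not_true_eq_false, if_false, hlt,
        if_true, Option.map_eq_some_iff] at hs
      obtain ⟨m', hm', rfl⟩ := hs
      rw [hm']
      simpa using hxm
    · rintro ⟨w, hw, hk, hs⟩
      refine Option.bind_eq_some_iff.2 ⟨Sum.inl m, ?_, rfl⟩
      refine (inbox_eq_some net _ v k _).2 ⟨w, hw, hk, ?_⟩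
      simp only [SpannerState.send, not_true_eq_false, if_false, hlt,
        if_true, hs, Option.map_some]

open Classical in
/-- The round in which the live nodes tell whether they are clustered. -/
theorem step_announce (s : V → A.SpannerState n r) (halive : ∀ v, (s v).alive)
    (hclock : ∀ v, (s v).clock = p * A.phaseLength n r + A.rounds n r)
    (hident : ∀ v, (s v).inp.ident = net.ident v) :
    round net s = fun v =>
      { s v with
        clock := p * A.phaseLength n r + A.rounds n r + 1
        inp := { (s v).inp with
          nbrs := {k | ∃ w, net.G.Adj v w ∧ net.ident w = k ∧ (s w).label = none} }
        clNbrs := net.clusteredNbrs (fun w => (s w).label) v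
        cand := if net.IsCandidate (fun w => (s w).label) v then net.ident v else n ^ a } := by
  funext v
  have hmod : (p * A.phaseLength n r + A.rounds n r) % A.phaseLength n r = A.rounds n r :=
    clock_mod p (by unfold phaseLength; omega)
  -- The announcements `0` and `1` are different elements of `Fin (n ^ a + 1)`: as `v` has an
  -- identifier below `n ^ a`, this power is positive.
  have hna : 1 < n ^ a + 1 := by have := net.ident_lt v; omega
  have hin : ∀ k m, inbox net s v k = some (Sum.inr m) ↔
      ∃ w, net.G.Adj v w ∧ net.ident w = k ∧
        m = (Fin.ofNat _ (if (s w).label = none then 0 else 1), 0) := by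
    intro k m
    rw [inbox_eq_some]
    simp only [SpannerState.send, halive, hclock, hmod, not_true_eq_false, if_false,
      lt_irrefl, Nat.lt_succ_self, if_true, Option.some.injEq, Sum.inr.injEq, eq_comm]
  have h0 : {k | ∃ m, inbox net s v k = some (Sum.inr m) ∧ m.1.val = 0} =
      {k | ∃ w, net.G.Adj v w ∧ net.ident w = k ∧ (s w).label = none} := by
    ext k
    constructor
    · rintro ⟨m, hm, hm0⟩
      obtain ⟨w, hw, hk, rfl⟩ := (hin k m).1 hm
      refine ⟨w, hw, hk, ?_⟩
      by_contra hn
      simp [hn, Fin.ofNat, Nat.mod_eq_of_lt hna] at hm0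
    · rintro ⟨w, hw, hk, hl⟩
      exact ⟨_, (hin k _).2 ⟨w, hw, hk, rfl⟩, by simp [hl]⟩
  have h1 : {k | ∃ m, inbox net s v k = some (Sum.inr m) ∧ m.1.val ≠ 0} =
      net.clusteredNbrs (fun w => (s w).label) v := by
    ext k
    constructor
    · rintro ⟨m, hm, hm0⟩
      obtain ⟨w, hw, hk, rfl⟩ := (hin k m).1 hm
      refine ⟨w, hw, hk, fun hn => ?_⟩
      simp [hn] at hm0
    · rintro ⟨w, hw, hk, hl⟩
      exact ⟨_, (hin k _).2 ⟨w, hw, hk, rfl⟩, by simp [hl, Fin.ofNat, Nat.mod_eq_of_lt hna]⟩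
  have hc : ((s v).label = none ∧ (net.clusteredNbrs (fun w => (s w).label) v).Nonempty) ↔
      net.IsCandidate (fun w => (s w).label) v := by
    refine and_congr_right fun _ => ⟨?_, ?_⟩
    · rintro ⟨k, w, hw, -, hl⟩
      exact ⟨w, hw, hl⟩
    · rintro ⟨w, hw, hl⟩
      exact ⟨_, w, hw, rfl, hl⟩
  rw [round, SpannerState.recv]
  simp only [halive, hclock, hmod, not_true_eq_false, if_false, lt_irrefl, Nat.lt_succ_self,
    if_true]
  rw [h0, h1]
  simp only [hc, hident]

/-- Flooding of the smallest identifier of a candidate. -/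
theorem step_iterate_flood (s : V → A.SpannerState n r) (halive : ∀ v, (s v).alive)
    (hclock : ∀ v, (s v).clock = p * A.phaseLength n r + A.rounds n r + 1)
    (hcluster : ∀ v, (s v).inp.cluster = net.ident (net.cluster v).1)
    (hcand : ∀ v, (s v).cand ≤ n ^ a) (q : ℕ) (hq : q ≤ r + r) :
    (round net)^[q] s = fun v =>
      { s v with
        clock := p * A.phaseLength n r + A.rounds n r + 1 + q
        cand := net.flood (fun w => (s w).cand) q v } := by
  induction q with
  | zero =>
    funext v
    rw [Function.iterate_zero, id_eq, add_zero, Network.flood, ← hclock v]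
  | succ q ih =>
    rw [Function.iterate_succ_apply', ih (by omega)]
    funext v
    have hmod : (p * A.phaseLength n r + A.rounds n r + 1 + q) % A.phaseLength n r =
        A.rounds n r + 1 + q := by
      rw [add_assoc, add_assoc, ← add_assoc (A.rounds n r)]
      exact clock_mod p (by unfold phaseLength; omega)
    have hlt1 : ¬ A.rounds n r + 1 + q < A.rounds n r := by omega
    have hlt2 : ¬ A.rounds n r + 1 + q < A.rounds n r + 1 := by omega
    have hlt3 : A.rounds n r + 1 + q < A.rounds n r + 1 + (r + r) := by omega
    set s' : V → A.SpannerState n r := fun v =>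
      { s v with
        clock := p * A.phaseLength n r + A.rounds n r + 1 + q
        cand := net.flood (fun w => (s w).cand) q v } with hs'
    -- Flooded values are initial values, so they fit into a message without reduction.
    have hle : ∀ w, net.flood (fun w => (s w).cand) q w < n ^ a + 1 := by
      intro w
      obtain ⟨u, -, hu⟩ := net.flood_eq_init (fun w => (s w).cand) q w
      rw [hu]
      exact Nat.lt_succ_of_le (hcand u)
    have hin : ∀ k m, inbox net s' v k = some (Sum.inr m) ↔
        ∃ w, net.G.Adj v w ∧ net.ident w = k ∧ m = (Fin.ofNat _ (net.ident (net.cluster w).1),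
          Fin.ofNat _ (net.flood (fun w => (s w).cand) q w)) := by
      intro k m
      rw [inbox_eq_some]
      simp only [SpannerState.send, hs', halive, hmod, not_true_eq_false, if_false,
        hlt1, hlt2, hlt3, if_true, Option.some.injEq, Sum.inr.injEq, hcluster, eq_comm]
    have hset : {c | ∃ k m, inbox net s' v k = some (Sum.inr m) ∧
        m.1.val = (s' v).inp.cluster ∧ m.2.val = c} =
        {k | ∃ w, net.G.Adj v w ∧ net.cluster w = net.cluster v ∧
          net.flood (fun w => (s w).cand) q w = k} := by
      ext c
      constructor
      · rintro ⟨k, m, hm, hm1, hm2⟩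
        obtain ⟨w, hw, hk, rfl⟩ := (hin k m).1 hm
        refine ⟨w, hw, ?_, ?_⟩
        · have hlt := net.ident_lt (net.cluster w).1
          simp only [Fin.ofNat, Nat.mod_eq_of_lt (hlt.trans (Nat.lt_succ_self _)), hs',
            hcluster] at hm1
          exact Subtype.ext (net.ident_injective hm1)
        · simpa [Fin.ofNat, Nat.mod_eq_of_lt (hle w)] using hm2
      · rintro ⟨w, hw, hcl, hc⟩
        refine ⟨_, _, (hin _ _).2 ⟨w, hw, rfl, rfl⟩, ?_, ?_⟩
        · have hlt := net.ident_lt (net.cluster w).1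
          simp only [Fin.ofNat, hs', hcluster, hcl]
          rw [← hcl, Nat.mod_eq_of_lt (hlt.trans (Nat.lt_succ_self _))]
        · simpa [Fin.ofNat, Nat.mod_eq_of_lt (hle w)] using hc
    rw [round, SpannerState.recv]
    rw [hset]
    simp only [hs', halive, hmod, not_true_eq_false, if_false, hlt1, hlt2, hlt3, if_true,
      Network.flood]
    rfl

/-- The last round of a phase. -/
theorem step_notify (s : V → A.SpannerState n r) (halive : ∀ v, (s v).alive)
    (hclock : ∀ v, (s v).clock = p * A.phaseLength n r + A.rounds n r + 1 + (r + r)) :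
    round net s = fun v =>
      { s v with
        clock := (p + 1) * A.phaseLength n r
        alive := (s v).label = none
        sub := A.init n r (s v).inp (fun j => (s v).tape (blockIndex (p + 1) j))
        chosen := (s v).chosen ∪ {k | (∃ ℓ, (ℓ, k) ∈ (A.out n r (s v).sub).treeEdges) ∨
          ((s v).label = none ∧ (s v).cand = (s v).inp.ident ∧ k = sInf (s v).clNbrs) ∨
          ∃ w, net.G.Adj v w ∧ net.ident w = k ∧ (s w).label = none ∧
            (s w).cand = (s w).inp.ident ∧ net.ident v = sInf (s w).clNbrs} } := by
  funext v
  have hmod : (p * A.phaseLength n r + A.rounds n r + 1 + (r + r)) % A.phaseLength n r =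
      A.rounds n r + 1 + (r + r) := by
    rw [add_assoc, add_assoc, ← add_assoc (A.rounds n r)]
    exact clock_mod p (by unfold phaseLength; omega)
  have hlt1 : ¬ A.rounds n r + 1 + (r + r) < A.rounds n r := by omega
  have hlt2 : ¬ A.rounds n r + 1 + (r + r) < A.rounds n r + 1 := by omega
  have hnext : p * A.phaseLength n r + A.rounds n r + 1 + (r + r) + 1 =
      (p + 1) * A.phaseLength n r := by
    rw [add_mul, one_mul]
    unfold phaseLength
    omega
  have hin : ∀ k, inbox net s v k ≠ none ↔
      ∃ w, net.G.Adj v w ∧ net.ident w = k ∧ (s w).label = none ∧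
            (s w).cand = (s w).inp.ident ∧ net.ident v = sInf (s w).clNbrs := by
    intro k
    rw [Option.ne_none_iff_exists']
    simp only [inbox_eq_some, SpannerState.send, halive, hclock, hmod, not_true_eq_false, if_false,
      hlt1, hlt2, lt_irrefl]
    constructor
    · rintro ⟨m, w, hw, hk, hm⟩
      split_ifs at hm with hc
      exact ⟨w, hw, hk, hc⟩
    · rintro ⟨w, hw, hk, hc⟩
      exact ⟨_, w, hw, hk, if_pos hc⟩
  rw [round, SpannerState.recv]
  simp only [halive, hclock, hmod, not_true_eq_false, if_false, hlt1, hlt2, lt_irrefl, hin, hnext,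
    Nat.mul_div_cancel _ (phaseLength_pos (A := A) (n := n) (r := r))]

/-- The states at the beginning of phase `p` if all nodes are live. -/
structure IsStart (ω : V → Fin ((Nat.log 2 n + 1) * A.bits n r) → Bool) (Ch : V → Set ℕ)
    (s : V → A.SpannerState n r) : Prop where
  clock : ∀ v, (s v).clock = p * A.phaseLength n r
  tape : ∀ v, (s v).tape = ω v
  inp : ∀ v, (s v).inp = net.input v
  alive : ∀ v, (s v).alive
  sub : ∀ v, (s v).sub = A.init n r (net.input v) (fun j => ω v (blockIndex p j))
  chosen : ∀ v, (s v).chosen = Ch v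

/-- The states after a phase. -/
structure IsEnd (ω : V → Fin ((Nat.log 2 n + 1) * A.bits n r) → Bool) (Ch : V → Set ℕ)
    (o : V → ClusteringOut) (s : V → A.SpannerState n r) : Prop where
  clock : ∀ v, (s v).clock = (p + 1) * A.phaseLength n r
  tape : ∀ v, (s v).tape = ω v
  inp : ∀ v, (s v).inp = { net.input v with
    nbrs := {k | ∃ w, net.G.Adj v w ∧ net.ident w = k ∧ (o w).label = none} }
  alive : ∀ v, (s v).alive ↔ (o v).label = none
  sub : ∀ v, (s v).sub = A.init n r (s v).inp (fun j => ω v (blockIndex (p + 1) j))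
  chosen : ∀ v, (s v).chosen = Ch v ∪ net.newChosen o v

/-- The four segments of a phase are composed, and `isWinner_iff_flood` identifies the locally
selected nodes with the winners. -/
theorem isEnd_of_isStart {ω : V → Fin ((Nat.log 2 n + 1) * A.bits n r) → Bool} {Ch : V → Set ℕ}
    {s : V → A.SpannerState n r} (h : IsStart net p ω Ch s) :
    IsEnd net p ω Ch (A.output net (fun v j => ω v (blockIndex p j)))
      ((round net)^[A.phaseLength n r] s) := by
  classical
  set τ : A.Tapes V n r := fun v j => ω v (blockIndex p j) with hτ
  set o := A.output net τ with ho
  set lab : V → Option ℕ := fun v => (o v).label with hlab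
  -- The segments appear in reverse order, because an iterate of a sum applies the last summand
  -- first.
  have hsplit : A.phaseLength n r = 1 + ((r + r) + (1 + A.rounds n r)) := by
    unfold phaseLength; omega
  rw [hsplit, Function.iterate_add_apply, Function.iterate_add_apply (m := r + r),
    Function.iterate_add_apply (m := 1) (n := A.rounds n r)]
  rw [step_iterate_run net p τ s h.alive h.clock h.sub _ le_rfl]
  simp only [Function.iterate_one]
  have hannounce : round net (fun v =>
      { s v with
        clock := p * A.phaseLength n r + A.rounds n r
        sub := A.stateAfter net τ (A.rounds n r) v }) = fun v =>
      { s v with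
        clock := p * A.phaseLength n r + A.rounds n r + 1
        inp := { (s v).inp with
          nbrs := {k | ∃ w, net.G.Adj v w ∧ net.ident w = k ∧ lab w = none} }
        sub := A.stateAfter net τ (A.rounds n r) v
        clNbrs := net.clusteredNbrs lab v
        cand := if net.IsCandidate lab v then net.ident v else n ^ a } :=
    step_announce net p _ h.alive (fun _ => rfl) (fun v => by simp only [h.inp]; rfl)
  rw [hannounce]
  rw [step_iterate_flood net p]
  rotate_left
  · exact h.alive
  · exact fun _ => rfl
  · intro v
    simp only [h.inp]
    rfl
  · intro v
    dsimp only
    split_ifs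
    · exact (net.ident_lt v).le
    · exact le_rfl
  · exact le_rfl
  rw [step_notify net p]
  rotate_left
  · exact h.alive
  · exact fun _ => rfl
  have hc : ∀ v, (net.IsCandidate lab v →
      (if net.IsCandidate lab v then net.ident v else n ^ a) = net.ident v) ∧
      (¬ net.IsCandidate lab v →
      (if net.IsCandidate lab v then net.ident v else n ^ a) = n ^ a) :=
    fun v => ⟨fun h => if_pos h, fun h => if_neg h⟩
  refine ⟨fun _ => rfl, h.tape, fun v => ?_, fun v => Iff.rfl, fun v => ?_, fun v => ?_⟩
  · simp only [h.inp]; rfl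
  · simp only [h.tape]
  · have hwin := net.isWinner_iff_flood _ lab hc
    simp only [h.chosen, h.inp]
    congr 1
    ext k
    simp only [Network.newChosen, SpannerState.label]
    refine or_congr Iff.rfl (or_congr ?_ (exists_congr fun w => and_congr_right fun _ =>
      and_congr_right fun _ => ?_))
    · rw [show (fun u => (o u).label) = lab from rfl, hwin v, and_assoc]
      rfl
    · rw [show (fun u => (o u).label) = lab from rfl, hwin w, and_assoc]
      exact and_congr_right fun _ => and_congr_right fun _ => eq_comm

end

end spannerAlg

end CongestAlg

/-! ### CONGEST: restriction to live clusters, and concatenation of the phases -/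

namespace CongestAlg

namespace spannerAlg

variable {A : CongestAlg ClusteringOut} {V : Type} {a n r : ℕ} (net : Network V a n r)

/-- Nodes outside `R` send nothing and keep their states. Hence the remaining ones cannot
distinguish the whole network from the one that `R` induces, and guarantees for the latter apply. -/
theorem round_restrict (R : Set net.Node) (s : V → A.SpannerState n r)
    (hdead : ∀ v, net.cluster v ∉ R → ¬ (s v).alive) :
    (∀ v : {v // net.cluster v ∈ R},
      round net s v.1 = round (net.restrict R) (fun u => s u.1) v) ∧
    ∀ v, net.cluster v ∉ R → round net s v = s v := by
  refine ⟨fun v => ?_, fun v hv => ?_⟩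
  · have : inbox net s v.1 = inbox (net.restrict R) (fun u => s u.1) v := by
      funext k
      refine Option.ext fun m => ?_
      rw [inbox_eq_some, inbox_eq_some]
      constructor
      · rintro ⟨w, hw, hk, hs⟩
        have hl : net.cluster w ∈ R := by
          by_contra hn
          simp [SpannerState.send, hdead w hn] at hs
        exact ⟨⟨w, hl⟩, hw, hk, hs⟩
      · rintro ⟨w, hw, hk, hs⟩
        exact ⟨w.1, hw, hk, hs⟩
    simp only [round, this]
  · simp only [round, SpannerState.recv, hdead v hv, not_false_eq_true, if_true]

theorem round_iterate_restrict (R : Set net.Node) (s : V → A.SpannerState n r)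
    (hdead : ∀ v, net.cluster v ∉ R → ¬ (s v).alive) (t : ℕ) :
    (∀ v : {v // net.cluster v ∈ R}, (round net)^[t] s v.1 =
      (round (net.restrict R))^[t] (fun u => s u.1) v) ∧
    ∀ v, net.cluster v ∉ R → (round net)^[t] s v = s v := by
  induction t with
  | zero => exact ⟨fun _ => rfl, fun _ _ => rfl⟩
  | succ t ih =>
    rw [Function.iterate_succ_apply', Function.iterate_succ_apply']
    obtain ⟨h1, h2⟩ := round_restrict net R ((round net)^[t] s)
      (fun v hv => by rw [ih.2 v hv]; exact hdead v hv)
    refine ⟨fun v => ?_, fun v hv => (h2 v hv).trans (ih.2 v hv)⟩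
    rw [h1 v]
    congr 1
    funext u
    exact ih.1 u

/-- The states at the beginning of phase `p` if the clusters in `R` are live. -/
def IsPhaseStart (p : ℕ) (R : Set net.Node)
    (ω : V → Fin ((Nat.log 2 n + 1) * A.bits n r) → Bool) (Ch : V → Set ℕ)
    (s : V → A.SpannerState n r) : Prop :=
  IsStart (net.restrict R) p (fun v => ω v.1) (fun v => Ch v.1) (fun v => s v.1) ∧
    ∀ v, net.cluster v ∉ R → ¬ (s v).alive ∧ (s v).chosen = Ch v

/-- The outputs of the clustering algorithm on the live clusters. -/
def liveOutput (A : CongestAlg ClusteringOut) (net : Network V a n r) (R : Set net.Node)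
    (τ : V × Fin (A.bits n r) → Bool) (v : {v // net.cluster v ∈ R}) : ClusteringOut :=
  A.output (net.restrict R) (fun v j => τ (v.1, j)) v

/-- The clusters that remain live. -/
def liveNext (A : CongestAlg ClusteringOut) (net : Network V a n r) (R : Set net.Node)
    (τ : V × Fin (A.bits n r) → Bool) : Set net.Node :=
  {x | ∃ h : net.cluster x.1 ∈ R, (liveOutput A net R τ ⟨x.1, h⟩).label = none}

/-- The clustering algorithm succeeds on the live clusters. -/
def Succeeds (A : CongestAlg ClusteringOut) (net : Network V a n r) (D : ℕ) (ξ : ℝ)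
    (R : Set net.Node) (τ : V × Fin (A.bits n r) → Bool) : Prop :=
  ∃ cl T, EncodesClustering (net.restrict R) (liveOutput A net R τ) cl T ∧
    IsWeakClustering (net.restrict R).clusterGraph cl T 3 D ξ

variable {net} {R : Set net.Node} {τ : V × Fin (A.bits n r) → Bool}

theorem liveNext_subset : liveNext A net R τ ⊆ R := by
  rintro x ⟨h, -⟩
  rwa [net.cluster_node x] at h

/-- `liveNext` consults only the root of a cluster. In a run that encodes a clustering, all nodes of
a cluster report the same label, so the set describes every node correctly. -/
theorem mem_liveNext {cl : (net.restrict R).Node → Option ℕ}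
    {T : ℕ → (net.restrict R).clusterGraph.Subgraph}
    (hE : EncodesClustering (net.restrict R) (liveOutput A net R τ) cl T)
    (v : {v // net.cluster v ∈ R}) :
    net.cluster v.1 ∈ liveNext A net R τ ↔ (liveOutput A net R τ v).label = none := by
  have h : net.cluster (net.cluster v.1).1 ∈ R := by rw [net.cluster_node]; exact v.2
  have heq : (liveOutput A net R τ ⟨(net.cluster v.1).1, h⟩).label =
      (liveOutput A net R τ v).label := by
    rw [hE.label, hE.label]
    congr 1
    rw [net.cluster_restrict_eq_iff R]
    exact net.cluster_node _
  constructor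
  · rintro ⟨h', hl⟩
    exact heq.symm.trans hl
  · intro hl
    exact ⟨h, heq.trans hl⟩

/-- The point is `hinput`: the locally updated input is exactly the input in the network restricted
to the clusters that stay live, so the next run is a genuine run there. -/
theorem IsPhaseStart.next {p : ℕ} {ω : V → Fin ((Nat.log 2 n + 1) * A.bits n r) → Bool}
    {Ch : V → Set ℕ} {s : V → A.SpannerState n r} (h : IsPhaseStart net p R ω Ch s)
    (hτ : ∀ v j, τ (v, j) = ω v (blockIndex p j))
    (hlabel : ∀ v : {v // net.cluster v ∈ R},
      net.cluster v.1 ∈ liveNext A net R τ ↔ (liveOutput A net R τ v).label = none) :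
    IsPhaseStart net (p + 1) (liveNext A net R τ) ω
      (fun v => Ch v ∪ {k | ∃ hv : net.cluster v ∈ R,
        k ∈ (net.restrict R).newChosen (liveOutput A net R τ) ⟨v, hv⟩})
      ((round net)^[A.phaseLength n r] s) := by
  obtain ⟨h1, h2⟩ := round_iterate_restrict net R s (fun v hv => (h.2 v hv).1)
    (A.phaseLength n r)
  have hend := isEnd_of_isStart (net.restrict R) p h.1
  have ho : A.output (net.restrict R) (fun v j => ω v.1 (blockIndex p j)) =
      liveOutput A net R τ := by
    funext v
    simp only [liveOutput, hτ]
  rw [ho] at hend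
  have hinput : ∀ v : {v // net.cluster v ∈ liveNext A net R τ},
      (net.restrict (liveNext A net R τ)).input v =
      { (net.restrict R).input ⟨v.1, liveNext_subset v.2⟩ with
        nbrs := {k | ∃ w, (net.restrict R).G.Adj ⟨v.1, liveNext_subset v.2⟩ w ∧
          (net.restrict R).ident w = k ∧ (liveOutput A net R τ w).label = none} } := by
    intro v
    have hcl : ((net.restrict (liveNext A net R τ)).cluster v).1.1 =
        ((net.restrict R).cluster ⟨v.1, liveNext_subset v.2⟩).1.1 :=
      (net.cluster_restrict_val _ v).trans
        (net.cluster_restrict_val R ⟨v.1, liveNext_subset v.2⟩).symm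
    simp only [Network.input, NodeInput.mk.injEq]
    refine ⟨rfl, ?_, rfl, congrArg net.ident hcl⟩
    ext k
    constructor
    · rintro ⟨w, hw, rfl⟩
      exact ⟨⟨w.1, liveNext_subset w.2⟩, hw, rfl, (hlabel ⟨w.1, liveNext_subset w.2⟩).1 w.2⟩
    · rintro ⟨w, hw, rfl, hl⟩
      exact ⟨⟨w.1, (hlabel w).2 hl⟩, hw, rfl⟩
  refine ⟨⟨fun v => ?_, fun v => ?_, fun v => ?_, fun v => ?_, fun v => ?_, fun v => ?_⟩,
    fun v hv => ?_⟩
  · rw [h1 ⟨v.1, liveNext_subset v.2⟩, hend.clock]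
  · rw [h1 ⟨v.1, liveNext_subset v.2⟩, hend.tape]
  · rw [h1 ⟨v.1, liveNext_subset v.2⟩, hend.inp, hinput]
  · rw [h1 ⟨v.1, liveNext_subset v.2⟩, hend.alive]
    exact (hlabel ⟨v.1, liveNext_subset v.2⟩).1 v.2
  · rw [h1 ⟨v.1, liveNext_subset v.2⟩, hend.sub, hend.inp, hinput]
  · rw [h1 ⟨v.1, liveNext_subset v.2⟩, hend.chosen]
    congr 1
    ext k
    exact ⟨fun hk => ⟨liveNext_subset v.2, hk⟩, fun ⟨_, hk⟩ => hk⟩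
  · by_cases hR : net.cluster v ∈ R
    · rw [h1 ⟨v, hR⟩, hend.alive, hend.chosen]
      refine ⟨fun hl => hv ((hlabel ⟨v, hR⟩).2 hl), ?_⟩
      congr 1
      ext k
      exact ⟨fun hk => ⟨hR, hk⟩, fun ⟨_, hk⟩ => hk⟩
    · rw [h2 v hR]
      refine ⟨(h.2 v hR).1, (h.2 v hR).2.trans ?_⟩
      ext k
      exact ⟨Or.inl, fun hk => hk.elim id (fun ⟨h, _⟩ => absurd h hR)⟩

/-- The phase on the restricted cluster graph is transported along `clusterGraphEmbedding`, and its
edges are read off from the local selections. -/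
theorem Succeeds.exists_phase {D : ℕ} {ξ : ℝ} (h : Succeeds A net D ξ R τ) :
    ∃ P : SimpleGraph net.Node, IsPhase net.clusterGraph P R (liveNext A net R τ) D ξ ∧
      ∀ x y, P.Adj x y ↔ x ≠ y ∧ ∃ u v, ∃ hu : net.cluster u ∈ R, net.G.Adj u v ∧
        net.cluster u = x ∧ net.cluster v = y ∧
        net.ident v ∈ (net.restrict R).newChosen (liveOutput A net R τ) ⟨u, hu⟩ := by
  obtain ⟨cl, T, hE, hC⟩ := h
  have := net.finite
  have hspec := fun x y hxy => hE.chosenNode_spec (x := x) (y := y) hxy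
  have hph := hC.isPhase rfl (net.clusterGraphEmbedding R) _ (fun x y h => (hspec x y h).1)
    (fun x y h => (hspec x y h).2.2) (fun x y hadj hx hy => hE.chosenNode_ne_none hadj hx hy)
  have hrange : Set.range (net.clusterGraphEmbedding R) = R := net.range_nodeVal R
  have hnext : net.clusterGraphEmbedding R '' {x | cl x = none} = liveNext A net R τ := by
    ext x
    constructor
    · rintro ⟨y, hy, rfl⟩
      have := (mem_liveNext hE y.1).2 (by
        rw [hE.label, (net.restrict R).cluster_node y]; exact hy)
      rwa [show net.cluster y.1.1 = net.nodeVal R y from net.cluster_node (net.nodeVal R y)] at this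
    · rintro ⟨hx, hl⟩
      refine ⟨(net.restrict R).cluster ⟨x.1, hx⟩, ?_, ?_⟩
      · rw [hE.label] at hl
        exact hl
      · exact (net.nodeVal_cluster R ⟨x.1, hx⟩).trans (net.cluster_node x)
  rw [hrange, hnext] at hph
  refine ⟨_, hph, fun x y => ?_⟩
  rw [SimpleGraph.map_adj]
  constructor
  · rintro ⟨x', y', hadj, rfl, rfl⟩
    obtain ⟨hne, u, v, huv, rfl, rfl, ho⟩ := (hE.attachGraph_adj_iff _ x' y').1 hadj
    exact ⟨fun he => hne (net.nodeVal_injective R he), u.1, v.1, u.2, huv,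
      (net.nodeVal_cluster R u).symm, (net.nodeVal_cluster R v).symm, ho⟩
  · rintro ⟨hne, u, v, hu, huv, rfl, rfl, ho⟩
    -- Only `u` is assumed to lie in a live cluster; the matching selection at the other end shows
    -- that `v` does as well.
    obtain ⟨w, hw, hk, -⟩ := hE.newChosen_symm ho
    obtain rfl : w.1 = v := net.ident_injective hk
    refine ⟨(net.restrict R).cluster ⟨u, hu⟩, (net.restrict R).cluster w, ?_,
      net.nodeVal_cluster R ⟨u, hu⟩, net.nodeVal_cluster R w⟩
    refine (hE.attachGraph_adj_iff _ _ _).2 ⟨fun he => hne ?_, ⟨u, hu⟩, w, hw, rfl, rfl, ho⟩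
    exact (net.cluster_restrict_eq_iff R ⟨u, hu⟩ w).1 he

theorem failureProb_succeeds_le {D : ℕ → ℕ} {ξ δ : ℕ → ℝ} (h : A.FindsClusterings a r D ξ δ)
    (net : Network V a n r) (R : Set net.Node) :
    failureProb (V × Fin (A.bits n r) → Bool) (Succeeds A net (D n) (ξ n) R) ≤ δ n := by
  have := net.finite
  let ι : {v // net.cluster v ∈ R} × Fin (A.bits n r) → V × Fin (A.bits n r) :=
    fun q => (q.1.1, q.2)
  have hι : Function.Injective ι := fun q q' hq =>
    Prod.ext (Subtype.ext (Prod.ext_iff.1 hq).1) (Prod.ext_iff.1 hq).2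
  let e := Equiv.curry {v // net.cluster v ∈ R} (Fin (A.bits n r)) Bool
  let E : A.Tapes {v // net.cluster v ∈ R} n r → Prop := fun ω =>
    ∃ cl T, EncodesClustering (net.restrict R) (A.output (net.restrict R) ω) cl T ∧
      IsWeakClustering (net.restrict R).clusterGraph cl T 3 (D n) (ξ n)
  have h1 : failureProb _ (fun ω => E (e ω)) ≤ δ n :=
    (failureProb_congr_equiv e E).le.trans (h n _ (net.restrict R))
  exact failureProb_comp_le hι (fun ω => E (e ω)) h1

theorem blockIndex_val {L b p : ℕ} (hp : p < L + 1) (j : Fin b) :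
    (blockIndex p j : Fin ((L + 1) * b)).val = p * b + j := by
  refine Nat.mod_eq_of_lt ?_
  have h1 : (p + 1) * b ≤ (L + 1) * b := Nat.mul_le_mul_right b (by omega)
  have h2 := j.2
  rw [add_mul, one_mul] at h1
  omega

theorem card_node_lt (net : Network V a n r) : Nat.card net.Node < 2 ^ (Nat.log 2 n + 1) := by
  have := net.finite
  exact (Nat.card_le_card_of_injective _ Subtype.val_injective).trans_lt
    (net.card_le.trans_lt (Nat.lt_pow_succ_log_self (by norm_num) n))

/-- If all runs of the clustering algorithm succeed, then the output is a spanner. -/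
theorem exists_spanner {D : ℕ} {ξ : ℝ} (hD : 1 ≤ D) (net : Network V a n r)
    (ω : V → Fin ((Nat.log 2 n + 1) * A.bits n r) → Bool) (R : ℕ → Set net.Node)
    (τ : ℕ → V × Fin (A.bits n r) → Bool) (h0 : R 0 = Set.univ)
    (hR : ∀ p, R (p + 1) = liveNext A net (R p) (τ p))
    (hτ : ∀ p v j, τ p (v, j) = ω v (blockIndex p j))
    (hgood : ∀ p < Nat.log 2 n + 1, Succeeds A net D ξ (R p) (τ p)) :
    ∃ H, EncodesSubgraph net ((A.spannerAlg a).output net ω) H ∧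
      IsSpanner net.clusterGraph H (2 * D) ∧
      (H.edgeSet.ncard : ℝ) ≤ 6 * ξ * Nat.card net.Node := by
  have := net.finite
  set Ch : ℕ → V → Set ℕ := fun p v => {k | ∃ q < p, ∃ hv : net.cluster v ∈ R q,
    k ∈ (net.restrict (R q)).newChosen (liveOutput A net (R q) (τ q)) ⟨v, hv⟩} with hCh
  let s : V → A.SpannerState n r := (A.spannerAlg a).stateAfter net ω 0
  have hrun : ∀ p ≤ Nat.log 2 n + 1,
      IsPhaseStart net p (R p) ω (Ch p) ((round net)^[p * A.phaseLength n r] s) := by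
    intro p
    induction p with
    | zero =>
      intro _
      rw [zero_mul]
      refine ⟨⟨fun v => ?_, fun v => rfl, fun v => ?_, fun v => trivial, fun v => ?_, fun v => ?_⟩,
        fun v hv => absurd (by rw [h0]; trivial) hv⟩
      · exact (zero_mul _).symm
      · change net.input v.1 = _
        simp only [Network.input, NodeInput.mk.injEq]
        refine ⟨rfl, ?_, rfl, ?_⟩
        · ext k
          constructor
          · rintro ⟨w, hw, rfl⟩
            exact ⟨⟨w, by rw [h0]; trivial⟩, hw, rfl⟩
          · rintro ⟨w, hw, rfl⟩
            exact ⟨w.1, hw, rfl⟩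
        · exact congrArg net.ident (net.cluster_restrict_val (R 0) v).symm
      · change A.init n r (net.input v.1) _ = _
        congr 1
        simp only [Network.input, NodeInput.mk.injEq]
        refine ⟨rfl, ?_, rfl, ?_⟩
        · ext k
          constructor
          · rintro ⟨w, hw, rfl⟩
            exact ⟨⟨w, by rw [h0]; trivial⟩, hw, rfl⟩
          · rintro ⟨w, hw, rfl⟩
            exact ⟨w.1, hw, rfl⟩
        · exact congrArg net.ident (net.cluster_restrict_val (R 0) v).symm
      · simp only [hCh, Nat.not_lt_zero, false_and, exists_false]
        rfl
    | succ p ih =>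
      intro hp
      -- Success of phase `p` is needed for the states, too: otherwise the nodes of a cluster might
      -- disagree on being live.
      obtain ⟨cl, T, hE, -⟩ := hgood p (by omega)
      have := (ih (by omega)).next (hτ p) (mem_liveNext hE)
      rw [hR p, add_mul, one_mul, add_comm (p * _), Function.iterate_add_apply]
      convert this using 1
      funext v
      ext k
      simp only [hCh, Set.mem_union, Set.mem_ofPred_eq, Nat.lt_succ_iff_lt_or_eq, or_and_right,
        exists_or, exists_eq_left]
  have hout : ∀ v, (A.spannerAlg a).output net ω v = Ch (Nat.log 2 n + 1) v := by
    intro v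
    have h := hrun _ le_rfl
    refine (congrArg (fun f : V → A.SpannerState n r => (f v).chosen)
      (stateAfter_eq_iterate (A.spannerAlg a) net ω _)).trans ?_
    by_cases hv : net.cluster v ∈ R (Nat.log 2 n + 1)
    · exact h.1.chosen ⟨v, hv⟩
    · exact (h.2 v hv).2
  -- After the last phase, a dummy graph makes the family total.
  have hex : ∀ p, ∃ P : SimpleGraph net.Node, p < Nat.log 2 n + 1 →
      IsPhase net.clusterGraph P (R p) (R (p + 1)) D ξ ∧
      ∀ x y, P.Adj x y ↔ x ≠ y ∧ ∃ u v, ∃ hu : net.cluster u ∈ R p, net.G.Adj u v ∧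
        net.cluster u = x ∧ net.cluster v = y ∧
        net.ident v ∈ (net.restrict (R p)).newChosen (liveOutput A net (R p) (τ p)) ⟨u, hu⟩ := by
    intro p
    by_cases hp : p < Nat.log 2 n + 1
    · obtain ⟨P, hP⟩ := (hgood p hp).exists_phase
      rw [← hR p] at hP
      exact ⟨P, fun _ => hP⟩
    · exact ⟨⊥, fun h => absurd h hp⟩
  choose P hP using hex
  let H : SimpleGraph net.Node :=
    { Adj := fun x y => ∃ p < Nat.log 2 n + 1, (P p).Adj x y
      symm := ⟨fun _ _ ⟨p, hp, h⟩ => ⟨p, hp, h.symm⟩⟩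
      loopless := ⟨fun _ ⟨_, _, h⟩ => h.ne rfl⟩ }
  refine ⟨H, ⟨fun v k hk => ?_, fun x y => ?_⟩,
    spanner_of_phases hD (card_node_lt net) R P h0 (fun p hp => (hP p hp).1)
    (fun _ _ => Iff.rfl)⟩
  · rw [hout] at hk
    obtain ⟨q, hq, hv, hk⟩ := hk
    obtain ⟨cl, T, hE, -⟩ := hgood q hq
    obtain ⟨w, hw, hwk, hwv⟩ := hE.newChosen_symm hk
    refine ⟨w.1, hw, hwk, ?_⟩
    rw [hout]
    exact ⟨q, hq, w.2, hwv⟩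
  · constructor
    · rintro ⟨p, hp, h⟩
      obtain ⟨hne, u, v, hu, huv, hux, hvy, hk⟩ := ((hP p hp).2 x y).1 h
      refine ⟨hne, u, v, huv, hux, hvy, ?_⟩
      rw [hout]
      exact ⟨p, hp, hu, hk⟩
    · rintro ⟨hne, u, v, huv, hux, hvy, hk⟩
      rw [hout] at hk
      obtain ⟨p, hp, hu, hk⟩ := hk
      exact ⟨p, hp, ((hP p hp).2 x y).2 ⟨hne, u, v, hu, huv, hux, hvy, hk⟩⟩

end spannerAlg

/-- The adaptive union bound, with the set of live clusters as state. If every phase succeeds, then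
`exists_spanner` applies. -/
theorem spannerAlg_buildsSpanners {A : CongestAlg ClusteringOut} {a r C : ℕ} (hC : 6 ≤ C)
    {D : ℕ → ℕ} {ξ δ : ℕ → ℝ} (hD : ∀ n, 1 ≤ D n) (h : A.FindsClusterings a r D ξ δ) :
    (A.spannerAlg a).BuildsSpanners a r (fun n => C * D n) (fun n => C * ξ n)
      (fun n => (Nat.log 2 n + 1) * δ n) := by
  intro n V net
  have := net.finite
  let ι : ℕ → V × Fin (A.bits n r) → V × Fin ((Nat.log 2 n + 1) * A.bits n r) :=
    fun p q => (q.1, blockIndex p q.2)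
  have key := failureProb_blockRun_le (ι := ι) (L := Nat.log 2 n + 1)
    (fun p hp q q' hq => by
      obtain ⟨h1, h2⟩ := Prod.ext_iff.1 hq
      refine Prod.ext h1 (Fin.ext ?_)
      have h3 := congrArg Fin.val h2
      simp only [ι, spannerAlg.blockIndex_val hp] at h3
      omega)
    (fun p hp q hq y y' heq => by
      have h3 := congrArg Fin.val (Prod.ext_iff.1 heq).2
      simp only [ι, spannerAlg.blockIndex_val hp,
        spannerAlg.blockIndex_val (show q < Nat.log 2 n + 1 by omega)] at h3
      have h4 : (q + 1) * A.bits n r ≤ p * A.bits n r := Nat.mul_le_mul_right _ (by omega)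
      have h5 := y'.2.2
      rw [add_mul, one_mul] at h4
      omega)
    (spannerAlg.liveNext A net) Set.univ _ (spannerAlg.failureProb_succeeds_le h net)
  rw [failureProb_congr_equiv
    (Equiv.curry V (Fin ((Nat.log 2 n + 1) * A.bits n r)) Bool).symm
    (fun ω => ∀ p < Nat.log 2 n + 1, spannerAlg.Succeeds A net (D n) (ξ n)
      (blockRun ι (spannerAlg.liveNext A net) Set.univ ω p) (ω ∘ ι p)) |>.symm] at key
  push_cast at key
  refine (failureProb_mono fun ω hω => ?_).trans key
  obtain ⟨H, hH1, hH2, hH3⟩ := spannerAlg.exists_spanner (A := A) (hD n) net ω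
    (blockRun ι (spannerAlg.liveNext A net) Set.univ _) (fun p => _ ∘ ι p) rfl (fun _ => rfl)
    (fun _ _ _ => rfl) hω
  refine ⟨H, hH1, ⟨hH2.1, fun u v => (hH2.2 u v).trans ?_⟩, hH3.trans ?_⟩
  · have : 2 * D n ≤ C * D n := Nat.mul_le_mul_right _ (by omega)
    gcongr
  -- The sign of `ξ n` is not known. The nonnegative number of edges is at most `6 * ξ n * |V|`, so
  -- this product is nonnegative and `6` may be replaced by `C`.
  · have h0 : (0 : ℝ) ≤ H.edgeSet.ncard := Nat.cast_nonneg _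
    have h1 : (6 : ℝ) ≤ C := by exact_mod_cast hC
    nlinarith

/-- For `n ≥ 2` the left side is at most `2 * log₂ n`, and `2 / log 2 < 3`. -/
theorem natLog_add_one_le {n : ℕ} (hn : 2 ≤ n) : ((Nat.log 2 n + 1 : ℕ) : ℝ) ≤ 3 * Real.log n := by
  have h1 : 1 ≤ Nat.log 2 n := Nat.log_pos (by norm_num) hn
  have h2 : (2 : ℝ) ^ (Nat.log 2 n) ≤ n := by exact_mod_cast Nat.pow_log_le_self 2 (by omega)
  have h3 : (Nat.log 2 n : ℝ) * Real.log 2 ≤ Real.log n := by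
    rw [← Real.log_pow]
    exact Real.log_le_log (by positivity) h2
  have h4 := Real.log_two_gt_d9
  have h5 : (1 : ℝ) ≤ Nat.log 2 n := by exact_mod_cast h1
  push_cast
  nlinarith

/-- A phase takes at most `T + 2 + 2 r ≤ 3 (T + r)` rounds, and there are at most `3 * log n`
phases. -/
theorem spannerAlg_rounds_le (A : CongestAlg ClusteringOut) (a : ℕ) {C n r : ℕ} (hC : 9 ≤ C)
    (hn : 2 ≤ n) {T : ℝ} (hT : 1 ≤ T) (hA : (A.rounds n r : ℝ) ≤ T) :
    ((A.spannerAlg a).rounds n r : ℝ) ≤ C * (Real.log n * (T + r)) := by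
  have h1 := natLog_add_one_le hn
  have h2 : (A.phaseLength n r : ℝ) ≤ 3 * (T + r) := by
    unfold phaseLength
    push_cast
    have : (0 : ℝ) ≤ r := Nat.cast_nonneg r
    linarith
  have h3 : ((A.spannerAlg a).rounds n r : ℝ) =
      ((Nat.log 2 n + 1 : ℕ) : ℝ) * A.phaseLength n r := by
    rw [← Nat.cast_mul]; rfl
  have hlog : 0 ≤ Real.log n := Real.log_nonneg (by exact_mod_cast (by omega : 1 ≤ n))
  have hTr : 0 ≤ T + r := by positivity
  have hCC : (9 : ℝ) ≤ C := by exact_mod_cast hC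
  rw [h3]
  calc ((Nat.log 2 n + 1 : ℕ) : ℝ) * A.phaseLength n r
      ≤ (3 * Real.log n) * (3 * (T + r)) :=
        mul_le_mul h1 h2 (Nat.cast_nonneg _) (by positivity)
    _ = 9 * (Real.log n * (T + r)) := by ring
    _ ≤ C * (Real.log n * (T + r)) := mul_le_mul_of_nonneg_right hCC (by positivity)

theorem spannerAlg_deterministic {A : CongestAlg ClusteringOut} (a : ℕ) (h : A.Deterministic) :
    (A.spannerAlg a).Deterministic := fun n r => by
  change (Nat.log 2 n + 1) * A.bits n r = 0
  rw [h n r, mul_zero]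

end CongestAlg

/-! ### PRAM: running a program repeatedly without clearing the memory

The memory of a program is simulated on top of old contents: the value `v` is stored as `v + base`,
where all old contents are at most `base`, so that truncated subtraction of `base` gives the value
`v` in cells that have been written and `0` in the others. -/

theorem Expr.Fits.eval_lt {B : ℕ} {ω : ℕ → Bool} {M : Mem} {θ : Thread} {e : Expr}
    (h : e.Fits B ω M θ) : e.eval ω M θ < B := by
  cases e with
  | const k => exact h
  | index d => exact h
  | read a e => exact h.2
  | coin e => exact h.2
  | bin o e₁ e₂ => exact h.2.2

theorem Expr.one_le_size (e : Expr) : 1 ≤ e.size := by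
  cases e <;> simp [Expr.size]

/-- All arrays that occur are below this bound. -/
def Expr.arrays : Expr → ℕ
  | const _ => 0
  | index _ => 0
  | read a e => max (a + 1) e.arrays
  | coin e => e.arrays
  | bin _ e₁ e₂ => max e₁.arrays e₂.arrays

def Prog.arrays : Prog → ℕ
  | .skip => 0
  | .write a i e => max (a + 1) (max i.arrays e.arrays)
  | .seq p q => max p.arrays q.arrays
  | .ite e p q => max e.arrays (max p.arrays q.arrays)
  | .loop e p => max e.arrays p.arrays
  | .par e p => max e.arrays p.arrays

/-- The expression with values relative to the base, which is stored in `K[0]`. -/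
def Expr.shift (K : ℕ) : Expr → Expr
  | const k => const k
  | index d => index d
  | read a e => bin .sub (read a (e.shift K)) (read K (const 0))
  | coin e => coin (bin .add (e.shift K) (read K (const 0)))
  | bin o e₁ e₂ => bin o (e₁.shift K) (e₂.shift K)

/-- Stored values are raised by the base, whereas addresses and thread counts keep their true
values. In expressions, the base is also the offset for random bits, so that runs with different
bases can use disjoint blocks. -/
def Prog.shift (K : ℕ) : Prog → Prog
  | .skip => .skip
  | .write a i e => .write a (i.shift K) (.bin .add (e.shift K) (.read K (.const 0)))
  | .seq p q => .seq (p.shift K) (q.shift K)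
  | .ite e p q => .ite (e.shift K) (p.shift K) (q.shift K)
  | .loop e p => .loop (e.shift K) (p.shift K)
  | .par e p => .par (e.shift K) (p.shift K)

theorem Expr.shift_noCoin (K : ℕ) (e : Expr) (h : e.NoCoin) : (e.shift K).NoCoin := by
  induction e with
  | const k => trivial
  | index d => trivial
  | read a e ih => exact ⟨ih h, trivial⟩
  | coin e ih => exact h.elim
  | bin o e₁ e₂ ih₁ ih₂ => exact ⟨ih₁ h.1, ih₂ h.2⟩

theorem Prog.shift_noCoin (K : ℕ) (p : Prog) (h : p.NoCoin) : (p.shift K).NoCoin := by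
  induction p with
  | skip => trivial
  | write a i e => exact ⟨i.shift_noCoin K h.1, e.shift_noCoin K h.2, trivial⟩
  | seq p q ihp ihq => exact ⟨ihp h.1, ihq h.2⟩
  | ite e p q ihp ihq => exact ⟨e.shift_noCoin K h.1, ihp h.2.1, ihq h.2.2⟩
  | loop e p ih => exact ⟨e.shift_noCoin K h.1, ih h.2⟩
  | par e p ih => exact ⟨e.shift_noCoin K h.1, ih h.2⟩

/-- A memory access or a coin toss costs three additional operations. -/
theorem Expr.size_shift_le (K : ℕ) (e : Expr) : (e.shift K).size ≤ 4 * e.size := by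
  induction e with
  | const k => simp [Expr.shift, Expr.size]
  | index d => simp [Expr.shift, Expr.size]
  | read a e ih => simp only [Expr.shift, Expr.size]; omega
  | coin e ih => simp only [Expr.shift, Expr.size]; omega
  | bin o e₁ e₂ ih₁ ih₂ => simp only [Expr.shift, Expr.size]; omega

/-- The memory `M` is represented by `M'` relative to `base`. -/
structure Represents (K base U : ℕ) (M M' : Mem) : Prop where
  base_eq : M' K 0 = base
  sub_eq : ∀ a < K, ∀ x, M' a x - base = M a x
  lt : ∀ a < K, ∀ x, M' a x < base + U

section Shift

variable {K base U B B' : ℕ} {ω ω' : ℕ → Bool} {M M' : Mem}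

theorem Expr.shift_spec (hU : B ≤ U) (hB : base + U ≤ B')
    (hω : ∀ x < B, ω' (base + x) = ω x) (hM : Represents K base U M M') {θ : Thread} {e : Expr}
    (hK : e.arrays ≤ K) (he : e.Fits B ω M θ) :
    (e.shift K).eval ω' M' θ = e.eval ω M θ ∧ (e.shift K).Fits B' ω' M' θ := by
  have hpos : 0 < B := (Nat.zero_le _).trans_lt he.eval_lt
  induction e with
  | const k =>
    refine ⟨rfl, ?_⟩
    change k < B'
    have : k < B := he
    omega
  | index d =>
    refine ⟨rfl, ?_⟩
    have : θ.getD d 0 < B := he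
    change θ.getD d 0 < B'
    omega
  | read a e ih =>
    have ha : a < K := (le_max_left _ _).trans hK
    obtain ⟨h1, h2⟩ := ih ((le_max_right _ _).trans hK) he.1
    have h3 : M' a ((e.shift K).eval ω' M' θ) - base = M a (e.eval ω M θ) := by
      rw [h1]; exact hM.sub_eq a ha _
    have h4 := hM.lt a ha ((e.shift K).eval ω' M' θ)
    have h5 := hM.base_eq
    refine ⟨?_, ⟨h2, ?_⟩, ⟨?_, ?_⟩, ?_⟩
    · change M' a ((e.shift K).eval ω' M' θ) - M' K 0 = M a (e.eval ω M θ)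
      rw [h5, h3]
    · change M' a ((e.shift K).eval ω' M' θ) < B'
      omega
    · change 0 < B'
      omega
    · change M' K 0 < B'
      omega
    · change M' a ((e.shift K).eval ω' M' θ) - M' K 0 < B'
      omega
  | coin e ih =>
    obtain ⟨h1, h2⟩ := ih hK he.1
    have h3 := he.1.eval_lt
    have h5 := hM.base_eq
    have h6 : (Expr.coin e).eval ω M θ < B := he.2
    have h7 : ω' ((e.shift K).eval ω' M' θ + M' K 0) = ω (e.eval ω M θ) := by
      rw [h1, h5, add_comm, hω _ h3]
    have h8 : ((Expr.coin e).shift K).eval ω' M' θ = (Expr.coin e).eval ω M θ := by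
      change (if ω' ((e.shift K).eval ω' M' θ + M' K 0) then 1 else 0) = _
      rw [h7]; rfl
    refine ⟨h8, ⟨h2, ⟨?_, ?_⟩, ?_⟩, ?_⟩
    · change 0 < B'
      omega
    · change M' K 0 < B'
      omega
    · change (e.shift K).eval ω' M' θ + M' K 0 < B'
      omega
    · rw [show (Expr.coin ((e.shift K).bin Op.add (Expr.read K (Expr.const 0)))).eval ω' M' θ =
        (Expr.coin e).eval ω M θ from h8]
      omega
  | bin o e₁ e₂ ih₁ ih₂ =>
    obtain ⟨h1, h2⟩ := ih₁ ((le_max_left _ _).trans hK) he.1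
    obtain ⟨h3, h4⟩ := ih₂ ((le_max_right _ _).trans hK) he.2.1
    have h5 : (Expr.bin o e₁ e₂).eval ω M θ < B := he.2.2
    have h6 : ((Expr.bin o e₁ e₂).shift K).eval ω' M' θ = (Expr.bin o e₁ e₂).eval ω M θ := by
      change o.eval ((e₁.shift K).eval ω' M' θ) ((e₂.shift K).eval ω' M' θ) = _
      rw [h1, h3]; rfl
    refine ⟨h6, h2, h4, ?_⟩
    rw [show (Expr.bin o (e₁.shift K) (e₂.shift K)).eval ω' M' θ =
      (Expr.bin o e₁ e₂).eval ω M θ from h6]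
    omega

/-- All addresses and values are evaluated in the memory before the write, so the representation is
checked thread by thread. The base and the bookkeeping arrays, from `K` on, stay intact. -/
theorem Represents.writeAll (hU : B ≤ U) (hB : base + U ≤ B')
    (hω : ∀ x < B, ω' (base + x) = ω x) (hM : Represents K base U M M') {a : ℕ} {i e : Expr}
    (ha : a < K) (hi : i.arrays ≤ K) (he : e.arrays ≤ K) (S : List Thread)
    (hiS : ∀ θ ∈ S, i.Fits B ω M θ) (heS : ∀ θ ∈ S, e.Fits B ω M θ) :
    Represents K base U (writeAll ω M a i e S)
      (writeAll ω' M' a (i.shift K) (.bin .add (e.shift K) (.read K (.const 0))) S) ∧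
    ∀ b, K ≤ b →
      writeAll ω' M' a (i.shift K) (.bin .add (e.shift K) (.read K (.const 0))) S b = M' b := by
  unfold SpannersViaClusterings.writeAll
  induction S with
  | nil => exact ⟨hM, fun _ _ => rfl⟩
  | cons θ S ih =>
    obtain ⟨h1, h2⟩ := ih (fun θ hθ => hiS θ (List.mem_cons_of_mem _ hθ))
      (fun θ hθ => heS θ (List.mem_cons_of_mem _ hθ))
    have h3 := (Expr.shift_spec hU hB hω hM hi (hiS θ List.mem_cons_self)).1
    have h4 := (Expr.shift_spec hU hB hω hM he (heS θ List.mem_cons_self)).1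
    have h5 := (heS θ List.mem_cons_self).eval_lt
    have h6 : (Expr.bin .add (e.shift K) (.read K (.const 0))).eval ω' M' θ =
        e.eval ω M θ + base := by
      change (e.shift K).eval ω' M' θ + M' K 0 = _
      rw [h4, hM.base_eq]
    simp only [List.foldr_cons]
    rw [h3, h6]
    refine ⟨⟨?_, ?_, ?_⟩, ?_⟩
    · unfold Mem.set
      rw [if_neg (fun h => ha.ne' h.1)]
      exact h1.base_eq
    · intro b hb x
      unfold Mem.set
      split_ifs
      · omega
      · exact h1.sub_eq b hb x
    · intro b hb x
      unfold Mem.set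
      split_ifs
      · omega
      · exact h1.lt b hb x
    · intro b hb
      rw [← h2 b hb]
      funext x
      unfold Mem.set
      rw [if_neg (fun h => by omega)]

theorem selectTrue_shift (hU : B ≤ U) (hB : base + U ≤ B')
    (hω : ∀ x < B, ω' (base + x) = ω x) (hM : Represents K base U M M') {e : Expr}
    (hK : e.arrays ≤ K) {S : List Thread} (he : ∀ θ ∈ S, e.Fits B ω M θ) :
    selectTrue ω' M' (e.shift K) S = selectTrue ω M e S :=
  List.filter_congr fun θ hθ => by rw [(Expr.shift_spec hU hB hω hM hK (he θ hθ)).1]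

theorem selectFalse_shift (hU : B ≤ U) (hB : base + U ≤ B')
    (hω : ∀ x < B, ω' (base + x) = ω x) (hM : Represents K base U M M') {e : Expr}
    (hK : e.arrays ≤ K) {S : List Thread} (he : ∀ θ ∈ S, e.Fits B ω M θ) :
    selectFalse ω' M' (e.shift K) S = selectFalse ω M e S :=
  List.filter_congr fun θ hθ => by rw [(Expr.shift_spec hU hB hω hM hK (he θ hθ)).1]

theorem spawn_shift (hU : B ≤ U) (hB : base + U ≤ B')
    (hω : ∀ x < B, ω' (base + x) = ω x) (hM : Represents K base U M M') {e : Expr}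
    (hK : e.arrays ≤ K) {S : List Thread} (he : ∀ θ ∈ S, e.Fits B ω M θ) :
    spawn ω' M' (e.shift K) S = spawn ω M e S :=
  List.flatMap_congr fun θ hθ => by rw [(Expr.shift_spec hU hB hω hM hK (he θ hθ)).1]

/-- The shifted program does the same as the original one, up to a constant factor. -/
theorem Exec.shift (hU : B ≤ U) (hB : base + U ≤ B')
    (hω : ∀ x < B, ω' (base + x) = ω x) {p : Prog} {S : List Thread} {M₁ : Mem} {d w : ℕ}
    (h : Exec B ω p S M M₁ d w) (hK : p.arrays ≤ K) (hM : Represents K base U M M') :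
    ∃ M₁' d' w', Exec B' ω' (p.shift K) S M' M₁' d' w' ∧ Represents K base U M₁ M₁' ∧
      (∀ b, K ≤ b → M₁' b = M' b) ∧ d' ≤ 7 * d ∧ w' ≤ 7 * w := by
  have hfits : ∀ {M M' : Mem} {e : Expr} {S : List Thread}, Represents K base U M M' →
      e.arrays ≤ K → (∀ θ ∈ S, e.Fits B ω M θ) → ∀ θ ∈ S, (e.shift K).Fits B' ω' M' θ :=
    fun hM hK he θ hθ => (Expr.shift_spec hU hB hω hM hK (he θ hθ)).2
  have hsize : ∀ (S : List Thread) (e : Expr), S.length * (e.shift K).size ≤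
      7 * (S.length * e.size) := fun S e => by
    rw [mul_left_comm]
    exact Nat.mul_le_mul_left _ ((e.size_shift_le K).trans (by omega))
  induction h generalizing M' with
  | skip S M => exact ⟨M', 1, S.length, .skip S M', hM, fun _ _ => rfl, by omega, by omega⟩
  | write a i e S M hi he =>
    have ha : a < K := (le_max_left _ _).trans hK
    have hiK : i.arrays ≤ K := (le_max_left _ _).trans ((le_max_right _ _).trans hK)
    have heK : e.arrays ≤ K := (le_max_right _ _).trans ((le_max_right _ _).trans hK)
    obtain ⟨h1, h2⟩ := hM.writeAll hU hB hω ha hiK heK S hi he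
    refine ⟨_, _, _, .write a _ _ S M' (hfits hM hiK hi) fun θ hθ => ?_, h1, h2, ?_, ?_⟩
    · obtain ⟨h3, h4⟩ := Expr.shift_spec hU hB hω hM heK (he θ hθ)
      have h5 := (he θ hθ).eval_lt
      have h6 := hM.base_eq
      refine ⟨h4, ⟨?_, ?_⟩, ?_⟩
      · change 0 < B'
        omega
      · change M' K 0 < B'
        omega
      · change (e.shift K).eval ω' M' θ + M' K 0 < B'
        omega
    -- The source of the factor `7`: adding the base costs three operations, and `4 |i| + 4 |e| + 3
    -- ≤ 7 (|i| + |e|)`.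
    · have h7 := i.size_shift_le K
      have h8 := e.size_shift_le K
      have h9 := e.one_le_size
      simp only [Expr.size]
      omega
    · rw [mul_left_comm]
      refine Nat.mul_le_mul_left _ ?_
      have h7 := i.size_shift_le K
      have h8 := e.size_shift_le K
      have h9 := e.one_le_size
      simp only [Expr.size]
      omega
  | seq hp hq ihp ihq =>
    obtain ⟨M₁', d₁', w₁', h1, h2, h3, h4, h5⟩ := ihp ((le_max_left _ _).trans hK) hM
    obtain ⟨M₂', d₂', w₂', h6, h7, h8, h9, h10⟩ := ihq ((le_max_right _ _).trans hK) h2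
    exact ⟨M₂', _, _, .seq h1 h6, h7, fun b hb => (h8 b hb).trans (h3 b hb), by omega, by omega⟩
  | @ite e p q S M M₁ M₂ _ _ _ _ he hp hq ihp ihq =>
    have heK : e.arrays ≤ K := (le_max_left _ _).trans hK
    obtain ⟨M₁', d₁', w₁', h1, h2, h3, h4, h5⟩ :=
      ihp ((le_max_left _ _).trans ((le_max_right _ _).trans hK)) hM
    obtain ⟨M₂', d₂', w₂', h6, h7, h8, h9, h10⟩ :=
      ihq ((le_max_right _ _).trans ((le_max_right _ _).trans hK)) h2
    rw [← selectTrue_shift hU hB hω hM heK he] at h1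
    rw [← selectFalse_shift hU hB hω hM heK he] at h6
    have := e.size_shift_le K
    have := hsize S e
    exact ⟨M₂', _, _, .ite (hfits hM heK he) h1 h6, h7, fun b hb => (h8 b hb).trans (h3 b hb),
      by omega, by omega⟩
  | @loopDone e p S M he h =>
    have heK : e.arrays ≤ K := (le_max_left _ _).trans hK
    have := e.size_shift_le K
    refine ⟨M', _, _, .loopDone (hfits hM heK he)
      (by rw [selectTrue_shift hU hB hω hM heK he]; exact h), hM, fun _ _ => rfl, by omega,
      hsize S e⟩
  | @loopStep e p S M M₁ M₂ _ _ _ _ he h hp hq ihp ihq =>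
    have heK : e.arrays ≤ K := (le_max_left _ _).trans hK
    obtain ⟨M₁', d₁', w₁', h1, h2, h3, h4, h5⟩ := ihp ((le_max_right _ _).trans hK) hM
    obtain ⟨M₂', d₂', w₂', h6, h7, h8, h9, h10⟩ := ihq hK h2
    rw [← selectTrue_shift hU hB hω hM heK he] at h1 h6 h
    have := e.size_shift_le K
    have := hsize S e
    exact ⟨M₂', _, _, .loopStep (hfits hM heK he) h h1 h6, h7,
      fun b hb => (h8 b hb).trans (h3 b hb), by omega, by omega⟩
  | @par e p S M M₁ _ _ he hp ihp =>
    have heK : e.arrays ≤ K := (le_max_left _ _).trans hK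
    obtain ⟨M₁', d₁', w₁', h1, h2, h3, h4, h5⟩ := ihp ((le_max_right _ _).trans hK) hM
    rw [← spawn_shift hU hB hω hM heK he] at h1
    have := e.size_shift_le K
    have := hsize S e
    exact ⟨M₁', _, _, .par (hfits hM heK he) h1, h2, h3, by omega, by omega⟩

end Shift

/-! ### PRAM: a program logic for a single thread with parallel assignments -/

/-- Run by a single thread, `p` takes `M` to a memory that satisfies `Q`, with depth at most `d` and
work at most `w`. -/
def Triple (B : ℕ) (ω : ℕ → Bool) (p : Prog) (M : Mem) (d w : ℕ) (Q : Mem → Prop) : Prop :=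
  ∃ M' d' w', Exec B ω p [[]] M M' d' w' ∧ d' ≤ d ∧ w' ≤ w ∧ Q M'

/-- The expression has value `v` in the memory `M`. -/
def Expr.HasValue (B : ℕ) (ω : ℕ → Bool) (M : Mem) (θ : Thread) (e : Expr) (v : ℕ) : Prop :=
  e.Fits B ω M θ ∧ e.eval ω M θ = v

namespace Expr.HasValue

variable {B : ℕ} {ω : ℕ → Bool} {M : Mem} {θ : Thread} {e e₁ e₂ : Expr} {x y v : ℕ}

theorem const (h : v < B) : (Expr.const v).HasValue B ω M θ v := ⟨h, rfl⟩

theorem index {j : ℕ} (h : j < B) : (Expr.index 0).HasValue B ω M [j] j := ⟨h, rfl⟩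

theorem read (a : ℕ) (he : e.HasValue B ω M θ x) (hv : M a x = v) (h : v < B) :
    (Expr.read a e).HasValue B ω M θ v := by
  obtain ⟨h1, rfl⟩ := he
  exact ⟨⟨h1, hv.trans_lt h⟩, hv⟩

theorem bin (o : Op) (h₁ : e₁.HasValue B ω M θ x) (h₂ : e₂.HasValue B ω M θ y)
    (hv : o.eval x y = v) (h : v < B) : (Expr.bin o e₁ e₂).HasValue B ω M θ v := by
  obtain ⟨h1, rfl⟩ := h₁
  obtain ⟨h2, rfl⟩ := h₂
  exact ⟨⟨h1, h2, hv.trans_lt h⟩, hv⟩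

end Expr.HasValue

/-- The winner of a write conflict is left open, since any winner is acceptable in the program
below. -/
theorem writeAll_cell (ω : ℕ → Bool) (M : Mem) (a : ℕ) (i e : Expr)
    (S : List Thread) (x : ℕ) :
    (∃ θ ∈ S, i.eval ω M θ = x ∧ writeAll ω M a i e S a x = e.eval ω M θ) ∨
      ((∀ θ ∈ S, i.eval ω M θ ≠ x) ∧ writeAll ω M a i e S a x = M a x) := by
  unfold writeAll
  induction S with
  | nil => exact Or.inr ⟨by simp, rfl⟩
  | cons θ S ih =>
    by_cases hx : i.eval ω M θ = x
    · refine Or.inl ⟨θ, List.mem_cons_self, hx, ?_⟩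
      simp [Mem.set, hx]
    · have hcell : List.foldr (fun θ M' => Mem.set M' a (i.eval ω M θ) (e.eval ω M θ)) M (θ :: S)
          a x = List.foldr (fun θ M' => Mem.set M' a (i.eval ω M θ) (e.eval ω M θ)) M S a x := by
        simp only [List.foldr_cons]
        rw [Mem.set, if_neg (fun h => hx h.2.symm)]
      rw [hcell]
      rcases ih with ⟨η, hη, h1, h2⟩ | ⟨h1, h2⟩
      · exact Or.inl ⟨η, List.mem_cons_of_mem _ hη, h1, h2⟩
      · refine Or.inr ⟨fun η hη => ?_, h2⟩
        rcases List.mem_cons.1 hη with rfl | hη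
        · exact hx
        · exact h1 η hη

theorem writeAll_other (ω : ℕ → Bool) (M : Mem) {a b : ℕ}
    (i e : Expr) (S : List Thread) (hb : b ≠ a) : writeAll ω M a i e S b = M b := by
  unfold writeAll
  induction S with
  | nil => rfl
  | cons θ S ih =>
    rw [← ih]
    funext x
    simp only [List.foldr_cons]
    rw [Mem.set, if_neg (fun h => hb h.1)]

namespace Triple

variable {B : ℕ} {ω : ℕ → Bool} {M : Mem} {d w d₁ w₁ d₂ w₂ : ℕ} {Q Q' : Mem → Prop}

theorem mono {p : Prog} (h : Triple B ω p M d₁ w₁ Q) (hd : d₁ ≤ d) (hw : w₁ ≤ w)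
    (hQ : ∀ M', Q M' → Q' M') : Triple B ω p M d w Q' := by
  obtain ⟨M', d', w', h1, h2, h3, h4⟩ := h
  exact ⟨M', d', w', h1, h2.trans hd, h3.trans hw, hQ _ h4⟩

theorem seq {p q : Prog} (h : Triple B ω p M d₁ w₁ fun M₁ => Triple B ω q M₁ d₂ w₂ Q) :
    Triple B ω (.seq p q) M (d₁ + d₂) (w₁ + w₂) Q := by
  obtain ⟨M₁, d', w', h1, h2, h3, M₂, d'', w'', h4, h5, h6, h7⟩ := h
  exact ⟨M₂, _, _, .seq h1 h4, by omega, by omega, h7⟩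

/-- The uniform bound `40` per statement spares the bookkeeping of expression sizes. -/
theorem write {a x v : ℕ} {e : Expr} (hx : x < B) (he : e.HasValue B ω M [] v)
    (hd : 1 + e.size ≤ 40)
    (hQ : ∀ M₁ : Mem, (∀ b ≠ a, M₁ b = M b) → M₁ a x = v → (∀ y ≠ x, M₁ a y = M a y) → Q M₁) :
    Triple B ω (.write a (.const x) e) M 40 40 Q := by
  refine ⟨_, _, _, .write a _ _ [[]] M ?_ ?_, hd, ?_, hQ _ ?_ ?_ ?_⟩
  · intro θ _; exact hx
  · intro θ hθ
    rw [List.mem_singleton.1 hθ]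
    exact he.1
  · simpa [Expr.size] using hd
  · intro b hb
    exact writeAll_other ω M _ _ _ hb
  · rcases writeAll_cell ω M a (.const x) e [[]] x with ⟨θ, hθ, -, h⟩ | ⟨h, -⟩
    · rw [h, List.mem_singleton.1 hθ, he.2]
    · exact absurd rfl (h [] (List.mem_singleton.2 rfl))
  · intro y hy
    rcases writeAll_cell ω M a (.const x) e [[]] y with ⟨θ, hθ, h, -⟩ | ⟨-, h⟩
    · exact absurd h.symm hy
    · exact h

theorem par {cnt i e : Expr} {a c : ℕ} {adr v : ℕ → ℕ} (hcnt : cnt.HasValue B ω M [] c)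
    (hi : ∀ j < c, j < B → i.HasValue B ω M [j] (adr j))
    (he : ∀ j < c, j < B → e.HasValue B ω M [j] (v j))
    (hd : cnt.size + (i.size + e.size) ≤ 40)
    (hQ : ∀ M₁ : Mem, (∀ b ≠ a, M₁ b = M b) →
      (∀ x, (∃ j < c, adr j = x ∧ M₁ a x = v j) ∨ ((∀ j < c, adr j ≠ x) ∧ M₁ a x = M a x)) →
      Q M₁) :
    Triple B ω (.par cnt (.write a i e)) M 40 (40 * (c + 1)) Q := by
  have hc : c < B := hcnt.2 ▸ hcnt.1.eval_lt
  have hspawn : spawn ω M cnt [[]] = (List.range c).map fun j => [j] := by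
    simp [spawn, hcnt.2]
  have hmem : ∀ θ ∈ spawn ω M cnt [[]], ∃ j < c, θ = [j] := by
    intro θ hθ
    rw [hspawn] at hθ
    obtain ⟨j, hj, rfl⟩ := List.mem_map.1 hθ
    exact ⟨j, List.mem_range.1 hj, rfl⟩
  refine ⟨_, _, _, .par (S := [[]]) ?_ (.write a i e _ M ?_ ?_), hd, ?_, hQ _ ?_ ?_⟩
  · intro θ hθ
    rw [List.mem_singleton.1 hθ]
    exact hcnt.1
  · intro θ hθ
    obtain ⟨j, hj, rfl⟩ := hmem θ hθ
    exact (hi j hj (hj.trans hc)).1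
  · intro θ hθ
    obtain ⟨j, hj, rfl⟩ := hmem θ hθ
    exact (he j hj (hj.trans hc)).1
  · rw [hspawn]
    simp only [List.length_cons, List.length_nil, List.length_map, List.length_range]
    have : c * (i.size + e.size) ≤ c * 40 := Nat.mul_le_mul_left _ (by omega)
    omega
  · intro b hb
    exact writeAll_other ω M i e _ hb
  · intro x
    rcases writeAll_cell ω M a i e (spawn ω M cnt [[]]) x with ⟨θ, hθ, h1, h2⟩ | ⟨h1, h2⟩
    · obtain ⟨j, hj, rfl⟩ := hmem θ hθ
      exact Or.inl ⟨j, hj, (hi j hj (hj.trans hc)).2.symm.trans h1,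
        h2.trans (he j hj (hj.trans hc)).2⟩
    · refine Or.inr ⟨fun j hj => ?_, h2⟩
      rw [← (hi j hj (hj.trans hc)).2]
      refine h1 _ ?_
      rw [hspawn]
      exact List.mem_map.2 ⟨j, List.mem_range.2 hj, rfl⟩

theorem parIndex {cnt e : Expr} {a c : ℕ} {v : ℕ → ℕ} (hcnt : cnt.HasValue B ω M [] c)
    (he : ∀ j < c, j < B → e.HasValue B ω M [j] (v j))
    (hd : cnt.size + (1 + e.size) ≤ 40)
    (hQ : ∀ M₁ : Mem, (∀ b ≠ a, M₁ b = M b) → (∀ x < c, M₁ a x = v x) →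
      (∀ x, c ≤ x → M₁ a x = M a x) → Q M₁) :
    Triple B ω (.par cnt (.write a (.index 0) e)) M 40 (40 * (c + 1)) Q := by
  refine par (adr := fun j => j) hcnt (fun j _ hj => .index hj) he hd fun M₁ h1 h2 => hQ M₁ h1 ?_ ?_
  · intro x hx
    rcases h2 x with ⟨j, -, rfl, h⟩ | ⟨h, -⟩
    · exact h
    · exact absurd rfl (h x hx)
  · intro x hx
    rcases h2 x with ⟨j, hj, rfl, -⟩ | ⟨-, h⟩
    · omega
    · exact h

theorem loop {e : Expr} {p : Prog} (I : ℕ → Mem → Prop) (L : ℕ)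
    (hstep : ∀ i < L, ∀ M, I i M → (∃ v, e.HasValue B ω M [] v ∧ v ≠ 0) ∧
      Triple B ω p M d w (I (i + 1)))
    (hdone : ∀ M, I L M → e.HasValue B ω M [] 0) (h0 : I 0 M) :
    Triple B ω (.loop e p) M (L * (d + e.size) + e.size) (L * (w + e.size) + e.size) (I L) := by
  -- Induction on the number `t` of iterations that remain.
  have key : ∀ t ≤ L, ∀ M, I (L - t) M → Triple B ω (.loop e p) M (t * (d + e.size) + e.size)
      (t * (w + e.size) + e.size) (I L) := by
    intro t
    induction t with
    | zero =>
      intro _ M hM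
      have hv := hdone M hM
      refine ⟨M, _, _, .loopDone (S := [[]]) ?_ ?_, by omega, ?_, hM⟩
      · intro θ hθ
        rw [List.mem_singleton.1 hθ]
        exact hv.1
      · simp [selectTrue, hv.2]
      · simp
    | succ t ih =>
      intro ht M hM
      obtain ⟨⟨v, hv, hv0⟩, M₁, d', w', h1, h2, h3, h4⟩ := hstep (L - (t + 1)) (by omega) M hM
      rw [show L - (t + 1) + 1 = L - t by omega] at h4
      obtain ⟨M₂, d'', w'', h5, h6, h7, h8⟩ := ih (by omega) M₁ h4
      have hsel : selectTrue ω M e [[]] = [[]] := by simp [selectTrue, hv.2, hv0]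
      rw [← hsel] at h1 h5
      refine ⟨M₂, _, _, .loopStep (S := [[]]) ?_ (by rw [hsel]; simp) h1 h5, ?_, ?_, h8⟩
      · intro θ hθ
        rw [List.mem_singleton.1 hθ]
        exact hv.1
      · rw [add_mul, one_mul]; omega
      · rw [add_mul, one_mul]
        simp only [List.length_cons, List.length_nil]
        omega
  exact key L le_rfl M (by rwa [Nat.sub_self])

end Triple

/-! ### The PRAM program -/

namespace SpannerProg

open SpannersViaClusterings.Expr

/-- Scalar number `x`: the base (0), `n` (1), `m` (2), a power of two (3), the base unit (4). -/
abbrev scal (k x : ℕ) : Expr := read (k + 11) (const x)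

/-- Statements for all vertices, or edge slots. -/
abbrev forVerts (k a : ℕ) (i e : Expr) : Prog := .par (scal k 1) (.write a i e)

abbrev forSlots (k a : ℕ) (i e : Expr) : Prog := .par (scal k 2) (.write a i e)

abbrev mulE (e₁ e₂ : Expr) : Expr := bin .mul e₁ e₂
abbrev addE (e₁ e₂ : Expr) : Expr := bin .add e₁ e₂
abbrev subE (e₁ e₂ : Expr) : Expr := bin .sub e₁ e₂
abbrev idx : Expr := index 0

/-- The condition of the loops: the power of two is at most `n`. -/
abbrev cond (k : ℕ) : Expr := bin .lt (scal k 3) (addE (scal k 1) (const 1))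

/-- Copies of the input: vertices in use (array `k + 12`), slots in use (`k + 13`), ends of the
edges (`k + 14` and `k + 15`). -/
def copyInput (k : ℕ) : Prog :=
  .seq (.write (k + 11) (const 1) (read 0 (const 0))) <|
  .seq (.write (k + 11) (const 2) (read 0 (const 1))) <|
  .seq (forVerts k (k + 12) idx (read 1 idx)) <|
  .seq (forSlots k (k + 13) idx (read 2 idx)) <|
  .seq (forSlots k (k + 14) idx (read 3 idx)) <|
  .seq (forSlots k (k + 15) idx (read 4 idx)) <|
  .seq (.write (k + 11) (const 3) (const 1)) <|
  .write (k + 11) (const 4) (const 1)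

/-- The base unit becomes `c ^ (⌊log₂ n⌋ + 1)`. -/
def computeUnit (k c : ℕ) : Prog :=
  .seq (.loop (cond k) (.seq (.write (k + 11) (const 3) (mulE (scal k 3) (const 2)))
    (.write (k + 11) (const 4) (mulE (scal k 4) (const c))))) <|
  .seq (.write (k + 11) (const 0) (scal k 4)) <|
  .write (k + 11) (const 3) (const 1)

/-- Write the live part of the graph as input of the clustering program. -/
def loadLive (k : ℕ) : Prog :=
  .seq (.write 0 (const 0) (addE (scal k 1) (scal k 0))) <|
  .seq (.write 0 (const 1) (addE (scal k 2) (scal k 0))) <|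
  .seq (forVerts k 1 idx (addE (read (k + 12) idx) (scal k 0))) <|
  .seq (forSlots k 2 idx (addE (read (k + 13) idx) (scal k 0))) <|
  .seq (forSlots k 3 idx (addE (mulE (read (k + 13) idx) (read (k + 14) idx)) (scal k 0))) <|
  forSlots k 4 idx (addE (mulE (read (k + 13) idx) (read (k + 15) idx)) (scal k 0))

abbrev flag (k a : ℕ) : Expr := read (k + 18) (read a idx)

/-- Number of the vertex with number `v` in array `a`, plus one, if the slot is in use, this vertex
is unclustered, and the other one, whose number is in array `b`, is clustered; zero otherwise. -/
abbrev attachAddr (k a b : ℕ) : Expr :=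
  mulE (mulE (read (k + 13) idx) (mulE (flag k a) (subE (const 1) (flag k b))))
    (addE (read a idx) (const 1))

/-- Mark the tree edges; for every vertex, compute whether it is unclustered (array `k + 18`) and
choose an edge to a clustered vertex (array `k + 17`), if it is unclustered and there is one. -/
def chooseEdges (k : ℕ) : Prog :=
  .seq (.par (subE (read 6 (const 1)) (scal k 0)) (.write (k + 16)
    (addE (subE (read 10 idx) (scal k 0)) (const 1)) (const 1))) <|
  .seq (forVerts k (k + 18) idx (bin .eq (subE (read 5 idx) (scal k 0)) (const 0))) <|
  .seq (.par (addE (scal k 1) (const 1)) (.write (k + 17) idx (const 0))) <|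
  -- Cell `0` of the arrays `k + 16` and `k + 17` is a dump for threads that have nothing to record.
  -- Hence vertices and slots are numbered from `1` there.
  .seq (forSlots k (k + 17) (attachAddr k (k + 14) (k + 15)) (addE idx (const 1))) <|
  .seq (forSlots k (k + 17) (attachAddr k (k + 15) (k + 14)) (addE idx (const 1))) <|
  forVerts k (k + 16) (read (k + 17) (addE idx (const 1))) (const 1)

/-- Remove the clustered vertices and their edges. -/
def removeClustered (k : ℕ) : Prog :=
  .seq (forVerts k (k + 12) idx (mulE (read (k + 12) idx) (read (k + 18) idx))) <|
  .seq (forSlots k (k + 13) idx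
    (mulE (read (k + 13) idx) (mulE (flag k (k + 14)) (flag k (k + 15))))) <|
  .seq (.write (k + 11) (const 0) (addE (scal k 0) (scal k 4))) <|
  .write (k + 11) (const 3) (mulE (scal k 3) (const 2))

/-- The marks are the output. -/
def copyOutput (k : ℕ) : Prog :=
  forSlots k 5 idx (read (k + 16) (addE idx (const 1)))

/-- With `k` the bound on the arrays of `p`, these arrays and the eleven arrays of the input and
output formats lie below `k + 11`, where the bookkeeping starts. Doubling a number up to `n` makes
both loops run exactly `⌊log₂ n⌋ + 1` times. -/
def main (k c : ℕ) (p : Prog) : Prog :=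
  .seq (copyInput k) <| .seq (computeUnit k c) <|
  .seq (.loop (cond k) (.seq (loadLive k) <| .seq (p.shift (k + 11)) <|
    .seq (chooseEdges k) (removeClustered k))) <|
  copyOutput k

theorem main_noCoin (k c : ℕ) {p : Prog} (h : p.NoCoin) : (main k c p).NoCoin := by
  have := p.shift_noCoin (k + 11) h
  simp [main, copyInput, computeUnit, loadLive, chooseEdges, removeClustered, copyOutput,
    Prog.NoCoin, Expr.NoCoin, this]

end SpannerProg

/-! ### PRAM: correctness and cost of the parts of the program -/

namespace SpannerProg

open SpannersViaClusterings.Expr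

variable {B : ℕ} {ω : ℕ → Bool} {k n m : ℕ} {M : Mem}

theorem scal_hasValue {x v : ℕ} {θ : Thread} (h : M (k + 11) x = v) (hx : x < B) (hv : v < B) :
    (scal k x).HasValue B ω M θ v := (HasValue.const hx).read _ h hv

theorem copyInput_triple (hn : M 0 0 = n) (hm : M 0 1 = m) (hB : ∀ a x, M a x < B)
    (hB4 : 4 < B) :
    Triple B ω (copyInput k) M 320 (160 * (n + m + 2)) fun M' =>
      (∀ a < k + 11, M' a = M a) ∧ M' (k + 16) = M (k + 16) ∧
      M' (k + 11) 1 = n ∧ M' (k + 11) 2 = m ∧ M' (k + 11) 3 = 1 ∧ M' (k + 11) 4 = 1 ∧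
      (∀ x < n, M' (k + 12) x = M 1 x) ∧ (∀ x < m, M' (k + 13) x = M 2 x) ∧
      (∀ x < m, M' (k + 14) x = M 3 x) ∧ (∀ x < m, M' (k + 15) x = M 4 x) := by
  have hnB : n < B := hn ▸ hB 0 0
  have hmB : m < B := hm ▸ hB 0 1
  refine Triple.mono (d₁ := 40 + (40 + (40 + (40 + (40 + (40 + (40 + 40)))))))
    (w₁ := 40 + (40 + (40 * (n + 1) + (40 * (m + 1) + (40 * (m + 1) + (40 * (m + 1) +
      (40 + 40))))))) ?_ (by omega) (by omega) (fun _ h => h)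
  -- For the memory after each statement, `o` describes the other arrays, `v` the new values and `r`
  -- the remaining cells of the array.
  refine Triple.seq (Triple.write (v := n) (by omega) ((HasValue.const (by omega)).read _ hn hnB)
    (by simp [Expr.size]) fun M₁ o₁ v₁ r₁ => ?_)
  refine Triple.seq (Triple.write (v := m) (by omega) ((HasValue.const (by omega)).read _
    (by simp [o₁, hm]) hmB) (by simp [Expr.size]) fun M₂ o₂ v₂ r₂ => ?_)
  have n₂ : M₂ (k + 11) 1 = n := by rw [r₂ 1 (by omega), v₁]
  refine Triple.seq (Triple.parIndex (c := n) (v := M 1) (scal_hasValue n₂ (by omega) hnB)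
    (fun j _ hj => (HasValue.index hj).read _ (by simp [o₁, o₂]) (hB _ _))
    (by simp [Expr.size]) fun M₃ o₃ v₃ r₃ => ?_)
  have n₃ : M₃ (k + 11) 2 = m := by simp [o₃, v₂]
  refine Triple.seq (Triple.parIndex (c := m) (v := M 2) (scal_hasValue n₃ (by omega) hmB)
    (fun j _ hj => (HasValue.index hj).read _ (by simp [o₁, o₂, o₃]) (hB _ _))
    (by simp [Expr.size]) fun M₄ o₄ v₄ r₄ => ?_)
  have n₄ : M₄ (k + 11) 2 = m := by simp [o₄, n₃]
  refine Triple.seq (Triple.parIndex (c := m) (v := M 3) (scal_hasValue n₄ (by omega) hmB)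
    (fun j _ hj => (HasValue.index hj).read _ (by simp [o₁, o₂, o₃, o₄]) (hB _ _))
    (by simp [Expr.size]) fun M₅ o₅ v₅ r₅ => ?_)
  have n₅ : M₅ (k + 11) 2 = m := by simp [o₅, n₄]
  refine Triple.seq (Triple.parIndex (c := m) (v := M 4) (scal_hasValue n₅ (by omega) hmB)
    (fun j _ hj => (HasValue.index hj).read _ (by simp [o₁, o₂, o₃, o₄, o₅]) (hB _ _))
    (by simp [Expr.size]) fun M₆ o₆ v₆ r₆ => ?_)
  refine Triple.seq (Triple.write (v := 1) (by omega) (HasValue.const (by omega))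
    (by simp [Expr.size]) fun M₇ o₇ v₇ r₇ => ?_)
  refine Triple.write (v := 1) (by omega) (HasValue.const (by omega))
    (by simp [Expr.size]) fun M₈ o₈ v₈ r₈ => ?_
  refine ⟨fun a ha => ?_, ?_, ?_, ?_, ?_, v₈, fun x hx => ?_, fun x hx => ?_, fun x hx => ?_,
    fun x hx => ?_⟩
  · rw [o₈ a (by omega), o₇ a (by omega), o₆ a (by omega), o₅ a (by omega), o₄ a (by omega),
      o₃ a (by omega), o₂ a (by omega), o₁ a (by omega)]
  · simp [o₁, o₂, o₃, o₄, o₅, o₆, o₇, o₈]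
  · simp [r₈, r₇, o₆, o₅, o₄, o₃, n₂]
  · simp [r₈, r₇, o₆, n₅]
  · simp [r₈, v₇]
  · simp [o₈, o₇, o₆, o₅, o₄, v₃ x hx]
  · simp [o₈, o₇, o₆, o₅, v₄ x hx]
  · simp [o₈, o₇, o₆, v₅ x hx]
  · simp [o₈, o₇, v₆ x hx]

theorem cond_hasValue {x : ℕ} (hn : M (k + 11) 1 = n) (hx : M (k + 11) 3 = x) (hnB : n + 1 < B)
    (hxB : x < B) (hB : 3 < B) :
    (cond k).HasValue B ω M [] (if x < n + 1 then 1 else 0) :=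
  (scal_hasValue hx hB hxB).bin .lt
    ((scal_hasValue hn (by omega) (by omega)).bin .add (HasValue.const (by omega)) rfl hnB) rfl
    (by split_ifs <;> omega)

theorem pow_lt_succ_iff {n i : ℕ} (hn : n ≠ 0) : 2 ^ i < n + 1 ↔ i < Nat.log 2 n + 1 := by
  rw [Nat.lt_succ_iff, Nat.lt_succ_iff]
  exact (Nat.le_log_iff_pow_le (by norm_num) hn).symm

/-- Multiplying by `c` whenever the power of two doubles yields an offset that is polynomial in `n`,
with as many multiplications as there are phases. -/
theorem computeUnit_triple {c : ℕ} (hn0 : n ≠ 0) (hn : M (k + 11) 1 = n) (h3 : M (k + 11) 3 = 1)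
    (h4 : M (k + 11) 4 = 1) (hc : 2 ≤ c) (hU : c ^ (Nat.log 2 n + 1) < B) (hnB : n + 1 < B)
    (hB : 4 < B) :
    Triple B ω (computeUnit k c) M (200 * (Nat.log 2 n + 1)) (200 * (Nat.log 2 n + 1)) fun M' =>
      (∀ a ≠ k + 11, M' a = M a) ∧ M' (k + 11) 0 = c ^ (Nat.log 2 n + 1) ∧
      M' (k + 11) 1 = n ∧ M' (k + 11) 2 = M (k + 11) 2 ∧ M' (k + 11) 3 = 1 ∧
      M' (k + 11) 4 = c ^ (Nat.log 2 n + 1) := by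
  set L := Nat.log 2 n + 1 with hL
  have hcpow : ∀ i ≤ L, c ^ i < B := fun i hi =>
    (Nat.pow_le_pow_right (by omega) hi).trans_lt hU
  have h2pow : ∀ i ≤ L, 2 ^ i < B := fun i hi =>
    (Nat.pow_le_pow_left hc i).trans_lt (hcpow i hi)
  have hcB : c < B := by
    have := hcpow 1 (by omega)
    rwa [pow_one] at this
  refine Triple.mono (d₁ := (L * (40 + 40 + (cond k).size) + (cond k).size) + (40 + 40))
    (w₁ := (L * (40 + 40 + (cond k).size) + (cond k).size) + (40 + 40)) ?_
    (by simp only [Expr.size]; omega) (by simp only [Expr.size]; omega) (fun _ h => h)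
  refine Triple.seq (Triple.mono (Triple.loop (fun i M' => (∀ a ≠ k + 11, M' a = M a) ∧
    M' (k + 11) 1 = n ∧ M' (k + 11) 2 = M (k + 11) 2 ∧ M' (k + 11) 3 = 2 ^ i ∧
    M' (k + 11) 4 = c ^ i) L (d := 40 + 40) (w := 40 + 40) ?_ ?_ ?_) le_rfl le_rfl ?_)
  · rintro i hi M₀ ⟨o₀, n₀, m₀, p₀, u₀⟩
    refine ⟨⟨_, cond_hasValue n₀ p₀ hnB (h2pow i hi.le) (by omega), ?_⟩, ?_⟩
    · rw [if_pos ((pow_lt_succ_iff hn0).2 hi)]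
      exact one_ne_zero
    · refine Triple.seq (Triple.write (v := 2 ^ (i + 1)) (by omega)
        ((scal_hasValue p₀ (by omega) (h2pow i hi.le)).bin .mul (HasValue.const (by omega))
          (pow_succ 2 i).symm (h2pow _ hi)) (by simp [Expr.size]) fun M₁ o₁ v₁ r₁ => ?_)
      have u₁ : M₁ (k + 11) 4 = c ^ i := by rw [r₁ 4 (by omega), u₀]
      refine Triple.write (v := c ^ (i + 1)) (by omega)
        ((scal_hasValue u₁ (by omega) (hcpow i hi.le)).bin .mul (HasValue.const hcB)
          (pow_succ c i).symm (hcpow _ hi)) (by simp [Expr.size]) fun M₂ o₂ v₂ r₂ => ?_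
      refine ⟨fun a ha => by rw [o₂ a ha, o₁ a ha, o₀ a ha], ?_, ?_, ?_, v₂⟩
      · simp [r₂, r₁, n₀]
      · simp [r₂, r₁, m₀]
      · simp [r₂, v₁]
  · rintro M₀ ⟨o₀, n₀, m₀, p₀, u₀⟩
    have := cond_hasValue (ω := ω) n₀ p₀ hnB (h2pow L le_rfl) (by omega)
    rwa [if_neg (fun h => lt_irrefl _ ((pow_lt_succ_iff hn0).1 h))] at this
  · exact ⟨fun _ _ => rfl, hn, rfl, h3, h4⟩
  · rintro M₀ ⟨o₀, n₀, m₀, p₀, u₀⟩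
    refine Triple.seq (Triple.write (v := c ^ L) (by omega) (scal_hasValue u₀ (by omega) hU)
      (by simp [Expr.size]) fun M₁ o₁ v₁ r₁ => ?_)
    refine Triple.write (v := 1) (by omega) (HasValue.const (by omega))
      (by simp [Expr.size]) fun M₂ o₂ v₂ r₂ => ?_
    refine ⟨fun a ha => by rw [o₂ a ha, o₁ a ha, o₀ a ha], ?_, ?_, ?_, v₂, ?_⟩
    · simp [r₂, v₁]
    · simp [r₂, r₁, n₀]
    · simp [r₂, r₁, m₀]
    · simp [r₂, r₁, u₀]

/-- `N` is the memory to be simulated. It is enough to write the cells for the `n` vertices and `m`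
slots: all other cells hold values below `base`, which represent zero. -/
theorem loadLive_triple {base U : ℕ} {N : Mem} (hbase : M (k + 11) 0 = base)
    (hn : M (k + 11) 1 = n) (hm : M (k + 11) 2 = m)
    (hlow : ∀ a < k + 11, ∀ x, M a x < base) (hN : ∀ a x, N a x < U) (hB : base + U ≤ B)
    (hU : 4 < U) (h00 : N 0 0 = n) (h01 : N 0 1 = m) (h0 : ∀ x, 2 ≤ x → N 0 x = 0)
    (h1 : ∀ x < n, M (k + 12) x = N 1 x) (h1' : ∀ x, n ≤ x → N 1 x = 0)
    (h2 : ∀ x < m, M (k + 13) x = N 2 x) (h2' : ∀ x, m ≤ x → N 2 x = 0)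
    (h3 : ∀ x < m, M (k + 13) x * M (k + 14) x = N 3 x) (h3' : ∀ x, m ≤ x → N 3 x = 0)
    (h4 : ∀ x < m, M (k + 13) x * M (k + 15) x = N 4 x) (h4' : ∀ x, m ≤ x → N 4 x = 0)
    (h5 : ∀ a, 5 ≤ a → ∀ x, N a x = 0) (hsrc : ∀ x < m, M (k + 14) x < B)
    (hdst : ∀ x < m, M (k + 15) x < B) :
    Triple B ω (loadLive k) M 240 (160 * (n + m + 2)) fun M' =>
      Represents (k + 11) base U N M' ∧ ∀ b, k + 11 ≤ b → M' b = M b := by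
  have hnU : n < U := h00 ▸ hN 0 0
  have hmU : m < U := h01 ▸ hN 0 1
  refine Triple.mono (d₁ := 40 + (40 + (40 + (40 + (40 + 40)))))
    (w₁ := 40 + (40 + (40 * (n + 1) + (40 * (m + 1) + (40 * (m + 1) + 40 * (m + 1))))))
    ?_ (by omega) (by omega) (fun _ h => h)
  have sc : ∀ {M' : Mem} {θ : Thread}, M' (k + 11) = M (k + 11) →
      (scal k 0).HasValue B ω M' θ base ∧ (scal k 1).HasValue B ω M' θ n ∧
      (scal k 2).HasValue B ω M' θ m := fun h =>
    ⟨scal_hasValue (by rw [h, hbase]) (by omega) (by omega),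
      scal_hasValue (by rw [h, hn]) (by omega) (by omega),
      scal_hasValue (by rw [h, hm]) (by omega) (by omega)⟩
  have bd : ∀ a x, N a x + base < B := fun a x => by have := hN a x; omega
  refine Triple.seq (Triple.write (v := n + base) (by omega)
    ((sc rfl).2.1.bin .add (sc rfl).1 rfl (by omega)) (by simp [Expr.size])
    fun M₁ o₁ v₁ r₁ => ?_)
  have s₁ : M₁ (k + 11) = M (k + 11) := by simp [o₁]
  refine Triple.seq (Triple.write (v := m + base) (by omega)
    ((sc s₁).2.2.bin .add (sc s₁).1 rfl (by omega)) (by simp [Expr.size])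
    fun M₂ o₂ v₂ r₂ => ?_)
  have s₂ : M₂ (k + 11) = M (k + 11) := by simp [o₂, s₁]
  refine Triple.seq (Triple.parIndex (c := n) (v := fun x => N 1 x + base) (sc s₂).2.1
    (fun j hj hjB => ((HasValue.index hjB).read _ (v := N 1 j) (by simp [o₁, o₂, h1 j hj])
      (by have := bd 1 j; omega)).bin .add (sc s₂).1 rfl (bd 1 j)) (by simp [Expr.size])
    fun M₃ o₃ v₃ r₃ => ?_)
  have s₃ : M₃ (k + 11) = M (k + 11) := by simp [o₃, s₂]
  refine Triple.seq (Triple.parIndex (c := m) (v := fun x => N 2 x + base) (sc s₃).2.2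
    (fun j hj hjB => ((HasValue.index hjB).read _ (v := N 2 j) (by simp [o₁, o₂, o₃, h2 j hj])
      (by have := bd 2 j; omega)).bin .add (sc s₃).1 rfl (bd 2 j)) (by simp [Expr.size])
    fun M₄ o₄ v₄ r₄ => ?_)
  have s₄ : M₄ (k + 11) = M (k + 11) := by simp [o₄, s₃]
  refine Triple.seq (Triple.parIndex (c := m) (v := fun x => N 3 x + base) (sc s₄).2.2
    (fun j hj hjB => (((HasValue.index hjB).read _ (v := N 2 j)
      (by simp [o₁, o₂, o₃, o₄, h2 j hj]) (by have := bd 2 j; omega)).bin .mul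
      ((HasValue.index hjB).read _ (v := M (k + 14) j) (by simp [o₁, o₂, o₃, o₄]) (hsrc j hj))
      (by rw [← h2 j hj]; exact h3 j hj) (by have := bd 3 j; omega)).bin .add (sc s₄).1 rfl
      (bd 3 j)) (by simp [Expr.size]) fun M₅ o₅ v₅ r₅ => ?_)
  have s₅ : M₅ (k + 11) = M (k + 11) := by simp [o₅, s₄]
  refine Triple.parIndex (c := m) (v := fun x => N 4 x + base) (sc s₅).2.2
    (fun j hj hjB => (((HasValue.index hjB).read _ (v := N 2 j)
      (by simp [o₁, o₂, o₃, o₄, o₅, h2 j hj]) (by have := bd 2 j; omega)).bin .mul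
      ((HasValue.index hjB).read _ (v := M (k + 15) j) (by simp [o₁, o₂, o₃, o₄, o₅]) (hdst j hj))
      (by rw [← h2 j hj]; exact h4 j hj) (by have := bd 4 j; omega)).bin .add (sc s₅).1 rfl
      (bd 4 j)) (by simp [Expr.size]) fun M₆ o₆ v₆ r₆ => ?_
  -- Each cell holds the shifted value, or an old content at a place where `N` is zero.
  have hcell : ∀ a < k + 11, ∀ x, M₆ a x = N a x + base ∨ (M₆ a x = M a x ∧ N a x = 0) := by
    intro a ha x
    by_cases a0 : a = 0
    · subst a0
      have e : M₆ 0 = M₂ 0 := by simp [o₆, o₅, o₄, o₃]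
      rw [e]
      by_cases x0 : x = 0
      · subst x0
        exact Or.inl (by rw [r₂ 0 (by omega), v₁, h00])
      by_cases x1 : x = 1
      · subst x1
        exact Or.inl (by rw [v₂, h01])
      exact Or.inr ⟨by rw [r₂ x x1, r₁ x x0], h0 x (by omega)⟩
    by_cases a1 : a = 1
    · subst a1
      have e : M₆ 1 = M₃ 1 := by simp [o₆, o₅, o₄]
      rw [e]
      by_cases hx : x < n
      · exact Or.inl (v₃ x hx)
      · exact Or.inr ⟨by rw [r₃ x (by omega)]; simp [o₁, o₂], h1' x (by omega)⟩
    by_cases a2 : a = 2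
    · subst a2
      have e : M₆ 2 = M₄ 2 := by simp [o₆, o₅]
      rw [e]
      by_cases hx : x < m
      · exact Or.inl (v₄ x hx)
      · exact Or.inr ⟨by rw [r₄ x (by omega)]; simp [o₁, o₂, o₃], h2' x (by omega)⟩
    by_cases a3 : a = 3
    · subst a3
      have e : M₆ 3 = M₅ 3 := by simp [o₆]
      rw [e]
      by_cases hx : x < m
      · exact Or.inl (v₅ x hx)
      · exact Or.inr ⟨by rw [r₅ x (by omega)]; simp [o₁, o₂, o₃, o₄], h3' x (by omega)⟩
    by_cases a4 : a = 4
    · subst a4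
      by_cases hx : x < m
      · exact Or.inl (v₆ x hx)
      · exact Or.inr ⟨by rw [r₆ x (by omega)]; simp [o₁, o₂, o₃, o₄, o₅], h4' x (by omega)⟩
    refine Or.inr ⟨?_, h5 a (by omega) x⟩
    rw [o₆ a a4, o₅ a a3, o₄ a a2, o₃ a a1, o₂ a a0, o₁ a a0]
  refine ⟨⟨?_, fun a ha x => ?_, fun a ha x => ?_⟩, fun b hb => ?_⟩
  · rw [o₆ _ (by omega), s₅, hbase]
  · have := hlow a ha x
    rcases hcell a ha x with h | ⟨h, h'⟩ <;> omega
  · have := hlow a ha x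
    have := hN a x
    rcases hcell a ha x with h | ⟨h, h'⟩ <;> omega
  · rw [o₆ b (by omega), o₅ b (by omega), o₄ b (by omega), o₃ b (by omega), o₂ b (by omega),
      o₁ b (by omega)]

end SpannerProg

namespace SpannerProg

open SpannersViaClusterings.Expr

variable {B : ℕ} {ω : ℕ → Bool} {k n m : ℕ} {M : Mem}

/-- Slot `j` in use joins the unclustered vertex `u` to a clustered vertex; `us`, `sr`, `ds` tell
the slots in use and the ends of the edges, `F` tells the unclustered vertices. -/
def Attaches (us sr ds F : ℕ → ℕ) (j u : ℕ) : Prop :=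
  us j = 1 ∧ ((sr j = u ∧ F (sr j) = 1 ∧ F (ds j) = 0) ∨ (ds j = u ∧ F (ds j) = 1 ∧ F (sr j) = 0))

theorem attachAddr_hasValue {a b j u s d x y : ℕ} (hj : j < B) (hu : M (k + 13) j = u)
    (hs : M a j = s) (hd : M b j = d) (hx : M (k + 18) s = x) (hy : M (k + 18) d = y)
    (hu1 : u ≤ 1) (hx1 : x ≤ 1) (hy1 : y ≤ 1) (hsB : s + 1 < B) (hdB : d < B) :
    (attachAddr k a b).HasValue B ω M [j] (u * (x * (1 - y)) * (s + 1)) := by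
  have h1 : x * (1 - y) ≤ 1 := Nat.mul_le_mul hx1 (Nat.sub_le 1 y)
  have h2 : u * (x * (1 - y)) ≤ 1 := Nat.mul_le_mul hu1 h1
  have h3 : u * (x * (1 - y)) * (s + 1) ≤ 1 * (s + 1) := Nat.mul_le_mul_right _ h2
  have hi : idx.HasValue B ω M [j] j := HasValue.index hj
  exact (((hi.read _ hu (by omega)).bin .mul
    (((hi.read _ hs (by omega)).read _ hx (by omega)).bin .mul
      ((HasValue.const (by omega)).bin .sub ((hi.read _ hd (by omega)).read _ hy (by omega)) rfl
        (by change 1 - y < B; omega)) rfl (by change x * (1 - y) < B; omega)) rfl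
    (by change u * (x * (1 - y)) < B; omega)).bin .mul
    ((hi.read _ hs (by omega)).bin .add (HasValue.const (by omega)) rfl hsB) rfl
    (by omega))

/-- The three flags are `0` or `1`, so the address differs from the dump `0` only if all conditions
hold. -/
theorem attachAddr_eq_iff {u s x y t : ℕ} (hu1 : u ≤ 1) (hx1 : x ≤ 1) (hy1 : y ≤ 1) :
    u * (x * (1 - y)) * (s + 1) = t + 1 ↔ u = 1 ∧ s = t ∧ x = 1 ∧ y = 0 := by
  interval_cases u <;> interval_cases x <;> interval_cases y <;> simp

/-- The function `ch` is existential because the winner among the slots that attach a vertex is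
irrelevant. Two passes treat the two orientations of a slot. -/
theorem chooseEdges_triple {base U E : ℕ} {lab te F : ℕ → ℕ} (hbase : M (k + 11) 0 = base)
    (hn : M (k + 11) 1 = n) (hm : M (k + 11) 2 = m) (hB : base + U ≤ B) (hU : 4 < U)
    (hnU : n + 1 < U) (hmU : m + 1 < U) (hlt : ∀ a < k + 11, ∀ x, M a x < base + U)
    (hE : M 6 1 - base = E) (hlab : ∀ x, M 5 x - base = lab x)
    (hte : ∀ x, M 10 x - base = te x) (htem : ∀ i < E, te i < m)
    (hF : ∀ x, F x = if lab x = 0 then 1 else 0)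
    (hus : ∀ j < m, M (k + 13) j ≤ 1) (hsr : ∀ j < m, M (k + 14) j < n)
    (hds : ∀ j < m, M (k + 15) j < n) :
    Triple B ω (chooseEdges k) M 240 (160 * (n + m + E + 2)) fun M' =>
      (∀ b, b ≠ k + 16 → b ≠ k + 17 → b ≠ k + 18 → M' b = M b) ∧
      (∀ x < n, M' (k + 18) x = F x) ∧
      ((∀ x, M (k + 16) x ≤ 1) → ∀ x, M' (k + 16) x ≤ 1) ∧
      ∃ ch : ℕ → ℕ,
        (∀ u < n, (ch u = 0 ∧ ∀ j < m, ¬ Attaches (M (k + 13)) (M (k + 14)) (M (k + 15)) F j u) ∨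
          ∃ j < m, ch u = j + 1 ∧ Attaches (M (k + 13)) (M (k + 14)) (M (k + 15)) F j u) ∧
        ∀ j, M' (k + 16) (j + 1) ≠ 0 ↔
          M (k + 16) (j + 1) ≠ 0 ∨ (∃ i < E, te i = j) ∨ ∃ u < n, ch u = j + 1 := by
  have sc : ∀ {M' : Mem} {θ : Thread}, M' (k + 11) = M (k + 11) →
      (scal k 0).HasValue B ω M' θ base ∧ (scal k 1).HasValue B ω M' θ n ∧
      (scal k 2).HasValue B ω M' θ m := fun h =>
    ⟨scal_hasValue (by rw [h, hbase]) (by omega) (by omega),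
      scal_hasValue (by rw [h, hn]) (by omega) (by omega),
      scal_hasValue (by rw [h, hm]) (by omega) (by omega)⟩
  have hF1 : ∀ x, F x ≤ 1 := fun x => by rw [hF]; split_ifs <;> omega
  refine Triple.mono (d₁ := 40 + (40 + (40 + (40 + (40 + 40)))))
    (w₁ := 40 * (E + 1) + (40 * (n + 1) + (40 * (n + 1 + 1) + (40 * (m + 1) + (40 * (m + 1) +
      40 * (n + 1)))))) ?_ (by omega) (by omega) (fun _ h => h)
  have hEB : E < B := by have := hlt 6 (by omega) 1; omega
  refine Triple.seq (Triple.par (c := E) (adr := fun i => te i + 1) (v := fun _ => 1)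
    (((HasValue.const (by omega)).read _ rfl ((hlt 6 (by omega) 1).trans_le hB)).bin .sub
      (sc rfl).1 hE hEB)
    (fun i hi hiB => (((HasValue.index hiB).read _ rfl ((hlt 10 (by omega) i).trans_le hB)).bin
      .sub (sc rfl).1 (hte i) (by have := htem i hi; omega)).bin .add (HasValue.const (by omega))
      rfl (by have := htem i hi; change te i + 1 < B; omega))
    (fun i hi hiB => HasValue.const (by omega)) (by simp [Expr.size]) fun M₁ o₁ c₁ => ?_)
  have s₁ : M₁ (k + 11) = M (k + 11) := by simp [o₁]
  refine Triple.seq (Triple.parIndex (c := n) (v := F) (sc s₁).2.1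
    (fun x hx hxB => (((HasValue.index hxB).read _ (v := M 5 x) (by simp [o₁])
      ((hlt 5 (by omega) x).trans_le hB)).bin .sub (sc s₁).1 (hlab x)
      (by have := hlt 5 (by omega) x; have := hlab x; omega)).bin .eq (HasValue.const (by omega))
      (hF x).symm (by have := hF1 x; omega)) (by simp [Expr.size]) fun M₂ o₂ v₂ _ => ?_)
  have s₂ : M₂ (k + 11) = M (k + 11) := by simp [o₂, s₁]
  -- The choices of the previous phase are erased in the cells `0, ..., n`.
  refine Triple.seq (Triple.parIndex (c := n + 1) (v := fun _ => 0)
    ((sc s₂).2.1.bin .add (HasValue.const (by omega)) rfl (by omega))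
    (fun x hx hxB => HasValue.const (by omega)) (by simp [Expr.size]) fun M₃ o₃ v₃ _ => ?_)
  have s₃ : M₃ (k + 11) = M (k + 11) := by simp [o₃, s₂]
  have hcopy₃ : M₃ (k + 13) = M (k + 13) ∧ M₃ (k + 14) = M (k + 14) ∧
      M₃ (k + 15) = M (k + 15) ∧ ∀ x < n, M₃ (k + 18) x = F x := by
    refine ⟨by simp [o₁, o₂, o₃], by simp [o₁, o₂, o₃], by simp [o₁, o₂, o₃], fun x hx => ?_⟩
    simp [o₃, v₂ x hx]
  refine Triple.seq (Triple.par (c := m) (adr := fun j => M (k + 13) j *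
      (F (M (k + 14) j) * (1 - F (M (k + 15) j))) * (M (k + 14) j + 1)) (v := fun j => j + 1)
    (sc s₃).2.2
    (fun j hj hjB => attachAddr_hasValue hjB (by rw [hcopy₃.1]) (by rw [hcopy₃.2.1])
      (by rw [hcopy₃.2.2.1]) (hcopy₃.2.2.2 _ (hsr j hj)) (hcopy₃.2.2.2 _ (hds j hj)) (hus j hj)
      (hF1 _) (hF1 _) (by have := hsr j hj; omega) (by have := hds j hj; omega))
    (fun j hj hjB => (HasValue.index hjB).bin .add (HasValue.const (by omega)) rfl (by omega))
    (by simp [Expr.size]) fun M₄ o₄ c₄ => ?_)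
  have s₄ : M₄ (k + 11) = M (k + 11) := by simp [o₄, s₃]
  have hcopy₄ : M₄ (k + 13) = M (k + 13) ∧ M₄ (k + 14) = M (k + 14) ∧
      M₄ (k + 15) = M (k + 15) ∧ ∀ x < n, M₄ (k + 18) x = F x := by
    refine ⟨by simp [o₄, hcopy₃.1], by simp [o₄, hcopy₃.2.1], by simp [o₄, hcopy₃.2.2.1],
      fun x hx => ?_⟩
    simp [o₄, hcopy₃.2.2.2 x hx]
  refine Triple.seq (Triple.par (c := m) (adr := fun j => M (k + 13) j *
      (F (M (k + 15) j) * (1 - F (M (k + 14) j))) * (M (k + 15) j + 1)) (v := fun j => j + 1)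
    (sc s₄).2.2
    (fun j hj hjB => attachAddr_hasValue hjB (by rw [hcopy₄.1]) (by rw [hcopy₄.2.2.1])
      (by rw [hcopy₄.2.1]) (hcopy₄.2.2.2 _ (hds j hj)) (hcopy₄.2.2.2 _ (hsr j hj)) (hus j hj)
      (hF1 _) (hF1 _) (by have := hds j hj; omega) (by have := hsr j hj; omega))
    (fun j hj hjB => (HasValue.index hjB).bin .add (HasValue.const (by omega)) rfl (by omega))
    (by simp [Expr.size]) fun M₅ o₅ c₅ => ?_)
  have s₅ : M₅ (k + 11) = M (k + 11) := by simp [o₅, s₄]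
  -- The second pass may overwrite the first, but either value is a valid choice; a cell stays zero
  -- only if no slot attaches its vertex.
  have hch : ∀ u < n, (M₅ (k + 17) (u + 1) = 0 ∧
        ∀ j < m, ¬ Attaches (M (k + 13)) (M (k + 14)) (M (k + 15)) F j u) ∨
      ∃ j < m, M₅ (k + 17) (u + 1) = j + 1 ∧
        Attaches (M (k + 13)) (M (k + 14)) (M (k + 15)) F j u := by
    intro u hu
    rcases c₅ (u + 1) with ⟨j, hj, ha, hv⟩ | ⟨ha, hv⟩
    · obtain ⟨h1, h2, h3, h4⟩ := (attachAddr_eq_iff (hus j hj) (hF1 _) (hF1 _)).1 ha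
      exact Or.inr ⟨j, hj, hv, h1, Or.inr ⟨h2, h3, h4⟩⟩
    · rcases c₄ (u + 1) with ⟨j, hj, ha', hv'⟩ | ⟨ha', hv'⟩
      · obtain ⟨h1, h2, h3, h4⟩ := (attachAddr_eq_iff (hus j hj) (hF1 _) (hF1 _)).1 ha'
        exact Or.inr ⟨j, hj, hv.trans hv', h1, Or.inl ⟨h2, h3, h4⟩⟩
      · refine Or.inl ⟨hv.trans (hv'.trans (v₃ _ (by omega))), ?_⟩
        rintro j hj ⟨h1, ⟨h2, h3, h4⟩ | ⟨h2, h3, h4⟩⟩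
        · exact ha' j hj ((attachAddr_eq_iff (hus j hj) (hF1 _) (hF1 _)).2 ⟨h1, h2, h3, h4⟩)
        · exact ha j hj ((attachAddr_eq_iff (hus j hj) (hF1 _) (hF1 _)).2 ⟨h1, h2, h3, h4⟩)
  refine Triple.par (c := n) (adr := fun u => M₅ (k + 17) (u + 1)) (v := fun _ => 1) (sc s₅).2.1
    (fun u hu huB => ((HasValue.index huB).bin .add (HasValue.const (by omega)) rfl
      (by change u + 1 < B; omega)).read _ rfl ?_)
    (fun u hu huB => HasValue.const (by omega)) (by simp [Expr.size]) fun M₆ o₆ c₆ => ?_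
  · rcases hch u hu with ⟨h, -⟩ | ⟨j, hj, h, -⟩
    · omega
    · omega
  have e₅ : M₅ (k + 16) = M₁ (k + 16) := by simp [o₅, o₄, o₃, o₂]
  refine ⟨fun b h16 h17 h18 => ?_, fun x hx => ?_, fun h1 x => ?_,
    fun u => M₅ (k + 17) (u + 1), hch, fun j => ?_⟩
  · rw [o₆ b h16, o₅ b h17, o₄ b h17, o₃ b h17, o₂ b h18, o₁ b h16]
  · rw [o₆ _ (by omega), o₅ _ (by omega)]
    exact hcopy₄.2.2.2 x hx
  · rcases c₆ x with ⟨u, -, -, h⟩ | ⟨-, h⟩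
    · omega
    · rw [h, e₅]
      rcases c₁ x with ⟨i, -, -, h'⟩ | ⟨-, h'⟩
      · omega
      · rw [h']
        exact h1 x
  · constructor
    · intro hne
      rcases c₆ (j + 1) with ⟨u, hu, ha, -⟩ | ⟨-, h⟩
      · exact Or.inr (Or.inr ⟨u, hu, ha⟩)
      · rw [h, e₅] at hne
        rcases c₁ (j + 1) with ⟨i, hi, ha, -⟩ | ⟨-, h'⟩
        · exact Or.inr (Or.inl ⟨i, hi, by omega⟩)
        · rw [h'] at hne
          exact Or.inl hne
    · intro hor
      rcases c₆ (j + 1) with ⟨u, hu, ha, h⟩ | ⟨hno, h⟩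
      · rw [h]
        exact one_ne_zero
      · rw [h, e₅]
        rcases c₁ (j + 1) with ⟨i, hi, ha, h'⟩ | ⟨hno', h'⟩
        · rw [h']
          exact one_ne_zero
        · rw [h']
          rcases hor with hor | ⟨i, hi, hi'⟩ | ⟨u, hu, hu'⟩
          · exact hor
          · exact absurd (by rw [hi']) (hno' i hi)
          · exact absurd hu' (hno u hu)

theorem removeClustered_triple {base U P : ℕ} {F : ℕ → ℕ} (hbase : M (k + 11) 0 = base)
    (hn : M (k + 11) 1 = n) (hm : M (k + 11) 2 = m) (hP : M (k + 11) 3 = P)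
    (hU : M (k + 11) 4 = U) (hB : base + U < B) (hPB : P * 2 < B) (hU4 : 4 < U)
    (hnU : n < U) (hmU : m < U)
    (hal : ∀ x < n, M (k + 12) x ≤ 1) (hus : ∀ j < m, M (k + 13) j ≤ 1)
    (hsr : ∀ j < m, M (k + 14) j < n) (hds : ∀ j < m, M (k + 15) j < n)
    (hF : ∀ x < n, M (k + 18) x = F x) (hF1 : ∀ x, F x ≤ 1) :
    Triple B ω (removeClustered k) M 160 (80 * (n + m + 4)) fun M' =>
      (∀ b, b ≠ k + 11 → b ≠ k + 12 → b ≠ k + 13 → M' b = M b) ∧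
      M' (k + 11) 0 = base + U ∧ M' (k + 11) 1 = n ∧ M' (k + 11) 2 = m ∧
      M' (k + 11) 3 = P * 2 ∧ M' (k + 11) 4 = U ∧
      (∀ x < n, M' (k + 12) x = M (k + 12) x * F x) ∧
      ∀ j < m, M' (k + 13) j = M (k + 13) j * (F (M (k + 14) j) * F (M (k + 15) j)) := by
  refine Triple.mono (d₁ := 40 + (40 + (40 + 40)))
    (w₁ := 40 * (n + 1) + (40 * (m + 1) + (40 + 40))) ?_ (by omega) (by omega) (fun _ h => h)
  have hmul : ∀ {x y : ℕ}, x ≤ 1 → y ≤ 1 → x * y ≤ 1 := fun h h' => Nat.mul_le_mul h h'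
  refine Triple.seq (Triple.parIndex (c := n) (v := fun x => M (k + 12) x * F x)
    (scal_hasValue hn (by omega) (by omega))
    (fun x hx hxB => ((HasValue.index hxB).read _ rfl (by have := hal x hx; omega)).bin .mul
      ((HasValue.index hxB).read _ (hF x hx) (by have := hF1 x; omega)) rfl
      (by have := hmul (hal x hx) (hF1 x); change M (k + 12) x * F x < B; omega))
    (by simp [Expr.size]) fun M₁ o₁ v₁ _ => ?_)
  have s₁ : M₁ (k + 11) = M (k + 11) := by simp [o₁]
  refine Triple.seq (Triple.parIndex (c := m)
    (v := fun j => M (k + 13) j * (F (M (k + 14) j) * F (M (k + 15) j)))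
    (scal_hasValue (by rw [s₁, hm]) (by omega) (by omega))
    (fun j hj hjB => ((HasValue.index hjB).read _ (v := M (k + 13) j) (by simp [o₁])
        (by have := hus j hj; omega)).bin .mul
      ((((HasValue.index hjB).read _ (v := M (k + 14) j) (by simp [o₁])
          (by have := hsr j hj; omega)).read _ (v := F (M (k + 14) j))
          (by simp [o₁, hF _ (hsr j hj)]) (by have := hF1 (M (k + 14) j); omega)).bin .mul
        (((HasValue.index hjB).read _ (v := M (k + 15) j) (by simp [o₁])
          (by have := hds j hj; omega)).read _ (v := F (M (k + 15) j))
          (by simp [o₁, hF _ (hds j hj)]) (by have := hF1 (M (k + 15) j); omega)) rfl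
        (by
          have := hmul (hF1 (M (k + 14) j)) (hF1 (M (k + 15) j))
          change F (M (k + 14) j) * F (M (k + 15) j) < B
          omega)) rfl
      (by
        have := hmul (hus j hj) (hmul (hF1 (M (k + 14) j)) (hF1 (M (k + 15) j)))
        change M (k + 13) j * (F (M (k + 14) j) * F (M (k + 15) j)) < B
        omega)) (by simp [Expr.size]) fun M₂ o₂ v₂ _ => ?_)
  have s₂ : M₂ (k + 11) = M (k + 11) := by simp [o₂, s₁]
  refine Triple.seq (Triple.write (v := base + U) (by omega)
    ((scal_hasValue (v := base) (by rw [s₂, hbase]) (by omega) (by omega)).bin .add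
      (scal_hasValue (v := U) (by rw [s₂, hU]) (by omega) (by omega)) rfl hB)
    (by simp [Expr.size]) fun M₃ o₃ v₃ r₃ => ?_)
  refine Triple.write (v := P * 2) (by omega)
    ((scal_hasValue (v := P) (by rw [r₃ 3 (by omega), s₂, hP]) (by omega) (by omega)).bin .mul
      (HasValue.const (by omega)) rfl hPB) (by simp [Expr.size]) fun M₄ o₄ v₄ r₄ => ?_
  refine ⟨fun b h11 h12 h13 => ?_, ?_, ?_, ?_, v₄, ?_, fun x hx => ?_, fun j hj => ?_⟩
  · rw [o₄ b h11, o₃ b h11, o₂ b h13, o₁ b h12]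
  · rw [r₄ 0 (by omega), v₃]
  · rw [r₄ 1 (by omega), r₃ 1 (by omega), s₂, hn]
  · rw [r₄ 2 (by omega), r₃ 2 (by omega), s₂, hm]
  · rw [r₄ 4 (by omega), r₃ 4 (by omega), s₂, hU]
  · rw [o₄ _ (by omega), o₃ _ (by omega), o₂ _ (by omega), v₁ x hx]
  · rw [o₄ _ (by omega), o₃ _ (by omega), v₂ j hj]

theorem copyOutput_triple (hm : M (k + 11) 2 = m) (hB : m + 1 < B) (hB2 : 2 < B)
    (hmark : ∀ x, M (k + 16) x ≤ 1) :
    Triple B ω (copyOutput k) M 40 (40 * (m + 1)) fun M' =>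
      ∀ j < m, M' 5 j = M (k + 16) (j + 1) :=
  Triple.parIndex (c := m) (scal_hasValue hm (by omega) (by omega))
    (fun j hj hjB => ((HasValue.index hjB).bin .add (HasValue.const (by omega)) rfl
      (by change j + 1 < B; omega)).read _ (v := M (k + 16) (j + 1)) rfl
        (by have := hmark (j + 1); omega))
    (by simp [Expr.size]) fun _ _ v₁ _ => v₁

end SpannerProg

/-! ### Stored graphs: restriction to live vertices -/

namespace StoredGraph

variable {n m : ℕ} (I : StoredGraph n m)

theorem Joins.symm {I : StoredGraph n m} {j : ℕ} {u v : I.verts} (h : I.Joins j u v) :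
    I.Joins j v u := by
  obtain ⟨hj, h⟩ := h
  exact ⟨hj, h.symm⟩

theorem Joins.slot_eq {I : StoredGraph n m} {i j : ℕ} {u v : I.verts} (hi : I.Joins i u v)
    (hj : I.Joins j u v) : i = j := by
  obtain ⟨hi, h⟩ := hi
  obtain ⟨hj, h'⟩ := hj
  rcases h with h | h
  · exact congrArg Fin.val (I.slot_unique _ _ _ _ h h')
  · exact congrArg Fin.val (I.slot_unique _ _ _ _ h h'.symm)

theorem Joins.ends_eq {I : StoredGraph n m} {j : ℕ} {u v u' v' : I.verts} (h : I.Joins j u v)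
    (h' : I.Joins j u' v') : (u = u' ∧ v = v') ∨ (u = v' ∧ v = u') := by
  obtain ⟨hj, h⟩ := h
  obtain ⟨_, h'⟩ := h'
  have key : ∀ {a b c d : I.verts}, I.slot ⟨j, hj⟩ = some (a.1, b.1) →
      I.slot ⟨j, hj⟩ = some (c.1, d.1) → a = c ∧ b = d := fun ha hc => by
    rw [ha, Option.some.injEq, Prod.mk.injEq] at hc
    exact ⟨Subtype.ext hc.1, Subtype.ext hc.2⟩
  rcases h with h | h
  · rcases h' with h' | h'
    · exact Or.inl (key h h')
    · exact Or.inr (key h h')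
  · rcases h' with h' | h'
    · exact Or.inr (key h h').symm
    · exact Or.inl (key h h').symm

theorem Joins.right_eq {I : StoredGraph n m} {j : ℕ} {u v v' : I.verts} (h : I.Joins j u v)
    (h' : I.Joins j u v') : v = v' := by
  rcases h.ends_eq h' with ⟨-, h⟩ | ⟨h1, h2⟩
  · exact h
  · exact h2.trans h1

open Classical in
/-- The stored graph with only the vertices in `R`, and the edges between them. -/
def restrict (R : Set I.verts) : StoredGraph n m where
  verts := I.verts.filter fun v => ∃ h : v ∈ I.verts, ⟨v, h⟩ ∈ R
  slot j := (I.slot j).filter fun q => (∃ h : q.1 ∈ I.verts, ⟨q.1, h⟩ ∈ R) ∧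
    ∃ h : q.2 ∈ I.verts, ⟨q.2, h⟩ ∈ R
  slot_mem j u v h := by
    obtain ⟨h1, h2⟩ := Option.filter_eq_some_iff.1 h
    have h3 := I.slot_mem j u v h1
    obtain ⟨h4, h5⟩ := of_decide_eq_true h2
    exact ⟨Finset.mem_filter.2 ⟨h3.1, h4⟩, Finset.mem_filter.2 ⟨h3.2.1, h5⟩, h3.2.2⟩
  slot_unique i j u v hi hj := by
    refine I.slot_unique i j u v (Option.filter_eq_some_iff.1 hi).1 ?_
    exact hj.imp (fun h => (Option.filter_eq_some_iff.1 h).1)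
      (fun h => (Option.filter_eq_some_iff.1 h).1)

variable (R : Set I.verts)

theorem mem_restrict {v : Fin n} :
    v ∈ (I.restrict R).verts ↔ ∃ h : v ∈ I.verts, ⟨v, h⟩ ∈ R := by
  classical
  change v ∈ Finset.filter _ _ ↔ _
  rw [Finset.mem_filter]
  exact ⟨fun h => h.2, fun h => ⟨h.1, h⟩⟩

theorem slot_restrict {j : Fin m} {q : Fin n × Fin n} : (I.restrict R).slot j = some q ↔
    I.slot j = some q ∧ q.1 ∈ (I.restrict R).verts ∧ q.2 ∈ (I.restrict R).verts := by
  classical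
  rw [mem_restrict, mem_restrict]
  change Option.filter _ _ = some q ↔ _
  rw [Option.filter_eq_some_iff, decide_eq_true_iff]

/-- Live vertices as vertices of the original graph. -/
def incl (v : (I.restrict R).verts) : I.verts := ⟨v.1, ((I.mem_restrict R).1 v.2).1⟩

theorem incl_injective : Function.Injective (I.incl R) := fun _ _ h =>
  Subtype.ext (congrArg (fun z : I.verts => z.1) h)

theorem range_incl : Set.range (I.incl R) = R := by
  ext v
  constructor
  · rintro ⟨w, rfl⟩
    exact ((I.mem_restrict R).1 w.2).2
  · intro hv
    exact ⟨⟨v.1, (I.mem_restrict R).2 ⟨v.2, hv⟩⟩, rfl⟩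

theorem joins_restrict {j : ℕ} {u v : (I.restrict R).verts} :
    (I.restrict R).Joins j u v ↔ I.Joins j (I.incl R u) (I.incl R v) := by
  refine exists_congr fun hj => or_congr ?_ ?_
  · rw [slot_restrict]
    exact ⟨fun h => h.1, fun h => ⟨h, u.2, v.2⟩⟩
  · rw [slot_restrict]
    exact ⟨fun h => h.1, fun h => ⟨h, v.2, u.2⟩⟩

/-- The graph on the live vertices is an induced subgraph. -/
def graphEmbedding : (I.restrict R).graph ↪g I.graph where
  toFun := I.incl R
  inj' := I.incl_injective R
  map_rel_iff' := exists_congr fun _ => (I.joins_restrict R).symm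

/-! #### The initial memory -/

theorem load_zero_of_two_le {x : ℕ} (hx : 2 ≤ x) : I.load 0 x = 0 := by
  obtain ⟨y, rfl⟩ := Nat.exists_eq_add_of_le' hx
  rfl

theorem load_of_five_le {a : ℕ} (ha : 5 ≤ a) (x : ℕ) : I.load a x = 0 := by
  obtain ⟨b, rfl⟩ := Nat.exists_eq_add_of_le' ha
  rfl

theorem load_vert (v : Fin n) [Decidable (v ∈ I.verts)] :
    I.load 1 v = if v ∈ I.verts then 1 else 0 := by
  simp only [load]
  have : (∃ h : v.1 < n, (⟨v.1, h⟩ : Fin n) ∈ I.verts) ↔ v ∈ I.verts :=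
    ⟨fun ⟨_, h⟩ => h, fun h => ⟨v.2, h⟩⟩
  split_ifs <;> tauto

theorem load_one_of_le {x : ℕ} (hx : n ≤ x) : I.load 1 x = 0 := by
  simp only [load]
  rw [if_neg]
  rintro ⟨h, -⟩
  omega

theorem load_one_le (x : ℕ) : I.load 1 x ≤ 1 := by
  simp only [load]
  split_ifs <;> omega

theorem load_slot_of_le {j : ℕ} (hj : m ≤ j) :
    I.load 2 j = 0 ∧ I.load 3 j = 0 ∧ I.load 4 j = 0 := by
  simp only [load]
  rw [dif_neg (by omega), dif_neg (by omega), dif_neg (by omega)]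
  exact ⟨rfl, rfl, rfl⟩

theorem load_slot_some {j : Fin m} {q : Fin n × Fin n} (h : I.slot j = some q) :
    I.load 2 j = 1 ∧ I.load 3 j = q.1 ∧ I.load 4 j = q.2 := by
  simp only [load]
  rw [dif_pos j.2, dif_pos j.2, dif_pos j.2]
  simp [h]

theorem load_slot_none {j : Fin m} (h : I.slot j = none) :
    I.load 2 j = 0 ∧ I.load 3 j = 0 ∧ I.load 4 j = 0 := by
  simp only [load]
  rw [dif_pos j.2, dif_pos j.2, dif_pos j.2]
  simp [h]

theorem load_slot_cases (j : ℕ) : (I.load 2 j = 0 ∧ I.load 3 j = 0 ∧ I.load 4 j = 0) ∨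
    ∃ hj : j < m, ∃ q, I.slot ⟨j, hj⟩ = some q ∧ I.load 2 j = 1 ∧ I.load 3 j = q.1 ∧
      I.load 4 j = q.2 := by
  by_cases hj : j < m
  · rcases h : I.slot ⟨j, hj⟩ with _ | q
    · exact Or.inl (I.load_slot_none h)
    · exact Or.inr ⟨hj, q, h, I.load_slot_some h⟩
  · exact Or.inl (I.load_slot_of_le (by omega))

theorem load_two_le (j : ℕ) : I.load 2 j ≤ 1 := by
  rcases I.load_slot_cases j with h | ⟨_, _, _, h⟩ <;> omega

theorem load_ends_lt (hn : 0 < n) (j : ℕ) : I.load 3 j < n ∧ I.load 4 j < n := by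
  rcases I.load_slot_cases j with h | ⟨_, q, _, h⟩
  · omega
  · rw [h.2.1, h.2.2]
    exact ⟨q.1.2, q.2.2⟩

theorem load_lt {U : ℕ} (hn : 0 < n) (hnU : n < U) (hmU : m < U) (hU : 1 < U) (a x : ℕ) :
    I.load a x < U := by
  have h1 := I.load_one_le x
  have h2 := I.load_two_le x
  have h3 := I.load_ends_lt hn x
  rcases lt_or_ge a 5 with ha | ha
  · interval_cases a
    · rcases Nat.lt_or_ge x 2 with hx | hx
      · interval_cases x
        · exact hnU
        · exact hmU
      · rw [I.load_zero_of_two_le hx]; omega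
    all_goals omega
  · rw [I.load_of_five_le ha]; omega

/-- A removed slot is loaded with both ends `0`. This is why `loadLive` multiplies the stored ends
by the flag of the slot. -/
theorem load_restrict_slot (j : ℕ) :
    (I.restrict R).load 2 j * I.load 3 j = (I.restrict R).load 3 j ∧
    (I.restrict R).load 2 j * I.load 4 j = (I.restrict R).load 4 j := by
  rcases (I.restrict R).load_slot_cases j with ⟨h1, h2, h3⟩ | ⟨hj, q, hq, h1, h2, h3⟩
  · rw [h1, h2, h3]; simp
  · obtain ⟨h4, h5, h6⟩ := I.load_slot_some ((I.slot_restrict R).1 hq).1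
    simp only at h4 h5 h6
    rw [h1, h2, h3, h5, h6]; simp

theorem restrict_univ_load : (I.restrict Set.univ).load 1 = I.load 1 ∧
    (I.restrict Set.univ).load 2 = I.load 2 := by
  have hv : ∀ v, v ∈ (I.restrict Set.univ).verts ↔ v ∈ I.verts := fun v => by
    rw [mem_restrict]
    exact ⟨fun h => h.1, fun h => ⟨h, trivial⟩⟩
  constructor
  · funext x
    simp only [load, hv]
  · funext j
    rcases I.load_slot_cases j with ⟨h1, -⟩ | ⟨hj, q, hq, h1, -⟩
    · rcases (I.restrict Set.univ).load_slot_cases j with ⟨h2, -⟩ | ⟨hj, q, hq, h2, -⟩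
      · rw [h1, h2]
      · have h3 : I.load 2 j = 1 := (I.load_slot_some ((I.slot_restrict _).1 hq).1).1
        omega
    · have hq' : (I.restrict Set.univ).slot ⟨j, hj⟩ = some q := by
        have := I.slot_mem _ _ _ hq
        exact (I.slot_restrict _).2 ⟨hq, (hv _).2 this.1, (hv _).2 this.2.1⟩
      have h3 : (I.restrict Set.univ).load 2 j = 1 :=
        ((I.restrict Set.univ).load_slot_some hq').1
      rw [h1, h3]

variable {I R}

/-- The load after the removal of the clustered vertices. -/
theorem load_next {cl : (I.restrict R).verts → Option ℕ} {F : ℕ → ℕ}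
    (hF : ∀ v : (I.restrict R).verts, F v.1 = if cl v = none then 1 else 0) :
    (∀ x, x < n → (I.restrict (I.incl R '' {v | cl v = none})).load 1 x =
      (I.restrict R).load 1 x * F x) ∧
    ∀ j, j < m → (I.restrict (I.incl R '' {v | cl v = none})).load 2 j =
      (I.restrict R).load 2 j * (F (I.load 3 j) * F (I.load 4 j)) := by
  classical
  have hmem : ∀ v : Fin n, v ∈ (I.restrict (I.incl R '' {v | cl v = none})).verts ↔
      ∃ h : v ∈ (I.restrict R).verts, cl ⟨v, h⟩ = none := by
    intro v
    rw [mem_restrict]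
    constructor
    · rintro ⟨h, w, hw, hwv⟩
      have : w.1 = v := congrArg (fun z : I.verts => z.1) hwv
      subst this
      exact ⟨w.2, hw⟩
    · rintro ⟨h, hc⟩
      exact ⟨(I.incl R ⟨v, h⟩).2, ⟨v, h⟩, hc, rfl⟩
  constructor
  · intro x hx
    have h1 := (I.restrict (I.incl R '' {v | cl v = none})).load_vert ⟨x, hx⟩
    have h2 := (I.restrict R).load_vert ⟨x, hx⟩
    simp only at h1 h2
    rw [h1, h2]
    by_cases hm : (⟨x, hx⟩ : Fin n) ∈ (I.restrict R).verts
    · rw [if_pos hm, one_mul, show F x = _ from hF ⟨⟨x, hx⟩, hm⟩]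
      refine if_congr ?_ rfl rfl
      rw [hmem]
      exact ⟨fun ⟨_, h⟩ => h, fun h => ⟨hm, h⟩⟩
    · rw [if_neg hm, if_neg (fun h => hm ((hmem _).1 h).1), zero_mul]
  · intro j hj
    rcases (I.restrict R).load_slot_cases j with ⟨h1, -⟩ | ⟨_, q, hq, h1, -⟩
    · rw [h1, zero_mul]
      rcases (I.restrict (I.incl R '' {v | cl v = none})).load_slot_cases j with
        ⟨h2, -⟩ | ⟨_, q, hq, h2, -⟩
      · exact h2
      · obtain ⟨h3, h4, h5⟩ := (I.slot_restrict _).1 hq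
        have : (I.restrict R).slot ⟨j, hj⟩ = some q :=
          (I.slot_restrict R).2 ⟨h3, ((hmem _).1 h4).1, ((hmem _).1 h5).1⟩
        have := ((I.restrict R).load_slot_some this).1
        simp only at this
        omega
    · obtain ⟨h3, h4, h5⟩ := (I.slot_restrict R).1 hq
      obtain ⟨-, h6, h7⟩ := I.load_slot_some h3
      simp only at h6 h7
      rw [h1, h6, h7, one_mul, hF ⟨q.1, h4⟩, hF ⟨q.2, h5⟩]
      by_cases hs : cl ⟨q.1, h4⟩ = none ∧ cl ⟨q.2, h5⟩ = none
      · rw [if_pos hs.1, if_pos hs.2]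
        refine ((I.restrict (I.incl R '' {v | cl v = none})).load_slot_some
          (j := ⟨j, hj⟩) ((I.slot_restrict _).2 ⟨h3, ?_, ?_⟩)).1
        · exact (hmem _).2 ⟨h4, hs.1⟩
        · exact (hmem _).2 ⟨h5, hs.2⟩
      · have hz : (if cl ⟨q.1, h4⟩ = none then 1 else 0) *
            (if cl ⟨q.2, h5⟩ = none then 1 else 0) = 0 := by
          by_cases h : cl ⟨q.1, h4⟩ = none
          · rw [if_neg (fun h' => hs ⟨h, h'⟩), mul_zero]
          · rw [if_neg h, zero_mul]
        rw [hz]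
        rcases (I.restrict (I.incl R '' {v | cl v = none})).load_slot_cases j with
          ⟨h2, -⟩ | ⟨_, q', hq', -, -⟩
        · exact h2
        · obtain ⟨h8, h9, h10⟩ := (I.slot_restrict _).1 hq'
          rw [h3, Option.some.injEq] at h8
          subst h8
          exact absurd ⟨((hmem _).1 h9).2, ((hmem _).1 h10).2⟩ hs

/-- The edges found by the machine are those between unclustered and clustered vertices. -/
theorem attaches_iff {cl : (I.restrict R).verts → Option ℕ} {F us sr ds : ℕ → ℕ}
    (hF : ∀ v : (I.restrict R).verts, F v.1 = if cl v = none then 1 else 0)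
    (hus : ∀ j < m, us j = (I.restrict R).load 2 j) (hsr : ∀ j < m, sr j = I.load 3 j)
    (hds : ∀ j < m, ds j = I.load 4 j) {j x : ℕ} (hj : j < m) :
    SpannerProg.Attaches us sr ds F j x ↔ ∃ u v : (I.restrict R).verts, u.1.1 = x ∧
      cl u = none ∧ (I.restrict R).Joins j u v ∧ cl v ≠ none := by
  have hF1 : ∀ v : (I.restrict R).verts, F v.1 = 1 ↔ cl v = none := fun v => by
    rw [hF]; split_ifs with h <;> simp [h]
  have hF0 : ∀ v : (I.restrict R).verts, F v.1 = 0 ↔ cl v ≠ none := fun v => by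
    rw [hF]; split_ifs with h <;> simp [h]
  unfold SpannerProg.Attaches
  rw [hus j hj, hsr j hj, hds j hj]
  constructor
  · rintro ⟨h1, h⟩
    rcases (I.restrict R).load_slot_cases j with ⟨h2, -⟩ | ⟨_, q, hq, -, -⟩
    · omega
    obtain ⟨h3, h4, h5⟩ := (I.slot_restrict R).1 hq
    obtain ⟨-, h6, h7⟩ := I.load_slot_some h3
    simp only at h6 h7
    rw [h6, h7] at h
    rcases h with ⟨rfl, h, h'⟩ | ⟨rfl, h, h'⟩
    · exact ⟨⟨q.1, h4⟩, ⟨q.2, h5⟩, rfl, (hF1 ⟨q.1, h4⟩).1 h, ⟨hj, Or.inl hq⟩,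
        (hF0 ⟨q.2, h5⟩).1 h'⟩
    · exact ⟨⟨q.2, h5⟩, ⟨q.1, h4⟩, rfl, (hF1 ⟨q.2, h5⟩).1 h, ⟨hj, Or.inr hq⟩,
        (hF0 ⟨q.1, h4⟩).1 h'⟩
  · rintro ⟨u, v, rfl, hu, ⟨_, hs | hs⟩, hv⟩
    · obtain ⟨h1, -⟩ := (I.restrict R).load_slot_some hs
      obtain ⟨-, h6, h7⟩ := I.load_slot_some ((I.slot_restrict R).1 hs).1
      simp only at h1 h6 h7
      exact ⟨h1, Or.inl ⟨h6, by rw [h6]; exact (hF1 u).2 hu, by rw [h7]; exact (hF0 v).2 hv⟩⟩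
    · obtain ⟨h1, -⟩ := (I.restrict R).load_slot_some hs
      obtain ⟨-, h6, h7⟩ := I.load_slot_some ((I.slot_restrict R).1 hs).1
      simp only at h1 h6 h7
      exact ⟨h1, Or.inr ⟨h7, by rw [h7]; exact (hF1 u).2 hu, by rw [h6]; exact (hF0 v).2 hv⟩⟩

end StoredGraph

/-- The number of tree edges in the memory. -/
theorem MemClustering.edges_le {n m : ℕ} {I : StoredGraph n m} {M : Mem}
    {cl : I.verts → Option ℕ} {T : ℕ → I.graph.Subgraph} {t D : ℕ} {ξ : ℝ}
    (h : MemClustering I M cl T) (hC : IsWeakClustering I.graph cl T t D ξ) :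
    (M 6 1 : ℝ) ≤ ξ * Nat.card I.verts := by
  rcases isEmpty_or_nonempty I.verts with hV | hV
  · have h0 : M 6 1 = 0 := by
      by_contra h0
      obtain ⟨u, -⟩ := h.edge_valid 0 (Nat.pos_of_ne_zero h0)
      exact hV.elim u
    rw [h0, Nat.card_of_isEmpty]
    simp
  have hex : ∀ k, ∃ p : I.verts × I.verts, k < M 6 1 → I.Joins (M 10 k) p.1 p.2 := fun k => by
    by_cases hk : k < M 6 1
    · obtain ⟨u, v, h⟩ := h.edge_valid k hk
      exact ⟨(u, v), fun _ => h⟩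
    · exact ⟨Classical.arbitrary _, fun h => absurd h hk⟩
  choose f hf using hex
  -- As the list has no repetitions and a slot is determined by its edge, the positions in the list
  -- inject into the labelled tree edges.
  have h1 : (Set.Iio (M 6 1)).ncard ≤ {p : ℕ × Sym2 I.verts | p.2 ∈ (T p.1).edgeSet}.ncard := by
    refine Set.ncard_le_ncard_of_injOn (fun k => (M 9 k, s((f k).1, (f k).2))) ?_ ?_
      hC.finite_treeEdges
    · intro k hk
      exact (h.edges _ _ _).2 ⟨k, hk, rfl, hf k hk⟩
    · intro k hk k' hk' heq
      obtain ⟨h9, he⟩ := Prod.ext_iff.1 heq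
      have hj : I.Joins (M 10 k') (f k).1 (f k).2 := by
        rcases Sym2.eq_iff.1 he with ⟨h1, h2⟩ | ⟨h1, h2⟩
        · rw [h1, h2]; exact hf k' hk'
        · rw [h1, h2]; exact (hf k' hk').symm
      exact h.edge_unique k hk k' hk' h9 ((hf k hk).slot_eq hj)
  have h2 : (Set.Iio (M 6 1)).ncard = M 6 1 := by
    rw [← Finset.coe_Iio, Set.ncard_coe_finset, Nat.card_Iio]
  rw [h2] at h1
  refine le_trans ?_ hC.overlap
  exact_mod_cast h1.trans hC.ncard_treeEdges_le

theorem exists_option_of_functional {α β : Type} {r : α → β → Prop}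
    (h : ∀ a b b', r a b → r a b' → b = b') : ∃ c : α → Option β, ∀ a b, c a = some b ↔ r a b := by
  classical
  refine ⟨fun a => if h : ∃ b, r a b then some h.choose else none, fun a b => ?_⟩
  constructor
  · intro hc
    dsimp only at hc
    split_ifs at hc with hex
    rw [← Option.some_injective _ hc]
    exact hex.choose_spec
  · intro hr
    have hex : ∃ b, r a b := ⟨b, hr⟩
    dsimp only
    rw [dif_pos hex, h a _ _ hex.choose_spec hr]

/-! ### One phase of the PRAM algorithm -/

/-- The memory before phase number `p`: the vertices in `R` are live, and the marked slots are those
of the edges in `Marked`. -/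
structure LiveState {n m : ℕ} (I : StoredGraph n m) (k U p : ℕ) (R : Set I.verts)
    (Marked : I.verts → I.verts → Prop) (M : Mem) : Prop where
  base : M (k + 11) 0 = (p + 1) * U
  num_verts : M (k + 11) 1 = n
  num_slots : M (k + 11) 2 = m
  pow : M (k + 11) 3 = 2 ^ p
  unit : M (k + 11) 4 = U
  low : ∀ a < k + 11, ∀ x, M a x < (p + 1) * U
  alive : ∀ x < n, M (k + 12) x = (I.restrict R).load 1 x
  used : ∀ j < m, M (k + 13) j = (I.restrict R).load 2 j
  src : ∀ j < m, M (k + 14) j = I.load 3 j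
  dst : ∀ j < m, M (k + 15) j = I.load 4 j
  marks_le : ∀ x, M (k + 16) x ≤ 1
  marked : ∀ u v, (∃ j, I.Joins j u v ∧ M (k + 16) (j + 1) ≠ 0) ↔ Marked u v

/-- The graph of the edges that are marked in one phase. -/
theorem exists_phase {n m : ℕ} {I : StoredGraph n m} {R : Set I.verts} {M : Mem}
    {cl : (I.restrict R).verts → Option ℕ} {T : ℕ → (I.restrict R).graph.Subgraph} {D : ℕ} {ξ : ℝ}
    (hM : MemClustering (I.restrict R) M cl T)
    (hC : IsWeakClustering (I.restrict R).graph cl T 3 D ξ) {ch : ℕ → ℕ}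
    {att : ℕ → ℕ → Prop}
    (hatt : ∀ j < m, ∀ x, att j x ↔ ∃ u v : (I.restrict R).verts, u.1.1 = x ∧
      cl u = none ∧ (I.restrict R).Joins j u v ∧ cl v ≠ none)
    (hch : ∀ u < n, (ch u = 0 ∧ ∀ j < m, ¬ att j u) ∨ ∃ j < m, ch u = j + 1 ∧ att j u) :
    ∃ P : SimpleGraph I.verts, IsPhase I.graph P R (I.incl R '' {v | cl v = none}) D ξ ∧
      ∀ u v, P.Adj u v ↔ ∃ j, I.Joins j u v ∧
        ((∃ i < M 6 1, M 10 i = j) ∨ ∃ x < n, ch x = j + 1) := by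
  -- The choice of `u` is the other end of its slot, which is unique because a slot holds one edge.
  obtain ⟨c, hc⟩ := exists_option_of_functional
    (r := fun u v : (I.restrict R).verts => ∃ j, ch u.1 = j + 1 ∧ (I.restrict R).Joins j u v)
    (by
      rintro a b b' ⟨j, hj, h⟩ ⟨j', hj', h'⟩
      obtain rfl : j = j' := by omega
      exact h.right_eq h')
  have hchosen : ∀ x < n, ∀ j, ch x = j + 1 → ∃ u v : (I.restrict R).verts, u.1.1 = x ∧
      (I.restrict R).Joins j u v ∧ cl v ≠ none := by
    intro x hx j hj
    rcases hch x hx with ⟨h, -⟩ | ⟨j', hj', h, ha⟩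
    · omega
    · obtain rfl : j = j' := by omega
      obtain ⟨u, v, h1, -, h2, h3⟩ := (hatt j hj' x).1 ha
      exact ⟨u, v, h1, h2, h3⟩
  have hcadj : ∀ a b, c a = some b → (I.restrict R).graph.Adj a b := fun a b h => by
    obtain ⟨j, -, h⟩ := (hc a b).1 h
    exact ⟨j, h⟩
  refine ⟨(attachGraph T c hcadj).map (I.graphEmbedding R).toEmbedding, ?_, ?_⟩
  · have := hC.isPhase rfl (I.graphEmbedding R) c hcadj ?_ ?_
    · rw [show Set.range (I.graphEmbedding R) = R from I.range_incl R] at this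
      exact this
    · intro a b hab
      obtain ⟨j, hj, h⟩ := (hc a b).1 hab
      obtain ⟨u, v, h1, h2, h3⟩ := hchosen _ a.1.2 j hj
      obtain rfl : u = a := Subtype.ext (Fin.ext h1)
      rwa [h.right_eq h2]
    · rintro a b ⟨j, h⟩ ha hb hn
      have hj : j < m := h.1
      rcases hch _ a.1.2 with ⟨-, h'⟩ | ⟨j', hj', h', h''⟩
      · exact h' j hj ((hatt j hj _).2 ⟨a, b, rfl, ha, h, hb⟩)
      · obtain ⟨u, v, h1, -, h2, -⟩ := (hatt j' hj' _).1 h''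
        obtain rfl : u = a := Subtype.ext (Fin.ext h1)
        rw [(hc u v).2 ⟨j', h', h2⟩] at hn
        exact absurd hn (by simp)
  · intro u v
    rw [SimpleGraph.map_adj]
    -- A slot determines the ends of its edge only up to order.
    have hval : ∀ a b : (I.restrict R).verts, ∀ j, (I.restrict R).Joins j a b →
        I.Joins j u v → (attachGraph T c hcadj).Adj a b →
        ∃ a b, (attachGraph T c hcadj).Adj a b ∧ (I.graphEmbedding R).toEmbedding a = u ∧
          (I.graphEmbedding R).toEmbedding b = v := by
      intro a b j hj hj' hab
      rcases ((I.joins_restrict R).1 hj).ends_eq hj' with ⟨h1, h2⟩ | ⟨h1, h2⟩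
      · exact ⟨a, b, hab, h1, h2⟩
      · exact ⟨b, a, hab.symm, h2, h1⟩
    constructor
    · rintro ⟨a, b, ⟨ℓ, h⟩ | h | h, rfl, rfl⟩
      · obtain ⟨i, hi, -, h⟩ := (hM.edges ℓ a b).1 h
        exact ⟨_, (I.joins_restrict R).1 h, Or.inl ⟨i, hi, rfl⟩⟩
      · obtain ⟨j, hj, h⟩ := (hc a b).1 h
        exact ⟨j, (I.joins_restrict R).1 h, Or.inr ⟨_, a.1.2, hj⟩⟩
      · obtain ⟨j, hj, h⟩ := (hc b a).1 h
        exact ⟨j, (I.joins_restrict R).1 h.symm, Or.inr ⟨_, b.1.2, hj⟩⟩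
    · rintro ⟨j, hj, ⟨i, hi, rfl⟩ | ⟨x, hx, h⟩⟩
      · obtain ⟨a, b, hab⟩ := hM.edge_valid i hi
        exact hval a b _ hab hj (Or.inl ⟨M 9 i, (hM.edges _ _ _).2 ⟨i, hi, rfl, hab⟩⟩)
      · obtain ⟨a, b, rfl, hab, -⟩ := hchosen x hx j h
        exact hval a b j hab hj (Or.inr (Or.inl ((hc a b).2 ⟨j, h, hab⟩)))

namespace SpannerProg

/-- The body of the main loop. -/
theorem phase_triple {n m k U p b B d w : ℕ} {I : StoredGraph n m} {R : Set I.verts}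
    {Marked : I.verts → I.verts → Prop} {M M₁ : Mem} {ω ω' : ℕ → Bool} {prog : Prog}
    {cl : (I.restrict R).verts → Option ℕ} {T : ℕ → (I.restrict R).graph.Subgraph} {D : ℕ} {ξ : ℝ}
    (hn : 0 < n) (hnU : n + 1 < U) (hmU : m + 1 < U) (hU : 4 < U) (hb : b ≤ U)
    (hB : (p + 2) * U < B) (hPB : 2 ^ p * 2 < B) (hω : ∀ x < b, ω' ((p + 1) * U + x) = ω x)
    (hk : prog.arrays ≤ k + 11) (hE : Exec b ω prog [[]] (I.restrict R).load M₁ d w)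
    (hcl : MemClustering (I.restrict R) M₁ cl T)
    (hC : IsWeakClustering (I.restrict R).graph cl T 3 D ξ) (hM : LiveState I k U p R Marked M) :
    Triple B ω' (.seq (loadLive k) <| .seq (prog.shift (k + 11)) <|
      .seq (chooseEdges k) (removeClustered k)) M (7 * d + 640)
      (7 * w + 640 * (n + m + M₁ 6 1 + 2)) fun M' =>
        ∃ P, IsPhase I.graph P R (I.incl R '' {v | cl v = none}) D ξ ∧
          LiveState I k U (p + 1) (I.incl R '' {v | cl v = none})
            (fun u v => Marked u v ∨ P.Adj u v) M' := by
  have hbU : (p + 1) * U + U = (p + 2) * U := by ring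
  have hldlt := (I.restrict R).load_lt hn (by omega : n < U) (by omega : m < U) (by omega : 1 < U)
  have hsrc : ∀ j < m, M (k + 14) j < n := fun j hj => by
    rw [hM.src j hj]; exact (I.load_ends_lt hn j).1
  have hdst : ∀ j < m, M (k + 15) j < n := fun j hj => by
    rw [hM.dst j hj]; exact (I.load_ends_lt hn j).2
  have hloaded := loadLive_triple (B := B) (ω := ω') (N := (I.restrict R).load) hM.base
    hM.num_verts hM.num_slots hM.low hldlt (by omega) hU rfl rfl
    (fun x hx => (I.restrict R).load_zero_of_two_le hx)
    hM.alive (fun x hx => (I.restrict R).load_one_of_le hx)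
    hM.used (fun x hx => ((I.restrict R).load_slot_of_le hx).1)
    (fun x hx => by rw [hM.used x hx, hM.src x hx]; exact (I.load_restrict_slot R x).1)
    (fun x hx => ((I.restrict R).load_slot_of_le hx).2.1)
    (fun x hx => by rw [hM.used x hx, hM.dst x hx]; exact (I.load_restrict_slot R x).2)
    (fun x hx => ((I.restrict R).load_slot_of_le hx).2.2)
    (fun a ha x => (I.restrict R).load_of_five_le ha x)
    (fun x hx => by have := hsrc x hx; omega) (fun x hx => by have := hdst x hx; omega)
  refine (Triple.seq (d₂ := 7 * d + 400) (w₂ := 7 * w + 400 * (n + m + M₁ 6 1 + 2))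
    (hloaded.mono le_rfl le_rfl ?_)).mono (by omega) (by omega) (fun _ h => h)
  rintro M2 ⟨hrep, hM2⟩
  obtain ⟨M3, d3, w3, hE3, hrep3, hM3, hd3, hw3⟩ := hE.shift hb (hbU.trans_lt hB).le hω hk hrep
  have hM3' : ∀ b, k + 11 ≤ b → M3 b = M b := fun b hb => (hM3 b hb).trans (hM2 b hb)
  refine Triple.seq (d₁ := 7 * d) (w₁ := 7 * w) (d₂ := 400)
    (w₂ := 400 * (n + m + M₁ 6 1 + 2)) ⟨M3, d3, w3, hE3, hd3, hw3, ?_⟩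
  -- Array 5 holds the label plus one, so zero means unclustered.
  let F : ℕ → ℕ := fun x => if M₁ 5 x = 0 then 1 else 0
  have hF : ∀ v : (I.restrict R).verts, F v.1 = if cl v = none then 1 else 0 := fun v => by
    refine if_congr ?_ rfl rfl
    rw [hcl.label v]
    cases cl v <;> simp
  have hused : ∀ j < m, M3 (k + 13) j = (I.restrict R).load 2 j := fun j hj => by
    rw [hM3' _ (by omega)]; exact hM.used j hj
  have hsrc3 : ∀ j < m, M3 (k + 14) j = I.load 3 j := fun j hj => by
    rw [hM3' _ (by omega)]; exact hM.src j hj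
  have hdst3 : ∀ j < m, M3 (k + 15) j = I.load 4 j := fun j hj => by
    rw [hM3' _ (by omega)]; exact hM.dst j hj
  have hused1 : ∀ j < m, M3 (k + 13) j ≤ 1 := fun j hj => by
    rw [hused j hj]; exact (I.restrict R).load_two_le j
  have hsrcn : ∀ j < m, M3 (k + 14) j < n := fun j hj => by
    rw [hsrc3 j hj]; exact (I.load_ends_lt hn j).1
  have hdstn : ∀ j < m, M3 (k + 15) j < n := fun j hj => by
    rw [hdst3 j hj]; exact (I.load_ends_lt hn j).2
  have hch := chooseEdges_triple (B := B) (ω := ω') (M := M3) (F := F) hrep3.base_eq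
    ((congrFun (hM3' _ le_rfl) 1).trans hM.num_verts)
    ((congrFun (hM3' _ le_rfl) 2).trans hM.num_slots) (by omega) hU hnU hmU hrep3.lt
    (hrep3.sub_eq 6 (by omega) 1) (hrep3.sub_eq 5 (by omega)) (hrep3.sub_eq 10 (by omega))
    (fun i hi => by obtain ⟨u, v, h⟩ := hcl.edge_valid i hi; exact h.1) (fun x => rfl)
    hused1 hsrcn hdstn
  refine (Triple.seq (d₂ := 160) (w₂ := 80 * (n + m + 4)) (hch.mono le_rfl le_rfl ?_)).mono
    (by omega) (by omega) (fun _ h => h)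
  rintro M4 ⟨hM4, hflag, hmark1, ch, hch, hmark⟩
  have hM4' : ∀ b, k + 11 ≤ b → b ≠ k + 16 → b ≠ k + 17 → b ≠ k + 18 → M4 b = M b :=
    fun b h1 h2 h3 h4 => (hM4 b h2 h3 h4).trans (hM3' b h1)
  have hrem := removeClustered_triple (B := B) (ω := ω') (M := M4) (F := F)
    ((congrFun (hM4' (k + 11) (by omega) (by omega) (by omega) (by omega)) 0).trans hM.base)
    ((congrFun (hM4' (k + 11) (by omega) (by omega) (by omega) (by omega)) 1).trans hM.num_verts)
    ((congrFun (hM4' (k + 11) (by omega) (by omega) (by omega) (by omega)) 2).trans hM.num_slots)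
    ((congrFun (hM4' (k + 11) (by omega) (by omega) (by omega) (by omega)) 3).trans hM.pow)
    ((congrFun (hM4' (k + 11) (by omega) (by omega) (by omega) (by omega)) 4).trans hM.unit)
    (by omega) hPB hU (by omega) (by omega)
    (fun x hx => by
      rw [hM4' (k + 12) (by omega) (by omega) (by omega) (by omega), hM.alive x hx]
      exact (I.restrict R).load_one_le x)
    (fun j hj => by rw [hM4 (k + 13) (by omega) (by omega) (by omega)]; exact hused1 j hj)
    (fun j hj => by rw [hM4 (k + 14) (by omega) (by omega) (by omega)]; exact hsrcn j hj)
    (fun j hj => by rw [hM4 (k + 15) (by omega) (by omega) (by omega)]; exact hdstn j hj)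
    hflag (fun x => by simp only [F]; split_ifs <;> omega)
  refine hrem.mono le_rfl le_rfl ?_
  rintro M5 ⟨hM5, h0, h1, h2, h3, h4, hal, hus⟩
  obtain ⟨P, hP, hPadj⟩ := exists_phase hcl hC
    (att := SpannerProg.Attaches (M3 (k + 13)) (M3 (k + 14)) (M3 (k + 15)) F)
    (fun j hj x => StoredGraph.attaches_iff hF hused hsrc3 hdst3 hj) hch
  obtain ⟨hnext1, hnext2⟩ := StoredGraph.load_next hF
  have hM5' : ∀ b, k + 14 ≤ b → b ≠ k + 16 → b ≠ k + 17 → b ≠ k + 18 → M5 b = M b :=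
    fun b h1 h2 h3 h4 => (hM5 b (by omega) (by omega) (by omega)).trans
      (hM4' b (by omega) h2 h3 h4)
  have hM16 : M5 (k + 16) = M4 (k + 16) := hM5 _ (by omega) (by omega) (by omega)
  refine ⟨P, hP, ?_⟩
  constructor
  · rw [h0]; ring
  · exact h1
  · exact h2
  · rw [h3, pow_succ]
  · exact h4
  -- All contents left by the simulated run lie below the next base, so they count as zeros in the
  -- next phase without being cleared.
  · intro a ha x
    rw [hM5 a (by omega) (by omega) (by omega), hM4 a (by omega) (by omega) (by omega)]
    have := hrep3.lt a ha x
    rw [show (p + 1 + 1) * U = (p + 1) * U + U by ring]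
    exact this
  · intro x hx
    rw [hal x hx, hM4' (k + 12) (by omega) (by omega) (by omega) (by omega), hM.alive x hx,
      hnext1 x hx]
  · intro j hj
    rw [hus j hj, hM4 (k + 13) (by omega) (by omega) (by omega),
      hM4 (k + 14) (by omega) (by omega) (by omega), hM4 (k + 15) (by omega) (by omega) (by omega),
      hused j hj, hsrc3 j hj, hdst3 j hj, hnext2 j hj]
  · intro j hj
    rw [hM5' (k + 14) (by omega) (by omega) (by omega) (by omega), hM.src j hj]
  · intro j hj
    rw [hM5' (k + 15) (by omega) (by omega) (by omega) (by omega), hM.dst j hj]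
  · rw [hM16]
    refine hmark1 ?_
    rw [hM3' _ (by omega)]
    exact hM.marks_le
  · intro u v
    rw [hM16, hPadj, ← hM.marked, ← exists_or]
    refine exists_congr fun j => ?_
    rw [hmark, hM3' (k + 16) (by omega), and_or_left]

end SpannerProg

/-! ### The PRAM algorithm -/

/-- This yields `1 ≤ T n`, so that the constant overhead of a phase is absorbed by the depth of the
clustering program. -/
theorem Exec.one_le_depth {B : ℕ} {ω : ℕ → Bool} {p : Prog} {S : List Thread} {M M' : Mem}
    {d w : ℕ} (h : Exec B ω p S M M' d w) : 1 ≤ d := by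
  have hs : ∀ e : Expr, 1 ≤ e.size := fun e => by cases e <;> simp [Expr.size]
  induction h with
  | skip => exact le_rfl
  | write a i e => exact (hs i).trans (Nat.le_add_right _ _)
  | seq _ _ ih => omega
  | @ite e => have := hs e; omega
  | @loopDone e => exact hs e
  | @loopStep e => have := hs e; omega
  | @par e => have := hs e; omega

theorem StoredGraph.card_verts_le {n m : ℕ} (I : StoredGraph n m) : Nat.card I.verts ≤ n := by
  rw [Nat.card_eq_fintype_card, Fintype.card_coe]
  exact (Finset.card_le_univ _).trans_eq (Fintype.card_fin n)

/-- On the part of `I` with vertex set `R`, the program `prog` finds a clustering, with `R'` the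
unclustered vertices. -/
def ClustersTo {n m : ℕ} (I : StoredGraph n m) (prog : Prog) (b : ℕ) (ω : ℕ → Bool) (d w D : ℕ)
    (ξ : ℝ) (R R' : Set I.verts) : Prop :=
  ∃ M d₀ w₀, Exec b ω prog [[]] (I.restrict R).load M d₀ w₀ ∧ d₀ ≤ d ∧ w₀ ≤ w ∧
    ∃ cl T, MemClustering (I.restrict R) M cl T ∧
      IsWeakClustering (I.restrict R).graph cl T 3 D ξ ∧ R' = I.incl R '' {v | cl v = none}

namespace SpannerProg

/-- The loop invariant consists of the phases completed so far and a memory that marks exactly their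
edges. After the loop, `spanner_of_phases` applies. The number `E` bounds the length of each list of
tree edges. -/
theorem main_triple {n m k c U b B d w E D : ℕ} {ξ : ℝ} {I : StoredGraph n m} {prog : Prog}
    {ω' : ℕ → Bool} {ω : ℕ → ℕ → Bool} {R : ℕ → Set I.verts} (hn : 0 < n) (hD : 1 ≤ D) (hc : 2 ≤ c)
    (hcU : c ^ (Nat.log 2 n + 1) = U) (hnU : n + 1 < U) (hmU : m + 1 < U) (hU : 4 < U) (hb : b ≤ U)
    (hB : (Nat.log 2 n + 4) * U ≤ B) (hξ : 0 ≤ ξ) (hE : ξ * n < E + 1)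
    (hω : ∀ p < Nat.log 2 n + 1, ∀ x < b, ω' ((p + 1) * U + x) = ω p x)
    (hk : prog.arrays ≤ k + 11) (hR0 : R 0 = Set.univ)
    (hR : ∀ p < Nat.log 2 n + 1, ClustersTo I prog b (ω p) d w D ξ (R p) (R (p + 1))) :
    Triple B ω' (main k c prog) I.load ((Nat.log 2 n + 1) * (7 * d + 1220))
      ((Nat.log 2 n + 1) * (7 * w + 1060 * (n + m + E + 2))) fun M' =>
        ∃ H, MemSubgraph I M' H ∧ IsSpanner I.graph H (2 * D) ∧
          (H.edgeSet.ncard : ℝ) ≤ 6 * ξ * Nat.card I.verts := by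
  obtain ⟨L, hL⟩ : ∃ L, Nat.log 2 n + 1 = L := ⟨_, rfl⟩
  have hUB : 4 * U ≤ B := (Nat.mul_le_mul_right U (Nat.le_add_left 4 _)).trans hB
  have hpB : ∀ p ≤ L, (p + 2) * U + U ≤ B := fun p hp => by
    refine le_trans ?_ hB
    rw [← Nat.succ_mul]
    exact Nat.mul_le_mul_right U (by omega)
  have hnL : n < 2 ^ L := hL ▸ Nat.lt_pow_succ_log_self one_lt_two n
  have hLn : ∀ p < L, 2 ^ p ≤ n := fun p hp =>
    Nat.lt_succ_iff.1 ((pow_lt_succ_iff hn.ne').2 (hL ▸ hp))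
  have hLn' : 2 ^ L ≤ 2 * n := by
    rw [← hL, pow_succ, mul_comm]
    exact Nat.mul_le_mul_left 2 (hLn _ (by omega))
  let Inv : ℕ → Mem → Prop := fun p M => ∃ P : ℕ → SimpleGraph I.verts,
    (∀ q < p, IsPhase I.graph (P q) (R q) (R (q + 1)) D ξ) ∧
      LiveState I k U p (R p) (fun u v => ∃ q < p, (P q).Adj u v) M
  have hcond : ∀ p ≤ L, ∀ M, Inv p M →
      (cond k).HasValue B ω' M [] (if 2 ^ p < n + 1 then 1 else 0) := by
    rintro p hp M ⟨P, -, hM⟩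
    have : 2 ^ p ≤ 2 ^ L := Nat.pow_le_pow_right (by omega) hp
    exact cond_hasValue hM.num_verts hM.pow (by omega) (by omega) (by omega)
  have hloop := fun M h0 => Triple.loop (B := B) (ω := ω') (e := cond k)
    (p := .seq (loadLive k) <| .seq (prog.shift (k + 11)) <|
      .seq (chooseEdges k) (removeClustered k)) (I := Inv) (L := L) (d := 7 * d + 640)
      (w := 7 * w + 640 * (n + m + E + 2)) (M := M) ?_ ?_ h0
  rotate_left
  · intro p hp M hInv
    refine ⟨⟨1, ?_, one_ne_zero⟩, ?_⟩
    · have := hcond p hp.le M hInv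
      rwa [if_pos ((pow_lt_succ_iff hn.ne').2 (hL ▸ hp))] at this
    · obtain ⟨P, hP, hM⟩ := hInv
      obtain ⟨M₁, d₀, w₀, hex, hd, hw, cl, T, hcl, hC, hR'⟩ := hR p (hL ▸ hp)
      -- The length is an integer and at most `ξ * n < E + 1`.
      have hE' : M₁ 6 1 ≤ E := by
        have h1 := hcl.edges_le hC
        have h2 : ((Nat.card (I.restrict (R p)).verts : ℕ) : ℝ) ≤ n := by
          exact_mod_cast (I.restrict (R p)).card_verts_le
        have h3 : (M₁ 6 1 : ℝ) < (E + 1 : ℕ) := by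
          push_cast
          exact (h1.trans (mul_le_mul_of_nonneg_left h2 hξ)).trans_lt hE
        exact Nat.lt_succ_iff.1 (by exact_mod_cast h3)
      have h2p := hLn p hp
      have hpB' := hpB p hp.le
      refine (phase_triple hn hnU hmU hU hb (B := B) (by omega) (by omega)
        (hω p (hL ▸ hp)) hk hex hcl hC hM).mono (by omega) (by omega) ?_
      rintro M' ⟨Q, hQ, hM'⟩
      -- The family of phase graphs is extended by its new member at index `p`.
      have hup : ∀ q < p, Function.update P p Q q = P q := fun q hq =>
        Function.update_of_ne hq.ne _ _
      refine ⟨Function.update P p Q, ?_, ?_⟩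
      · intro q hq
        rcases Nat.lt_succ_iff_lt_or_eq.1 hq with hq | rfl
        · rw [hup q hq]
          exact hP q hq
        · rw [Function.update_self, hR']
          exact hQ
      · rw [hR']
        have hmark : (fun u v => ∃ q < p + 1, (Function.update P p Q q).Adj u v) =
            fun u v => (∃ q < p, (P q).Adj u v) ∨ Q.Adj u v := by
          funext u v
          refine propext ⟨?_, ?_⟩
          · rintro ⟨q, hq, h⟩
            rcases Nat.lt_succ_iff_lt_or_eq.1 hq with hq | rfl
            · rw [hup q hq] at h
              exact Or.inl ⟨q, hq, h⟩
            · rw [Function.update_self] at h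
              exact Or.inr h
          · rintro (⟨q, hq, h⟩ | h)
            · exact ⟨q, by omega, by rwa [hup q hq]⟩
            · exact ⟨p, by omega, by rwa [Function.update_self]⟩
        rw [hmark]
        exact hM'
  · intro M hInv
    have := hcond L le_rfl M hInv
    rwa [if_neg (by omega)] at this
  have hsize : (cond k).size = 7 := rfl
  rw [hsize] at hloop
  have hld : ∀ a x, I.load a x < U := I.load_lt hn (by omega) (by omega) (by omega)
  rw [hL]
  have hLpos : 1 ≤ L := by omega
  have hd' : 320 + (200 * L + (L * (7 * d + 640 + 7) + 7 + 40)) ≤ L * (7 * d + 1220) := by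
    nlinarith
  have hw' : 160 * (n + m + 2) + (200 * L + (L * (7 * w + 640 * (n + m + E + 2) + 7) + 7 +
      40 * (m + 1))) ≤ L * (7 * w + 1060 * (n + m + E + 2)) := by
    have h1 : n + m + 2 ≤ L * (n + m + 2) := Nat.le_mul_of_pos_left _ hLpos
    have h2 : 0 ≤ L * E := Nat.zero_le _
    nlinarith
  refine Triple.mono (Triple.seq ((copyInput_triple (n := n) (m := m) rfl rfl
    (fun a x => (hld a x).trans (by omega)) (by omega)).mono le_rfl le_rfl ?_)) hd' hw'
    (fun _ h => h)
  rintro M1 ⟨hlow1, h16, h1, h2, h3, h4, hal, hus, hsr, hds⟩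
  refine Triple.seq (((computeUnit_triple hn.ne' h1 h3 h4 hc (by rw [hcU]; omega) (by omega)
    (by omega)).mono (by rw [hL]) (by rw [hL])) ?_)
  rw [hcU]
  rintro M2 ⟨hM2, h0', h1', h2', h3', h4'⟩
  have hne : ∀ a, a ≠ k + 11 → M2 a = M1 a := hM2
  refine Triple.seq ((hloop M2 ?_).mono le_rfl le_rfl ?_)
  · refine ⟨fun _ => ⊥, fun q hq => absurd hq (Nat.not_lt_zero q), ?_⟩
    have h16' : M2 (k + 16) = fun _ => 0 := by
      rw [hne _ (by omega), h16]
      exact funext (I.load_of_five_le (by omega))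
    have hru := I.restrict_univ_load
    constructor
    · rw [h0', zero_add, one_mul]
    · exact h1'
    · rw [h2', h2]
    · rw [h3', pow_zero]
    · exact h4'
    · intro a ha x
      rw [hne _ (by omega), hlow1 a ha, zero_add, one_mul]
      exact hld a x
    · intro x hx
      rw [hne _ (by omega), hal x hx, hR0, hru.1]
    · intro x hx
      rw [hne _ (by omega), hus x hx, hR0, hru.2]
    · intro x hx
      rw [hne _ (by omega), hsr x hx]
    · intro x hx
      rw [hne _ (by omega), hds x hx]
    · intro x
      simp [h16']
    · intro u v
      simp [h16']
  · rintro M3 ⟨P, hP, hM3⟩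
    refine (copyOutput_triple hM3.num_slots (by omega) (by omega) hM3.marks_le).mono le_rfl le_rfl
      fun M4 hM4 => ?_
    let H : SimpleGraph I.verts :=
      { Adj := fun u v => ∃ q < L, (P q).Adj u v
        symm := ⟨fun _ _ ⟨q, hq, h⟩ => ⟨q, hq, h.symm⟩⟩
        loopless := ⟨fun _ ⟨_, _, h⟩ => h.ne rfl⟩ }
    have hcard : Nat.card I.verts < 2 ^ L := I.card_verts_le.trans_lt hnL
    refine ⟨H, fun u v => (hM3.marked u v).symm.trans (exists_congr fun j => ?_),
      spanner_of_phases hD hcard R P hR0 hP fun _ _ => Iff.rfl⟩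
    exact and_congr_right fun h => by rw [hM4 j h.1]

end SpannerProg

/-! ### PRAM: choice of word sizes, cost estimates and probability -/

namespace PramAlg

variable (A : PramAlg)

/-- The unit is `U = (2 ^ (⌊log₂ n⌋ + 1)) ^ (wordExp + 3)`. It is at least `(n + 1) ^ (wordExp +
3)`, which exceeds `n + 1` and `m + 1` and is no less than the old word bound. It is at most `(2 n)
^ (wordExp + 3) ≤ n ^ (2 * (wordExp + 3))`. The last summand `3` of the exponent makes room for
`⌊log₂ n⌋ + 4 ≤ n ^ 3` units. -/
def spannerAlg : PramAlg where
  prog := SpannerProg.main A.prog.arrays (2 ^ (A.wordExp + 3)) A.prog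
  wordExp := 2 * (A.wordExp + 3) + 3

theorem spannerAlg_deterministic (h : A.Deterministic) : A.spannerAlg.Deterministic :=
  SpannerProg.main_noCoin _ _ h

theorem unit_bounds {n m w U : ℕ} (hn : 2 ≤ n) (hm : m ≤ n ^ 2)
    (hU : (2 ^ (w + 3)) ^ (Nat.log 2 n + 1) = U) : n + 1 < U ∧ m + 1 < U ∧ 4 < U ∧ n ^ w ≤ U ∧
      (Nat.log 2 n + 4) * U ≤ n ^ (2 * (w + 3) + 3) := by
  have hU' : U = (2 ^ (Nat.log 2 n + 1)) ^ (w + 3) := by rw [← hU, ← pow_mul, ← pow_mul, mul_comm]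
  have h1 : n + 1 ≤ 2 ^ (Nat.log 2 n + 1) := Nat.lt_pow_succ_log_self one_lt_two n
  have h2 : 2 ^ Nat.log 2 n ≤ n := Nat.pow_log_le_self 2 (by omega)
  have h3 : (n + 1) ^ (w + 3) ≤ U := hU' ▸ Nat.pow_le_pow_left h1 _
  have h4 : (n + 1) ^ 3 ≤ U := (Nat.pow_le_pow_right (by omega) (by omega)).trans h3
  have h5 : n ^ w ≤ U := (Nat.pow_le_pow_left (by omega) w).trans
    ((Nat.pow_le_pow_right (by omega) (by omega)).trans h3)
  have h6 : U ≤ n ^ (2 * (w + 3)) := by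
    rw [hU', pow_mul]
    refine Nat.pow_le_pow_left ?_ _
    rw [pow_succ]
    nlinarith
  have h7 : Nat.log 2 n < n := Nat.log_lt_self 2 (by omega)
  have h8 : Nat.log 2 n + 4 ≤ n ^ 3 := by
    have : n ^ 3 = n * n * n := by ring
    nlinarith [Nat.mul_le_mul hn hn]
  have h9 : (n + 1) ^ 3 = n ^ 3 + 3 * n ^ 2 + 3 * n + 1 := by ring
  refine ⟨by omega, by omega, by omega, h5, ?_⟩
  rw [pow_add, mul_comm (n ^ _)]
  exact Nat.mul_le_mul h8 h6

end PramAlg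

namespace PramAlg

variable {A : PramAlg} {D : ℕ → ℕ} {ξ δ : ℕ → ℝ} {T : ℕ → ℝ} {W : ℕ → ℕ → ℝ}

/-- As the failure probability is below one, some run succeeds on the edgeless graph with `n`
vertices. These bounds let the overhead be absorbed into `T n` and `n * ξ n`, and they justify
rounding down. -/
theorem FindsClusterings.bounds (h : A.FindsClusterings D ξ δ T W) (hδ : ∀ n, δ n < 1) {n m : ℕ}
    (hn : 2 ≤ n) (hm : m ≤ n ^ 2) : 1 / 2 ≤ ξ n ∧ 1 ≤ T n ∧ 0 ≤ W m n := by
  let I : StoredGraph n m :=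
    { verts := Finset.univ
      slot := fun _ => none
      slot_mem := by simp
      slot_unique := by simp }
  obtain ⟨ω, M', ⟨d₀, w₀, hd, hw, hex⟩, cl, S, -, hC⟩ :=
    exists_of_failureProb_lt_one (h n m hn hm I) (hδ n)
  have : Nonempty I.verts := ⟨⟨⟨0, by omega⟩, Finset.mem_univ _⟩⟩
  refine ⟨hC.half_le, le_trans ?_ hd, (Nat.cast_nonneg _).trans hw⟩
  exact_mod_cast hex.one_le_depth

/-- Removing vertices only frees slots: the restricted graph is an input with the same `n` and `m`,
so the same bounds hold. -/
theorem FindsClusterings.failureProb_clustersTo_le (h : A.FindsClusterings D ξ δ T W) {n m : ℕ}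
    (hn : 2 ≤ n) (hm : m ≤ n ^ 2) (I : StoredGraph n m) (R : Set I.verts) :
    failureProb (A.Tape n) (fun ω => ∃ R', ClustersTo I A.prog (A.bound n)
      (fun k => if h : k < A.bound n then ω ⟨k, h⟩ else false) ⌊T n⌋₊ ⌊W m n⌋₊ (D n) (ξ n) R R')
      ≤ δ n := by
  refine (failureProb_mono ?_).trans (h n m hn hm (I.restrict R))
  rintro ω ⟨M', ⟨d₀, w₀, hd, hw, hex⟩, cl, S, hcl, hC⟩
  exact ⟨_, M', d₀, w₀, hex, Nat.le_floor hd, Nat.le_floor hw, cl, S, hcl, hC, rfl⟩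

theorem spannerAlg_depth_le {C L d : ℕ} {l t : ℝ} (hC : 3700 ≤ C) (hL : (L : ℝ) ≤ 3 * l)
    (ht : 1 ≤ t) (hd : (d : ℝ) ≤ t) : ((L * (7 * d + 1220) : ℕ) : ℝ) ≤ C * (l * t) := by
  have hl : 0 ≤ l := by linarith [(Nat.cast_nonneg L : (0 : ℝ) ≤ L)]
  have hC' : (3700 : ℝ) ≤ C := by exact_mod_cast hC
  push_cast
  calc (L : ℝ) * (7 * d + 1220) ≤ 3 * l * (1227 * t) :=
        mul_le_mul hL (by linarith) (by positivity) (by positivity)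
    _ = 3681 * (l * t) := by ring
    _ ≤ C * (l * t) := mul_le_mul_of_nonneg_right (by linarith) (by positivity)

/-- Since `ξ ≥ 1/2`, both `n` and `2` are at most `2 n ξ`, and `E ≤ n ξ`. So the overhead is at most
`1060 * (m + 5 n ξ)`, and `3 * 5300 = 15900`. -/
theorem spannerAlg_work_le {C L w n m E : ℕ} {l W ξ : ℝ} (hC : 16000 ≤ C) (hL : (L : ℝ) ≤ 3 * l)
    (hn : 2 ≤ n) (hξ : 1 / 2 ≤ ξ) (hW : 0 ≤ W) (hw : (w : ℝ) ≤ W) (hE : (E : ℝ) ≤ ξ * n) :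
    ((L * (7 * w + 1060 * (n + m + E + 2)) : ℕ) : ℝ) ≤ C * (l ^ 1 * (W + m + n * ξ)) := by
  have hl : 0 ≤ l := by linarith [(Nat.cast_nonneg L : (0 : ℝ) ≤ L)]
  have hC' : (16000 : ℝ) ≤ C := by exact_mod_cast hC
  have hn' : (2 : ℝ) ≤ n := by exact_mod_cast hn
  have hm : (0 : ℝ) ≤ m := Nat.cast_nonneg m
  have h1 : (n : ℝ) ≤ 2 * (n * ξ) := by nlinarith
  have hX : 0 ≤ W + m + n * ξ := by linarith
  push_cast
  rw [pow_one]
  calc (L : ℝ) * (7 * w + 1060 * (n + m + E + 2)) ≤ 3 * l * (5300 * (W + m + n * ξ)) :=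
        mul_le_mul hL (by linarith) (by positivity) (by positivity)
    _ = 15900 * (l * (W + m + n * ξ)) := by ring
    _ ≤ C * (l * (W + m + n * ξ)) := mul_le_mul_of_nonneg_right (by linarith) (by positivity)

/-- The block of random bits for phase number `p`. -/
def phaseBits (b U B p : ℕ) (hB : 0 < B) (y : Fin b) : Fin B :=
  -- The blocks start at the multiples of `U`, because the shifted program uses its base as offset
  -- for the random bits. The reduction never acts in the phases that are run.
  ⟨((p + 1) * U + y) % B, Nat.mod_lt _ hB⟩

theorem val_phaseBits {b U B p L : ℕ} (hB : 0 < B) (hb : b ≤ U) (hL : (L + 1) * U ≤ B) (hp : p < L)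
    (y : Fin b) : (phaseBits b U B p hB y : ℕ) = (p + 1) * U + y := by
  refine Nat.mod_eq_of_lt (lt_of_lt_of_le ?_ hL)
  have h1 : (p + 1) * U + U ≤ (L + 1) * U := by
    rw [← Nat.succ_mul]
    exact Nat.mul_le_mul_right U (by omega)
  have := y.2
  omega

theorem spannerAlg_buildsSpanners {C : ℕ} (hC : 16000 ≤ C) (hD : ∀ n, 1 ≤ D n)
    (hδ : ∀ n, δ n < 1) (h : A.FindsClusterings D ξ δ T W) :
    A.spannerAlg.BuildsSpanners (fun n => C * D n) (fun n => C * ξ n)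
      (fun n => (Nat.log 2 n + 1) * δ n) (fun n => C * (Real.log n * T n))
      (fun m n => C * (Real.log n ^ 1 * (W m n + m + n * ξ n))) := by
  classical
  intro n m hn hm I
  obtain ⟨hξ, hT, hW⟩ := h.bounds hδ hn hm
  obtain ⟨U, hU⟩ : ∃ U, (2 ^ (A.wordExp + 3)) ^ (Nat.log 2 n + 1) = U := ⟨_, rfl⟩
  obtain ⟨hnU, hmU, hU4, hbU, hUB⟩ := unit_bounds hn hm hU
  obtain ⟨B, hBdef⟩ : ∃ B, A.spannerAlg.bound n = B := ⟨_, rfl⟩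
  have hB : (Nat.log 2 n + 4) * U ≤ B := hBdef ▸ hUB
  have hBpos : 0 < B := hBdef ▸ Nat.pow_pos (by omega)
  obtain ⟨L, hL⟩ : ∃ L, Nat.log 2 n + 1 = L := ⟨_, rfl⟩
  have hLU : (L + 1) * U ≤ B := (Nat.mul_le_mul_right U (by omega)).trans hB
  let E : Set I.verts → A.Tape n → Set I.verts → Prop := fun R ω R' =>
    ClustersTo I A.prog (A.bound n) (fun k => if h : k < A.bound n then ω ⟨k, h⟩ else false)
      ⌊T n⌋₊ ⌊W m n⌋₊ (D n) (ξ n) R R'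
  -- After a failure the next live set is irrelevant; keeping `R` makes the process total.
  let step : Set I.verts → A.Tape n → Set I.verts := fun R ω =>
    if h : ∃ R', E R ω R' then h.choose else R
  let ι : ℕ → Fin (A.bound n) → Fin B := fun p => phaseBits (A.bound n) U B p hBpos
  have hι : ∀ p < L, ∀ y, (ι p y : ℕ) = (p + 1) * U + y := fun p hp y =>
    val_phaseBits hBpos hbU hLU hp y
  have key := failureProb_blockRun_le (ι := ι) (L := L) (δ := δ n) ?_ ?_ step Set.univ
    (fun R ω => ∃ R', E R ω R') (fun R => h.failureProb_clustersTo_le hn hm I R)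
  rotate_left
  · intro p hp y y' hyy
    have h1 := congrArg Fin.val hyy
    rw [hι p hp, hι p hp] at h1
    exact Fin.ext (by omega)
  · intro p hp q hq y y' hyy
    have h1 := congrArg Fin.val hyy
    rw [hι p hp, hι q (hq.trans hp)] at h1
    have h2 : (q + 1) * U + U ≤ (p + 1) * U := by
      rw [← Nat.succ_mul]
      exact Nat.mul_le_mul_right U (by omega)
    have h3 : (y' : ℕ) < U := y'.2.trans_le hbU
    omega
  have hLδ : (L : ℝ) * δ n = (Nat.log 2 n + 1) * δ n := by rw [← hL]; push_cast; rfl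
  rw [hLδ] at key
  refine le_trans ?_ key
  subst hBdef
  refine failureProb_mono fun ω hω => ?_
  let ω' : ℕ → Bool := fun k => if h : k < A.spannerAlg.bound n then ω ⟨k, h⟩ else false
  have hmain := SpannerProg.main_triple (n := n) (m := m) (k := A.prog.arrays)
    (B := A.spannerAlg.bound n) (ω' := ω') (I := I) (prog := A.prog) (E := ⌊ξ n * n⌋₊) (d := ⌊T n⌋₊)
    (w := ⌊W m n⌋₊) (ξ := ξ n) (R := blockRun ι step Set.univ ω)
    (ω := fun p k => if h : k < A.bound n then (ω ∘ ι p) ⟨k, h⟩ else false)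
    (by omega) (hD n) (Nat.le_self_pow (by omega) 2) hU hnU hmU hU4 hbU hB (by linarith)
    (Nat.lt_floor_add_one _) ?_ (by omega) rfl ?_
  rotate_left
  · intro p hp x hx
    have hval := hι p (hL ▸ hp) ⟨x, hx⟩
    have hlt := (ι p ⟨x, hx⟩).2
    rw [hval] at hlt
    change dite _ _ _ = dite _ _ _
    rw [dif_pos hlt, dif_pos (show x < A.bound n from hx)]
    exact congrArg ω (Fin.ext hval.symm)
  · intro p hp
    have hs := hω p (hL ▸ hp)
    have : blockRun ι step Set.univ ω (p + 1) = hs.choose := dif_pos hs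
    rw [this]
    exact hs.choose_spec
  obtain ⟨M', d', w', hex, hd, hw, H, hH, hsp, hcard⟩ := hmain
  have hlog : ((Nat.log 2 n + 1 : ℕ) : ℝ) ≤ 3 * Real.log n := CongestAlg.natLog_add_one_le hn
  have hC' : (16000 : ℝ) ≤ C := by exact_mod_cast hC
  refine ⟨M', ⟨d', w', ?_, ?_, hex⟩, H, hH, ?_, ?_⟩
  · exact (Nat.cast_le.2 hd).trans
      (spannerAlg_depth_le (by omega) hlog hT (Nat.floor_le (by linarith)))
  · exact (Nat.cast_le.2 hw).trans (spannerAlg_work_le hC hlog hn hξ hW (Nat.floor_le hW)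
      (Nat.floor_le (by positivity)))
  · refine ⟨hsp.1, fun u v => (hsp.2 u v).trans ?_⟩
    have : 2 * D n ≤ C * D n := Nat.mul_le_mul_right _ (by omega)
    gcongr
  · rw [Nat.card_eq_fintype_card, Fintype.card_coe] at hcard
    refine hcard.trans (mul_le_mul_of_nonneg_right ?_ (Nat.cast_nonneg _))
    nlinarith

end PramAlg

end

end SpannersViaClusterings

/-! ### The theorem for all three models -/

theorem mainTheorem7 :
    ∃ C k : ℕ,
      ∀ (D : ℕ → ℕ) (ξ δ : ℕ → ℝ), (∀ n, 1 ≤ D n) → (∀ n, δ n < 1) →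
      -- CONGEST, on graphs
      (∀ a : ℕ, 1 ≤ a → ∀ A : CongestAlg ClusteringOut, A.FindsClusterings a 0 D ξ δ →
        ∃ A' : CongestAlg (Set ℕ),
          A'.BuildsSpanners a 0 (fun n => C * D n) (fun n => C * ξ n)
            (fun n => (Nat.log 2 n + 1) * δ n) ∧
          (A.Deterministic → A'.Deterministic) ∧
          ∀ T : ℕ → ℝ, (∀ n, 1 ≤ T n) → (∀ n, (A.rounds n 0 : ℝ) ≤ T n) →
            ∀ n, 2 ≤ n → (A'.rounds n 0 : ℝ) ≤ C * (Real.log n * T n)) ∧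
      -- CONGEST, on cluster graphs
      (∀ a : ℕ, 1 ≤ a → ∀ A : CongestAlg ClusteringOut, (∀ r, A.FindsClusterings a r D ξ δ) →
        ∃ A' : CongestAlg (Set ℕ),
          (∀ r, A'.BuildsSpanners a r (fun n => C * D n) (fun n => C * ξ n)
            (fun n => (Nat.log 2 n + 1) * δ n)) ∧
          (A.Deterministic → A'.Deterministic) ∧
          ∀ T : ℕ → ℕ → ℝ, (∀ n r, 1 ≤ T n r) → (∀ n r, (A.rounds n r : ℝ) ≤ T n r) →
            ∀ n r, 2 ≤ n → (A'.rounds n r : ℝ) ≤ C * (Real.log n * (T n r + r))) ∧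
      -- PRAM
      (∀ (A : PramAlg) (T : ℕ → ℝ) (W : ℕ → ℕ → ℝ), A.FindsClusterings D ξ δ T W →
        ∃ A' : PramAlg,
          A'.BuildsSpanners (fun n => C * D n) (fun n => C * ξ n)
            (fun n => (Nat.log 2 n + 1) * δ n)
            (fun n => C * (Real.log n * T n))
            (fun m n => C * (Real.log n ^ k * (W m n + m + n * ξ n))) ∧
          (A.Deterministic → A'.Deterministic)) := by
  -- The PRAM work bound dictates the constant `16000`, and one logarithmic factor suffices.
  refine ⟨16000, 1, fun D ξ δ hD hδ => ⟨?_, ?_, ?_⟩⟩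
  · intro a _ A hA
    refine ⟨A.spannerAlg a, CongestAlg.spannerAlg_buildsSpanners (by norm_num) hD hA,
      CongestAlg.spannerAlg_deterministic a, fun T hT hA n hn => ?_⟩
    have := CongestAlg.spannerAlg_rounds_le A a (C := 16000) (r := 0) (by norm_num) hn (hT n) (hA n)
    simpa using this
  · intro a _ A hA
    exact ⟨A.spannerAlg a,
      fun r => CongestAlg.spannerAlg_buildsSpanners (by norm_num) hD (hA r),
      CongestAlg.spannerAlg_deterministic a, fun T hT hA n r hn =>
        CongestAlg.spannerAlg_rounds_le A a (by norm_num) hn (hT n r) (hA n r)⟩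
  · intro A T W hA
    exact ⟨A.spannerAlg, PramAlg.spannerAlg_buildsSpanners le_rfl hD hδ hA,
      A.spannerAlg_deterministic⟩
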